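/- **Setting.** Fix a finite set $\mathsf{Tid}$ of threads, a set $\mathsf{Loc}$ of locations and a set $\mathsf{Val}$ of values with a distinguished element $0$. An *event label* is $\mathtt R(x,v_R)$, $\mathtt W(x,v_W)$ or $\mathtt{RMW}(x,v_R,v_W)$ with $x\in\mathsf{Loc}$ and $v_R,v_W\in\mathsf{Val}$. A *behavior* $\beta$ assigns to every thread a finite or infinite sequence of event labels. A finite or infinite sequence over $\mathsf{Tid}\times\{\text{event labels}\}$ induces the behavior that maps $\tau$ to the sequence of labels paired with $\tau$. **Operational side.** A *memory system* $\mathcal M$ is a labeled transition system with an initial state, observable labels $\tau{:}l$ ($\tau\in\mathsf{Tid}$, $l$ an event label) and a set of silent labels. A *run* is a finite or infinite sequence of consecutive transitions from the initial state. A run is *memory-fair* if it is finite, or for every silent label $\theta$ and index $k$ such that $\theta$ is enabled in the source of the $j$-th transition for all $j\ge k$, some $j$-th transition with $j\ge k$ has label $\theta$. $\mathrm{Beh}_{\mathrm{mf}}(\mathcal M)$ is the set of behaviors induced by the sequences of observable labels of memory-fair runs. The four systems are: - $\mathcal M_{\mathsf{SC}}$: the state is $M:\mathsf{Loc}\to\mathsf{Val}$,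 initially constantly $0$; there are no silent labels. $\mathtt W(x,v)$ sets $M(x):=v$; $\mathtt R(x,v)$ requires $M(x)=v$; $\mathtt{RMW}(x,v_R,v_W)$ performs $\mathtt R(x,v_R)$ and then $\mathtt W(x,v_W)$ atomically. - $\mathcal M_{\mathsf{TSO}}$: the state is a memory $M$, initially constantly $0$, and a FIFO buffer of pairs in $\mathsf{Loc}\times\mathsf{Val}$ per thread, initially empty. $\tau{:}\mathtt W(x,v)$ adds $(x,v)$ to the buffer of $\tau$; $\tau{:}\mathtt R(x,v)$ requires that $v$ is the value of $x$ after applying the buffer of $\tau$, oldest entry first, to $M$; $\tau{:}\mathtt{RMW}(x,v_R,v_W)$ requires an empty buffer of $\tau$ and $M(x)=v_R$, and sets $M(x):=v_W$. The silent label $\mathtt{prop}(\tau)$ removes the oldest entry of the buffer of $\tau$ and applies it to $M$. - $\mathcal M_{\mathsf{RA}}$: the state is a set $M$ of messages $\langle x,v,t,V\rangle$ (location, value, timestamp $t\in\mathbb N$, view $V:\mathsf{Loc}\to\mathbb N$) and a view $T(\tau)$ per thread. Initially $M=\{\langle x,0,0,\lambda y.0\rangle: x\in\mathsf{Loc}\}$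 and all views are $0$. $\tau{:}\mathtt W(x,v)$ picks $t>T(\tau)(x)$ not used by any message of $x$ in $M$, sets $T(\tau)(x):=t$ and adds $\langle x,v,t,T(\tau)\rangle$ (with the updated view) to $M$; $\tau{:}\mathtt R(x,v)$ picks $\langle x,v,t,V\rangle\in M$ with $T(\tau)(x)\le t$ and sets $T(\tau):=T(\tau)\sqcup V$ (pointwise maximum); $\tau{:}\mathtt{RMW}(x,v_R,v_W)$ performs $\mathtt R(x,v_R)$ and then $\mathtt W(x,v_W)$ atomically, where the write increases $T(\tau)(x)$ by exactly $1$. The silent label $\mathtt{prop}(\tau,m)$, enabled if $m\in M$ has location $x$ and timestamp $t>T(\tau)(x)$, sets $T(\tau)(x):=t$. - $\mathcal M_{\mathsf{StrongCOH}}$: as $\mathcal M_{\mathsf{RA}}$, except that reading $\langle x,v,t,V\rangle$ (also inside an $\mathtt{RMW}$) only sets $T(\tau)(x):=t$. **Declarative side.** An *event* is a triple of a serial number in $\mathbb N\cup\{\bot\}$, a thread in $\mathsf{Tid}\cup\{\bot\}$ and an event label. Let $\mathsf{Init}=\{\langle\bot,\bot,\mathtt W(x,0)\rangle:x\in\mathsf{Loc}\}$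 and $\mathsf{Event}(\beta)=\mathsf{Init}\cup\{\langle k,\tau,\beta(\tau)(k)\rangle:\tau\in\mathsf{Tid},\,k\in\mathrm{dom}(\beta(\tau))\}$. A set $E\supseteq\mathsf{Init}$ of events is *well-formed* if every event of $E\setminus\mathsf{Init}$ has thread and serial number different from $\bot$ and is determined in $E\setminus\mathsf{Init}$ by these two, and if, for every event of $E\setminus\mathsf{Init}$ with serial number $n$ and every $k<n$, $E$ contains an event of the same thread with serial number $k$. Let $\mathtt R$ (resp. $\mathtt W$) be the set of events labeled by a read (resp. write) or a read-modify-write, and $\mathtt{RMW}=\mathtt R\cap\mathtt W$. An *execution graph* $G=\langle E,\mathit{rf},\mathit{mo}\rangle$ consists of a well-formed set $E$; a relation $\mathit{rf}$ on $E$ that relates elements of $\mathtt W$ to elements of $\mathtt R$ with the same location such that the value written equals the value read, and in which every element of $E\cap\mathtt R$ has exactly one predecessor; and a relation $\mathit{mo}$ that is the disjoint union over $x\in\mathsf{Loc}$ of strict total orders on the elements of $E\cap\mathtt W$ with location $x$. Put - $\mathit{po}=\{(a,b)\in E^2: (a\in\mathsf{Init}\wedge b\notin\mathsf{Init})$, or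 $a,b$ are non-initialization events of the same thread and the serial number of $a$ is smaller than that of $b\}$; - $\mathit{fr}=(\mathit{rf}^{-1};\mathit{mo})\setminus\mathrm{id}_E$, $\ \mathit{rfe}=\mathit{rf}\setminus\mathit{po}$, $\ \mathit{ppo}=\mathit{po}\setminus((\mathtt W\setminus\mathtt{RMW})\times(\mathtt R\setminus\mathtt{RMW}))$, $\ \mathit{hb}=(\mathit{po}\cup\mathit{rf})^+$; and write $S|_{\mathtt{loc}}$ for the restriction of a relation $S$ to pairs of events with the same location. Then - $G\in\mathcal G_{\mathsf{SC}}$ iff $(\mathit{po}\cup\mathit{rf}\cup\mathit{mo}\cup\mathit{fr})^+$ is irreflexive; - $G\in\mathcal G_{\mathsf{TSO}}$ iff $(\mathit{ppo}\cup\mathit{rfe}\cup\mathit{mo}\cup\mathit{fr})^+$ and $(\mathit{po}|_{\mathtt{loc}}\cup\mathit{rf}\cup\mathit{mo}\cup\mathit{fr})^+$ are irreflexive; - $G\in\mathcal G_{\mathsf{RA}}$ iff $(\mathit{hb}|_{\mathtt{loc}}\cup\mathit{rf}\cup\mathit{mo}\cup\mathit{fr})^+$ is irreflexive; - $G\in\mathcal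 G_{\mathsf{StrongCOH}}$ iff $\mathit{hb}$ and $(\mathit{po}|_{\mathtt{loc}}\cup\mathit{rf}\cup\mathit{mo}\cup\mathit{fr})^+$ are irreflexive. $G$ is *fair* if $\mathit{mo}$ and $\mathit{fr}$ are prefix-finite, i.e. $\{a:(a,b)\in\mathit{mo}\}$ and $\{a:(a,b)\in\mathit{fr}\}$ are finite for every $b\in E$. Let $\mathcal G_X^{\mathtt{fair}}$ be the set of fair graphs in $\mathcal G_X$, and for a set $\mathcal G$ of execution graphs let $\mathrm{Beh}(\mathcal G)$ be the set of behaviors $\beta$ with $\mathsf{Event}(\beta)=E$ for some $\langle E,\mathit{rf},\mathit{mo}\rangle\in\mathcal G$. **Theorem.** For every $X\in\{\mathsf{SC},\mathsf{TSO},\mathsf{RA},\mathsf{StrongCOH}\}$, $$\mathrm{Beh}_{\mathrm{mf}}(\mathcal M_X)=\mathrm{Beh}(\mathcal G_X^{\mathtt{fair}}).$$ -/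

import Mathlib

namespace FairMM

universe u v w

/-! ### Sequences

A finite or infinite sequence is a `Stream'.Seq`; `s.get? k = some a` says that `k` is in the domain
of `s` and `s(k) = a`, and `s.Terminates` says that `s` is finite. -/

theorem exists_count_eq (P : ℕ → Prop) [DecidablePred P] (k : ℕ) :
    ∀ n, k < Nat.count P n → ∃ m, P m ∧ Nat.count P m = k := by
  intro n
  induction n with
  | zero => intro h; simp at h
  | succ n ih =>
    intro h
    by_cases hk : k < Nat.count P n
    · exact ih hk
    · rw [Nat.count_succ] at h
      by_cases hP : P n
      · refine ⟨n, hP, ?_⟩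
        simp [hP] at h
        omega
      · simp [hP] at h
        omega

/-- Index `n` of `s` carries an element that is kept by the partial function `f`. -/
def Kept {α : Type u} {β : Type v} (f : α → Option β) (s : Stream'.Seq α) (n : ℕ) : Prop :=
  ((s.get? n).bind f).isSome

open Classical in
/-- The subsequence of `s` formed by the elements on which the partial function `f` is defined,
mapped by `f`: its `k`-th element comes from the index `n` that is kept and has exactly `k` kept
indices before it (there is at most one such `n`). -/
noncomputable def subseq {α : Type u} {β : Type v} (f : α → Option β) (s : Stream'.Seq α) :
    Stream'.Seq β :=
  ⟨fun k => if h : ∃ n, Kept f s n ∧ Nat.count (Kept f s) n = k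
      then (s.get? h.choose).bind f else none, by
    intro k hk
    by_cases h : ∃ n, Kept f s n ∧ Nat.count (Kept f s) n = k
    · have h1 : Kept f s h.choose := h.choose_spec.1
      have h2 : (s.get? h.choose).bind f = none := by
        have hk' : (if h : ∃ n, Kept f s n ∧ Nat.count (Kept f s) n = k
          then (s.get? h.choose).bind f else none) = none := hk
        rwa [dif_pos h] at hk'
      have h3 : ((s.get? h.choose).bind f).isSome = true := h1
      exact absurd h3 (by simp [h2])
    · have h' : ¬ ∃ n, Kept f s n ∧ Nat.count (Kept f s) n = k + 1 := by
        rintro ⟨n, -, hn⟩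
        exact h (exists_count_eq (Kept f s) k n (by omega))
      exact dif_neg h'⟩

/-! ### Labeled transition systems -/

/-- An LTS with states `Q`, observable labels `Obs` and silent labels `Sil`. -/
structure LTS (Q : Type u) (Obs : Type v) (Sil : Type w) where
  init : Q
  step : Q → Obs ⊕ Sil → Q → Prop

/-- A triple source, label, target. -/
structure Transition (Q : Type u) (Obs : Type v) (Sil : Type w) where
  src : Q
  tlab : Obs ⊕ Sil
  tgt : Q

section LTS

variable {Q : Type u} {Obs : Type v} {Sil : Type w}

/-- The label `σ` is enabled in the state `q`. -/
def LTS.Enabled (A : LTS Q Obs Sil) (q : Q) (σ : Obs ⊕ Sil) : Prop :=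
  ∃ q', A.step q σ q'

/-- `μ` is a (finite or infinite) run of `A`. -/
structure LTS.IsRun (A : LTS Q Obs Sil) (μ : Stream'.Seq (Transition Q Obs Sil)) : Prop where
  trans : ∀ k t, μ.get? k = some t → A.step t.src t.tlab t.tgt
  start : ∀ t, μ.get? 0 = some t → t.src = A.init
  link : ∀ k t t', μ.get? k = some t → μ.get? (k + 1) = some t' → t.tgt = t'.src

/-- The trace induced by a run. -/
def trace (μ : Stream'.Seq (Transition Q Obs Sil)) : Stream'.Seq (Obs ⊕ Sil) :=
  μ.map Transition.tlab

/-- The observable trace induced by a run: the restriction of its trace to observable labels. -/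
noncomputable def obsTrace (μ : Stream'.Seq (Transition Q Obs Sil)) : Stream'.Seq Obs :=
  subseq Sum.getLeft? (trace μ)

/-- The silent label `θ` is continuously enabled in the infinite run `μ` at index `k`. -/
def LTS.ContEnabledAt (A : LTS Q Obs Sil) (μ : Stream'.Seq (Transition Q Obs Sil)) (θ : Sil)
    (k : ℕ) : Prop :=
  ∀ j, k ≤ j → ∃ t, μ.get? j = some t ∧ A.Enabled t.src (Sum.inr θ)

/-- Memory fairness of a run: it is finite, or every silent label that is continuously enabled at
some index `k` is taken at some index `j ≥ k`. -/
def LTS.MemoryFair (A : LTS Q Obs Sil) (μ : Stream'.Seq (Transition Q Obs Sil)) : Prop :=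
  μ.Terminates ∨
    ∀ (θ : Sil) (k : ℕ), A.ContEnabledAt μ θ k →
      ∃ j t, k ≤ j ∧ μ.get? j = some t ∧ t.tlab = Sum.inr θ

end LTS

/-! ### Event labels and behaviors -/

/-- Event labels: read `R(x, v_R)`, write `W(x, v_W)`, read-modify-write `RMW(x, v_R, v_W)`. -/
inductive ELab (Loc : Type u) (Val : Type v) where
  | read (x : Loc) (vR : Val)
  | write (x : Loc) (vW : Val)
  | rmw (x : Loc) (vR vW : Val)

section ELab

variable {Loc : Type u} {Val : Type v}

def ELab.loc : ELab Loc Val → Loc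
  | .read x _ => x
  | .write x _ => x
  | .rmw x _ _ => x

def ELab.valR : ELab Loc Val → Option Val
  | .read _ vR => some vR
  | .write _ _ => none
  | .rmw _ vR _ => some vR

def ELab.valW : ELab Loc Val → Option Val
  | .read _ _ => none
  | .write _ vW => some vW
  | .rmw _ _ vW => some vW

/-- The label is a read or a read-modify-write. -/
def ELab.IsR : ELab Loc Val → Prop
  | .read _ _ => True
  | .write _ _ => False
  | .rmw _ _ _ => True

/-- The label is a write or a read-modify-write. -/
def ELab.IsW : ELab Loc Val → Prop
  | .read _ _ => False
  | .write _ _ => True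
  | .rmw _ _ _ => True

/-- The label is a read-modify-write. -/
def ELab.IsRMW : ELab Loc Val → Prop
  | .read _ _ => False
  | .write _ _ => False
  | .rmw _ _ _ => True

end ELab

/-- A behavior assigns a finite or infinite sequence of event labels to every thread. -/
abbrev Behavior (Tid : Type w) (Loc : Type u) (Val : Type v) :=
  Tid → Stream'.Seq (ELab Loc Val)

/-- The behavior induced by a concurrent trace. -/
noncomputable def behOf {Tid : Type w} {Loc : Type u} {Val : Type v} [DecidableEq Tid]
    (ρ : Stream'.Seq (Tid × ELab Loc Val)) : Behavior Tid Loc Val :=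
  fun τ => subseq (fun σ => if σ.1 = τ then some σ.2 else none) ρ

/-- The memory-fair behaviors of a memory system. -/
def BehMF {Tid : Type*} {Loc : Type*} {Val : Type*} {Q : Type*} {Sil : Type*} [DecidableEq Tid]
    (A : LTS Q (Tid × ELab Loc Val) Sil) : Set (Behavior Tid Loc Val) :=
  {β | ∃ μ, A.IsRun μ ∧ A.MemoryFair μ ∧ β = behOf (obsTrace μ)}

/-! ### Operational memory systems -/

section Operational

variable {Tid : Type w} {Loc : Type u} {Val : Type v} [DecidableEq Loc]

/-! #### Sequential consistency -/

def scRead (x : Loc) (a : Val) (M M' : Loc → Val) : Prop :=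
  M x = a ∧ M' = M

def scWrite (x : Loc) (a : Val) (M M' : Loc → Val) : Prop :=
  M' = Function.update M x a

def scStep (M : Loc → Val) : (Tid × ELab Loc Val) ⊕ Empty → (Loc → Val) → Prop
  | .inl (_, .write x a), M' => scWrite x a M M'
  | .inl (_, .read x a), M' => scRead x a M M'
  | .inl (_, .rmw x vR vW), M' => ∃ M₁, scRead x vR M M₁ ∧ scWrite x vW M₁ M'
  | .inr _, _ => False

variable (Tid Loc Val) in
/-- The memory system for SC. -/
def memSC [Zero Val] : LTS (Loc → Val) (Tid × ELab Loc Val) Empty where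
  init := fun _ => 0
  step := scStep

/-! #### Total store order -/

/-- A memory and, for every thread, a store buffer (newest entry at the head of the list). -/
structure TSOState (Tid : Type w) (Loc : Type u) (Val : Type v) where
  mem : Loc → Val
  buf : Tid → List (Loc × Val)

/-- The memory obtained by applying all the entries of a buffer, oldest first. -/
def applyBuffer (M : Loc → Val) (b : List (Loc × Val)) : Loc → Val :=
  b.foldr (fun p M' => Function.update M' p.1 p.2) M

/-- The silent label `τ` stands for `prop(τ)`. -/
def tsoStep [DecidableEq Tid] (q : TSOState Tid Loc Val) :
    (Tid × ELab Loc Val) ⊕ Tid → TSOState Tid Loc Val → Prop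
  | .inl (τ, .write x a), q' => q' = ⟨q.mem, Function.update q.buf τ ((x, a) :: q.buf τ)⟩
  | .inl (τ, .read x a), q' => applyBuffer q.mem (q.buf τ) x = a ∧ q' = q
  | .inl (τ, .rmw x vR vW), q' =>
      q.buf τ = [] ∧ q.mem x = vR ∧ q' = ⟨Function.update q.mem x vW, q.buf⟩
  | .inr τ, q' => ∃ (b : List (Loc × Val)) (x : Loc) (a : Val), q.buf τ = b ++ [(x, a)] ∧
      q' = ⟨Function.update q.mem x a, Function.update q.buf τ b⟩

variable (Tid Loc Val) in
/-- The memory system for TSO. -/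
def memTSO [DecidableEq Tid] [Zero Val] : LTS (TSOState Tid Loc Val) (Tid × ELab Loc Val) Tid where
  init := ⟨fun _ => 0, fun _ => []⟩
  step := tsoStep

/-! #### Release/acquire and strong coherence -/

/-- Views assign a timestamp to every location; `⊔` on views is the pointwise maximum. -/
abbrev View (Loc : Type u) := Loc → ℕ

structure Msg (Loc : Type u) (Val : Type v) where
  loc : Loc
  val : Val
  ts : ℕ
  view : View Loc

/-- A set of messages and, for every thread, its view. -/
structure VState (Tid : Type w) (Loc : Type u) (Val : Type v) where
  mem : Set (Msg Loc Val)
  tview : Tid → View Loc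

section

variable [DecidableEq Tid]

def viewWrite (τ : Tid) (x : Loc) (a : Val) (q q' : VState Tid Loc Val) : Prop :=
  ∃ t : ℕ, (¬ ∃ m ∈ q.mem, m.loc = x ∧ m.ts = t) ∧ q.tview τ x < t ∧
    q'.tview = Function.update q.tview τ (Function.update (q.tview τ) x t) ∧
    q'.mem = q.mem ∪ {⟨x, a, t, q'.tview τ⟩}

/-- A read step; `upd V m` is the view of a thread with view `V` after it has read the message `m`.
-/
def viewRead (upd : View Loc → Msg Loc Val → View Loc) (τ : Tid) (x : Loc) (a : Val)
    (q q' : VState Tid Loc Val) : Prop :=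
  ∃ m ∈ q.mem, m.loc = x ∧ m.val = a ∧ q.tview τ x ≤ m.ts ∧
    q' = ⟨q.mem, Function.update q.tview τ (upd (q.tview τ) m)⟩

/-- The silent label `(τ, m)` stands for `prop(τ, m)`. -/
def viewStep (upd : View Loc → Msg Loc Val → View Loc) (q : VState Tid Loc Val) :
    (Tid × ELab Loc Val) ⊕ (Tid × Msg Loc Val) → VState Tid Loc Val → Prop
  | .inl (τ, .write x a), q' => viewWrite τ x a q q'
  | .inl (τ, .read x a), q' => viewRead upd τ x a q q'
  | .inl (τ, .rmw x vR vW), q' => ∃ q₁, viewRead upd τ x vR q q₁ ∧ viewWrite τ x vW q₁ q' ∧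
      q'.tview τ x = q₁.tview τ x + 1
  | .inr (τ, m), q' => m ∈ q.mem ∧ q.tview τ m.loc < m.ts ∧
      q' = ⟨q.mem, Function.update q.tview τ (Function.update (q.tview τ) m.loc m.ts)⟩

/-- Initially there is one message `⟨x : 0 @ 0, V₀⟩` for every location, and all views are `V₀`. -/
def viewInit [Zero Val] : VState Tid Loc Val where
  mem := {m | ∃ x : Loc, m = ⟨x, 0, 0, fun _ => 0⟩}
  tview := fun _ _ => 0

variable (Tid Loc Val) in
/-- The memory system for RA: a read joins the view of the message into the view of the thread. -/
def memRA [Zero Val] : LTS (VState Tid Loc Val) (Tid × ELab Loc Val) (Tid × Msg Loc Val) where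
  init := viewInit
  step := viewStep (fun V m => V ⊔ m.view)

variable (Tid Loc Val) in
/-- The memory system for StrongCOH: a read only records the timestamp of the message. -/
def memStrongCOH [Zero Val] :
    LTS (VState Tid Loc Val) (Tid × ELab Loc Val) (Tid × Msg Loc Val) where
  init := viewInit
  step := viewStep (fun V m => Function.update V m.loc m.ts)

end

end Operational

/-! ### Events and execution graphs -/

/-- Events; the value `none` of the serial number and of the thread identifier stands for `⊥`. -/
@[ext]
structure Event (Tid : Type w) (Loc : Type u) (Val : Type v) where
  sn : Option ℕ
  tid : Option Tid
  lab : ELab Loc Val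

section Events

variable {Tid : Type w} {Loc : Type u} {Val : Type v}

abbrev Event.loc (e : Event Tid Loc Val) : Loc := e.lab.loc
abbrev Event.valR (e : Event Tid Loc Val) : Option Val := e.lab.valR
abbrev Event.valW (e : Event Tid Loc Val) : Option Val := e.lab.valW
abbrev Event.IsR (e : Event Tid Loc Val) : Prop := e.lab.IsR
abbrev Event.IsW (e : Event Tid Loc Val) : Prop := e.lab.IsW
abbrev Event.IsRMW (e : Event Tid Loc Val) : Prop := e.lab.IsRMW

variable (Tid Loc Val) in
/-- The set of initialization events. -/
def Init [Zero Val] : Set (Event Tid Loc Val) :=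
  {e | ∃ x : Loc, e = ⟨none, none, .write x 0⟩}

/-- Sequenced-before. -/
def seqBefore [Zero Val] (e₁ e₂ : Event Tid Loc Val) : Prop :=
  (e₁ ∈ Init Tid Loc Val ∧ e₂ ∉ Init Tid Loc Val) ∨
    (e₁.tid = e₂.tid ∧ ∃ k₁ k₂ : ℕ, e₁.sn = some k₁ ∧ e₂.sn = some k₂ ∧ k₁ < k₂)

/-- The set of events extracted from a behavior. -/
def eventsOf [Zero Val] (β : Behavior Tid Loc Val) : Set (Event Tid Loc Val) :=
  Init Tid Loc Val ∪ {e | ∃ τ k l, (β τ).get? k = some l ∧ e = ⟨some k, some τ, l⟩}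

/-- Well-formed sets of events. -/
structure WellFormed [Zero Val] (E : Set (Event Tid Loc Val)) : Prop where
  init_subset : Init Tid Loc Val ⊆ E
  ne_bot : ∀ e ∈ E \ Init Tid Loc Val, e.tid ≠ none ∧ e.sn ≠ none
  inj : ∀ e₁ ∈ E \ Init Tid Loc Val, ∀ e₂ ∈ E \ Init Tid Loc Val,
    e₁.tid = e₂.tid → e₁.sn = e₂.sn → e₁ = e₂
  downward : ∀ e ∈ E \ Init Tid Loc Val, ∀ n k : ℕ, e.sn = some n → k < n →
    ∃ l, (⟨some k, e.tid, l⟩ : Event Tid Loc Val) ∈ E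

end Events

/-- Execution graphs. The modification order `mo` is the disjoint union of its restrictions to the
writes to each location, and each restriction is a strict total order. -/
structure EGraph (Tid : Type w) (Loc : Type u) (Val : Type v) [Zero Val] where
  E : Set (Event Tid Loc Val)
  rf : Event Tid Loc Val → Event Tid Loc Val → Prop
  mo : Event Tid Loc Val → Event Tid Loc Val → Prop
  wf : WellFormed E
  rf_mem : ∀ e r, rf e r → e ∈ E ∧ r ∈ E
  rf_match : ∀ e r, rf e r → e.IsW ∧ r.IsR ∧ e.loc = r.loc ∧ e.valW = r.valR
  rf_functional : ∀ e₁ e₂ r, rf e₁ r → rf e₂ r → e₁ = e₂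
  rf_total : ∀ r ∈ E, r.IsR → ∃ e, rf e r
  mo_mem : ∀ a b, mo a b → a ∈ E ∧ b ∈ E
  mo_match : ∀ a b, mo a b → a.IsW ∧ b.IsW ∧ a.loc = b.loc
  mo_irrefl : ∀ a, ¬ mo a a
  mo_trans : ∀ a b c, mo a b → mo b c → mo a c
  mo_total : ∀ a ∈ E, ∀ b ∈ E, a.IsW → b.IsW → a.loc = b.loc → a ≠ b → mo a b ∨ mo b a

/-- The relation `R` on the set `A` is prefix-finite. -/
def PrefixFinite {α : Type*} (A : Set α) (R : α → α → Prop) : Prop :=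
  ∀ b ∈ A, {a | R a b}.Finite

/-- The transitive closure of `R` is irreflexive. -/
def ClosureIrrefl {α : Type*} (R : α → α → Prop) : Prop :=
  ∀ a, ¬ Relation.TransGen R a a

namespace EGraph

variable {Tid : Type w} {Loc : Type u} {Val : Type v} [Zero Val] (G : EGraph Tid Loc Val)

/-- Program order. -/
def po (a b : Event Tid Loc Val) : Prop :=
  a ∈ G.E ∧ b ∈ G.E ∧ seqBefore a b

/-- From-read: `(rf⁻¹ ; mo) \ [E]`. -/
def fr (a b : Event Tid Loc Val) : Prop :=
  (∃ e, G.rf e a ∧ G.mo e b) ∧ ¬ (a = b ∧ a ∈ G.E)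

/-- External reads-from. -/
def rfe (a b : Event Tid Loc Val) : Prop :=
  G.rf a b ∧ ¬ G.po a b

/-- Preserved program order. -/
def ppo (a b : Event Tid Loc Val) : Prop :=
  G.po a b ∧ ¬ ((a.IsW ∧ ¬ a.IsRMW) ∧ (b.IsR ∧ ¬ b.IsRMW))

/-- RA-happens-before `(po ∪ rf)⁺`. -/
def hbRA : Event Tid Loc Val → Event Tid Loc Val → Prop :=
  Relation.TransGen fun a b => G.po a b ∨ G.rf a b

/-- `(po ∪ rf ∪ mo ∪ fr)⁺` is irreflexive. -/
def ConsistentSC : Prop :=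
  ClosureIrrefl fun a b => G.po a b ∨ G.rf a b ∨ G.mo a b ∨ G.fr a b

/-- SC per location: `(po|loc ∪ rf ∪ mo ∪ fr)⁺` is irreflexive. -/
def SCPerLoc : Prop :=
  ClosureIrrefl fun a b => (G.po a b ∧ a.loc = b.loc) ∨ G.rf a b ∨ G.mo a b ∨ G.fr a b

/-- `(ppo ∪ rfe ∪ mo ∪ fr)⁺` is irreflexive, and SC per location. -/
def ConsistentTSO : Prop :=
  (ClosureIrrefl fun a b => G.ppo a b ∨ G.rfe a b ∨ G.mo a b ∨ G.fr a b) ∧ G.SCPerLoc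

/-- `(hbRA|loc ∪ rf ∪ mo ∪ fr)⁺` is irreflexive. -/
def ConsistentRA : Prop :=
  ClosureIrrefl fun a b => (G.hbRA a b ∧ a.loc = b.loc) ∨ G.rf a b ∨ G.mo a b ∨ G.fr a b

/-- `hbRA` is irreflexive, and SC per location. -/
def ConsistentStrongCOH : Prop :=
  (∀ a, ¬ G.hbRA a a) ∧ G.SCPerLoc

/-- Fair execution graphs. -/
def Fair : Prop :=
  PrefixFinite G.E G.mo ∧ PrefixFinite G.E G.fr

end EGraph

section Declarative

variable (Tid : Type w) (Loc : Type u) (Val : Type v) [Zero Val]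

/-- The declarative memory systems, as sets of execution graphs. -/
def graphsSC : Set (EGraph Tid Loc Val) := {G | G.ConsistentSC}
def graphsTSO : Set (EGraph Tid Loc Val) := {G | G.ConsistentTSO}
def graphsRA : Set (EGraph Tid Loc Val) := {G | G.ConsistentRA}
def graphsStrongCOH : Set (EGraph Tid Loc Val) := {G | G.ConsistentStrongCOH}

/-- The fair execution graphs. -/
def graphsFair : Set (EGraph Tid Loc Val) := {G | G.Fair}

end Declarative

/-- The behaviors allowed by a declarative memory system. -/
def BehDecl {Tid : Type*} {Loc : Type*} {Val : Type*} [Zero Val] (𝒢 : Set (EGraph Tid Loc Val)) :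
    Set (Behavior Tid Loc Val) :=
  {β | ∃ G ∈ 𝒢, eventsOf β = G.E}

end FairMM

namespace FairMM

/-!
Finite and infinite runs are both treated as infinite runs with stuttering steps. Such a run and an
execution graph are compared through a *schedule*, an assignment of positions in time to the events.

From runs to graphs, the modification order is read off a numerical key: the time of execution for
SC, the time of the commit to the memory for TSO, the timestamp for RA and StrongCOH. Every relation
of the consistency axiom increases suitable times, so there are no cycles, and `mo` and `fr` are
prefix-finite because only finitely many events come before a given point. In the systems with
silent steps this uses memory fairness: buffered writes are eventually committed, and a thread
eventually observes every message and hence no longer reads older ones.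

From graphs to runs, fairness of the graph and finiteness of the set of threads make every event
have finitely many predecessors, so that the acyclic relation extends to a schedule of order type
at most `ω`. Executing the events along it yields a run. For TSO the commits are scheduled as well,
which gives fairness. For RA and StrongCOH the timestamp of a write is its position in `mo`, and
every second step is reserved for propagation: after all `mo`- and `fr`-predecessors of a write have
been executed, the write can be propagated to any thread.
-/

/-! ### Subsequences -/

section Subseq

variable {α β γ : Type*}

open Classical in
theorem subseq_get?_iff {f : α → Option β} {s : Stream'.Seq α} {k : ℕ} {b : β} :
    (subseq f s).get? k = some b ↔
      ∃ n, Nat.count (Kept f s) n = k ∧ (s.get? n).bind f = some b := by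
  have hget : (subseq f s).get? k = if h : ∃ n, Kept f s n ∧ Nat.count (Kept f s) n = k
      then (s.get? h.choose).bind f else none := rfl
  rw [hget]
  constructor
  · intro h
    split_ifs at h with hex
    exact ⟨_, hex.choose_spec.2, h⟩
  · rintro ⟨n, hn, hb⟩
    have hkept : Kept f s n := by simp [Kept, hb]
    have hex : ∃ n, Kept f s n ∧ Nat.count (Kept f s) n = k := ⟨n, hkept, hn⟩
    have hchoose : hex.choose = n :=
      Nat.count_injective hex.choose_spec.1 hkept (hex.choose_spec.2.trans hn.symm)
    rw [dif_pos hex, hchoose, hb]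

open Classical in
theorem subseq_get?_count {f : α → Option β} {s : Stream'.Seq α} {n : ℕ} (h : Kept f s n) :
    (subseq f s).get? (Nat.count (Kept f s) n) = (s.get? n).bind f := by
  obtain ⟨b, hb⟩ := Option.isSome_iff_exists.1 h
  rw [hb, subseq_get?_iff]
  exact ⟨n, rfl, hb⟩

theorem seq_ext_some {s t : Stream'.Seq α} (h : ∀ n a, s.get? n = some a ↔ t.get? n = some a) :
    s = t :=
  Stream'.Seq.ext fun n => Option.ext fun a => h n a

theorem Kept.of_bind {f : α → Option β} {g : β → Option γ} {s : Stream'.Seq α} {n : ℕ}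
    (h : Kept (fun a => (f a).bind g) s n) : Kept f s n := by
  unfold Kept at h ⊢
  rw [← Option.bind_assoc] at h
  exact Option.isSome_of_isSome_bind h

open Classical in
theorem kept_subseq_count_iff {f : α → Option β} {g : β → Option γ} {s : Stream'.Seq α} {n : ℕ}
    (h : Kept f s n) :
    Kept g (subseq f s) (Nat.count (Kept f s) n) ↔ Kept (fun a => (f a).bind g) s n := by
  unfold Kept
  rw [← Option.bind_assoc]
  exact iff_of_eq (congrArg (fun o => (o.bind g).isSome = true) (subseq_get?_count h))

open Classical in
theorem count_kept_bind (f : α → Option β) (g : β → Option γ) (s : Stream'.Seq α) (n : ℕ) :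
    Nat.count (Kept (fun a => (f a).bind g) s) n =
      Nat.count (Kept g (subseq f s)) (Nat.count (Kept f s) n) := by
  induction n with
  | zero => simp
  | succ n ih =>
    rw [Nat.count_succ, ih, Nat.count_succ (Kept f s)]
    by_cases h : Kept f s n
    · rw [if_pos h, Nat.count_succ (Kept g (subseq f s))]
      simp only [kept_subseq_count_iff h]
    · rw [if_neg h, if_neg (mt Kept.of_bind h), add_zero, add_zero]

theorem subseq_subseq (f : α → Option β) (g : β → Option γ) (s : Stream'.Seq α) :
    subseq g (subseq f s) = subseq (fun a => (f a).bind g) s := by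
  classical
  refine seq_ext_some fun k c => ?_
  simp only [subseq_get?_iff]
  constructor
  · rintro ⟨j, hj, hc⟩
    obtain ⟨b, hb, hbc⟩ := Option.bind_eq_some_iff.1 hc
    obtain ⟨n, hn, hnb⟩ := subseq_get?_iff.1 hb
    refine ⟨n, by rw [count_kept_bind, hn, hj], ?_⟩
    rwa [← Option.bind_assoc, hnb]
  · rintro ⟨n, hn, hc⟩
    have hkept : Kept f s n := Kept.of_bind (g := g) (by simp [Kept, hc])
    refine ⟨Nat.count (Kept f s) n, by rw [← count_kept_bind, hn], ?_⟩
    rw [subseq_get?_count hkept, Option.bind_assoc, hc]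

theorem map_eq_subseq (h : α → β) (s : Stream'.Seq α) :
    s.map h = subseq (fun a => some (h a)) s := by
  classical
  refine seq_ext_some fun k b => ?_
  rw [subseq_get?_iff, Stream'.Seq.map_get?]
  have hcount {n a} (hn : s.get? n = some a) :
      Nat.count (Kept (fun a => some (h a)) s) n = n := by
    refine Nat.count_iff_forall.2 fun m hm => ?_
    obtain ⟨c, hc⟩ := Stream'.Seq.ge_stable s hm.le hn
    simp [Kept, hc]
  constructor
  · intro hk
    obtain ⟨a, ha, rfl⟩ := Option.map_eq_some_iff.1 hk
    exact ⟨k, hcount ha, by simp [ha]⟩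
  · rintro ⟨n, rfl, hb⟩
    obtain ⟨a, ha, hab⟩ := Option.bind_eq_some_iff.1 hb
    simpa [hcount ha, ha] using hab

end Subseq

/-! ### Runs with stuttering -/

section Stutter

variable {Q Obs Sil : Type*} {A : LTS Q Obs Sil}

/-- A transition of `A`, or a stuttering step labeled `none`. -/
def LTS.StepOpt (A : LTS Q Obs Sil) (q : Q) : Option (Obs ⊕ Sil) → Q → Prop
  | none, q' => q' = q
  | some σ, q' => A.step q σ q'

/-- An infinite run in which stuttering steps are allowed. Finite and infinite runs both become runs
of this kind, whose states and labels are total functions of time. -/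
structure LTS.StutterRun (A : LTS Q Obs Sil) (q : ℕ → Q) (l : ℕ → Option (Obs ⊕ Sil)) : Prop where
  start : q 0 = A.init
  step : ∀ n, A.StepOpt (q n) (l n) (q (n + 1))

/-- Memory fairness of a run with stuttering; the run counts as finite if it eventually only
stutters. -/
def LTS.StutterFair (A : LTS Q Obs Sil) (q : ℕ → Q) (l : ℕ → Option (Obs ⊕ Sil)) : Prop :=
  (∃ N, ∀ n, N ≤ n → l n = none) ∨
    ∀ (θ : Sil) (k : ℕ), (∀ j, k ≤ j → A.Enabled (q j) (Sum.inr θ)) →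
      ∃ j, k ≤ j ∧ l j = some (Sum.inr θ)

theorem LTS.exists_stutterRun (A : LTS Q Obs Sil) (Inv : ℕ → Q → Prop)
    (Spec : ℕ → Q → Option (Obs ⊕ Sil) → Q → Prop) (hinit : Inv 0 A.init)
    (hstep : ∀ n q, Inv n q → ∃ o q', Spec n q o q' ∧ A.StepOpt q o q' ∧ Inv (n + 1) q') :
    ∃ q l, A.StutterRun q l ∧ (∀ n, Inv n (q n)) ∧ ∀ n, Spec n (q n) (l n) (q (n + 1)) := by
  choose o next hspec hnext hinv using hstep
  let x : (n : ℕ) → {q // Inv n q} := fun n =>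
    Nat.rec ⟨A.init, hinit⟩ (fun n q => ⟨next n q.1 q.2, hinv n q.1 q.2⟩) n
  exact ⟨fun n => (x n).1, fun n => o n (x n).1 (x n).2, ⟨rfl, fun n => hnext n _ _⟩,
    fun n => (x n).2, fun n => hspec n _ _⟩

/-- The number of proper transitions among the first `n` steps of a run with stuttering. -/
def stepCount (l : ℕ → Option (Obs ⊕ Sil)) (n : ℕ) : ℕ :=
  Nat.count (fun k => (l k).isSome) n

variable {q : ℕ → Q} {l : ℕ → Option (Obs ⊕ Sil)}

theorem stepCount_mono (l : ℕ → Option (Obs ⊕ Sil)) : Monotone (stepCount l) :=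
  Nat.count_monotone _

theorem stepCount_succ {σ : Obs ⊕ Sil} {n : ℕ} (h : l n = some σ) :
    stepCount l (n + 1) = stepCount l n + 1 := by
  simp [stepCount, Nat.count_succ, h]

theorem le_of_stepCount_le {σ : Obs ⊕ Sil} {m n : ℕ} (hn : l n = some σ)
    (h : stepCount l m ≤ stepCount l n) : m ≤ n := by
  by_contra! hlt
  have := stepCount_mono l (Nat.succ_le_of_lt hlt)
  rw [Nat.succ_eq_add_one, stepCount_succ hn] at this
  omega

theorem LTS.StutterRun.state_eq (h : A.StutterRun q l) {n m : ℕ} (hnm : n ≤ m)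
    (hc : stepCount l n = stepCount l m) : q m = q n := by
  induction m, hnm using Nat.le_induction with
  | base => rfl
  | succ m hm ih =>
    have hle := stepCount_mono l hm
    have hl : l m = none := by
      by_contra hne
      obtain ⟨σ, hσ⟩ := Option.ne_none_iff_exists'.1 hne
      rw [stepCount_succ hσ] at hc
      omega
    have hle' := stepCount_mono l (Nat.le_add_right m 1)
    have hstep := h.step m
    rw [hl] at hstep
    exact hstep.trans (ih (by omega))

/-- The sequence of the (optional) transitions of a run with stuttering. -/
def transSeq (q : ℕ → Q) (l : ℕ → Option (Obs ⊕ Sil)) :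
    Stream'.Seq (Option (Transition Q Obs Sil)) :=
  ⟨fun n => some ((l n).map fun σ => ⟨q n, σ, q (n + 1)⟩), fun h => by cases h⟩

theorem transSeq_get? (q : ℕ → Q) (l : ℕ → Option (Obs ⊕ Sil)) (n : ℕ) :
    (transSeq q l).get? n = some ((l n).map fun σ => ⟨q n, σ, q (n + 1)⟩) := rfl

/-- The run obtained by removing the stuttering steps. -/
noncomputable def compress (q : ℕ → Q) (l : ℕ → Option (Obs ⊕ Sil)) :
    Stream'.Seq (Transition Q Obs Sil) :=
  subseq id (transSeq q l)

theorem compress_get?_iff {k : ℕ} {t : Transition Q Obs Sil} :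
    (compress q l).get? k = some t ↔
      ∃ n, stepCount l n = k ∧ l n = some t.tlab ∧ t.src = q n ∧ t.tgt = q (n + 1) := by
  have hkept : Kept id (transSeq q l) = fun n => (l n).isSome = true := by
    funext n
    simp [Kept, transSeq_get?]
  unfold compress stepCount
  rw [subseq_get?_iff]
  simp only [hkept, transSeq_get?]
  refine exists_congr fun n => and_congr Iff.rfl ?_
  obtain ⟨src, σ, tgt⟩ := t
  cases hl : l n
  · simp
  · simp only [Option.map_some, Option.bind_some, id, Option.some.injEq, Transition.mk.injEq]
    tauto

theorem LTS.StutterRun.isRun_compress (h : A.StutterRun q l) : A.IsRun (compress q l) := by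
  constructor
  · intro k t ht
    obtain ⟨n, -, hl, hsrc, htgt⟩ := compress_get?_iff.1 ht
    have hstep := h.step n
    rw [hl] at hstep
    rw [hsrc, htgt]
    exact hstep
  · intro t ht
    obtain ⟨n, hn, -, hsrc, -⟩ := compress_get?_iff.1 ht
    rw [hsrc, ← h.start]
    exact h.state_eq n.zero_le ((Nat.count_zero _).trans hn.symm)
  · intro k t t' ht ht'
    obtain ⟨n, hn, hl, -, htgt⟩ := compress_get?_iff.1 ht
    obtain ⟨n', hn', hl', hsrc', -⟩ := compress_get?_iff.1 ht'
    rw [htgt, hsrc']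
    have hcount : stepCount l (n + 1) = stepCount l n' := by rw [stepCount_succ hl, hn, hn']
    exact (h.state_eq (le_of_stepCount_le hl' hcount.le) hcount).symm

theorem exists_get?_eq_some_of_not_terminates {α : Type*} {s : Stream'.Seq α}
    (h : ¬ s.Terminates) (n : ℕ) : ∃ a, s.get? n = some a :=
  Option.isSome_iff_exists.1 (Stream'.Seq.not_terminates_iff.1 h n)

theorem LTS.StutterRun.exists_next_transition (h : A.StutterRun q l)
    (hinf : ¬ (compress q l).Terminates) (n : ℕ) :
    ∃ n' t, n ≤ n' ∧ l n' = some t.tlab ∧ (compress q l).get? (stepCount l n) = some t ∧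
      t.src = q n := by
  obtain ⟨t, ht⟩ := exists_get?_eq_some_of_not_terminates hinf (stepCount l n)
  obtain ⟨n', hn', hl, hsrc, -⟩ := compress_get?_iff.1 ht
  have hle : n ≤ n' := le_of_stepCount_le hl hn'.ge
  exact ⟨n', t, hle, hl, ht, by rw [hsrc, h.state_eq hle hn'.symm]⟩

theorem LTS.StutterRun.memoryFair_compress (h : A.StutterRun q l) (hf : A.StutterFair q l) :
    A.MemoryFair (compress q l) := by
  by_cases hinf : (compress q l).Terminates
  · exact Or.inl hinf
  refine Or.inr fun θ k hk => ?_
  rcases hf with ⟨N, hN⟩ | hf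
  · obtain ⟨n, t, hle, hl, -⟩ := h.exists_next_transition hinf N
    simp [hN n hle] at hl
  obtain ⟨t, ht⟩ := exists_get?_eq_some_of_not_terminates hinf k
  obtain ⟨n, rfl, -⟩ := compress_get?_iff.1 ht
  have henabled : ∀ j, n ≤ j → A.Enabled (q j) (Sum.inr θ) := by
    intro j hj
    obtain ⟨_, u, -, -, hu, hsrc⟩ := h.exists_next_transition hinf j
    obtain ⟨u', hu', hen⟩ := hk (stepCount l j) (stepCount_mono l hj)
    obtain rfl : u = u' := Option.some.inj (hu.symm.trans hu')
    rwa [← hsrc]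
  obtain ⟨j, hj, hl⟩ := hf θ n henabled
  exact ⟨stepCount l j, ⟨q j, Sum.inr θ, q (j + 1)⟩, stepCount_mono l hj,
    compress_get?_iff.2 ⟨j, rfl, hl, rfl, rfl⟩, rfl⟩

/-- The states visited by a run, repeating the last one if the run is finite. -/
def statesOf (A : LTS Q Obs Sil) (μ : Stream'.Seq (Transition Q Obs Sil)) : ℕ → Q
  | 0 => A.init
  | n + 1 => match μ.get? n with
    | some t => t.tgt
    | none => statesOf A μ n

/-- The labels of a run, followed by stuttering if the run is finite. -/
def labelsOf (μ : Stream'.Seq (Transition Q Obs Sil)) (n : ℕ) : Option (Obs ⊕ Sil) :=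
  (μ.get? n).map Transition.tlab

variable {μ : Stream'.Seq (Transition Q Obs Sil)}

theorem LTS.IsRun.src_eq (h : A.IsRun μ) {n : ℕ} {t : Transition Q Obs Sil}
    (ht : μ.get? n = some t) : t.src = statesOf A μ n := by
  cases n with
  | zero => exact h.start t ht
  | succ n =>
    obtain ⟨t', ht'⟩ := Stream'.Seq.ge_stable μ (Nat.le_succ n) ht
    rw [← h.link n t' t ht' ht]
    simp [statesOf, ht']

theorem LTS.IsRun.stutterRun (h : A.IsRun μ) : A.StutterRun (statesOf A μ) (labelsOf μ) := by
  refine ⟨rfl, fun n => ?_⟩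
  cases ht : μ.get? n with
  | none => simp [labelsOf, ht, statesOf, LTS.StepOpt]
  | some t =>
    have hstep := h.trans n t ht
    rw [h.src_eq ht] at hstep
    simpa [labelsOf, ht, statesOf, LTS.StepOpt] using hstep

theorem LTS.IsRun.stutterFair (h : A.IsRun μ) (hf : A.MemoryFair μ) :
    A.StutterFair (statesOf A μ) (labelsOf μ) := by
  by_cases hinf : μ.Terminates
  · obtain ⟨N, hN⟩ := hinf
    exact Or.inl ⟨N, fun n hn => by simp [labelsOf, Stream'.Seq.le_stable μ hn hN]⟩
  refine Or.inr fun θ k hk => ?_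
  have hcont : A.ContEnabledAt μ θ k := by
    intro j hj
    obtain ⟨t, ht⟩ := exists_get?_eq_some_of_not_terminates hinf j
    exact ⟨t, ht, by rw [h.src_eq ht]; exact hk j hj⟩
  obtain ⟨j, t, hj, ht, hl⟩ := hf.resolve_left hinf θ k hcont
  exact ⟨j, hj, by simp [labelsOf, ht, hl]⟩

end Stutter

/-! ### Behaviors of runs with stuttering -/

section StutterBehavior

variable {Tid Loc Val Q Sil : Type*} {l : ℕ → Option ((Tid × ELab Loc Val) ⊕ Sil)}

/-- The step at time `n` carries an observable label of the thread `τ`. -/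
def OfThread (l : ℕ → Option ((Tid × ELab Loc Val) ⊕ Sil)) (τ : Tid) (n : ℕ) : Prop :=
  ∃ a, l n = some (Sum.inl (τ, a))

open Classical in
/-- `β` is the behavior induced by the labels `l`: the `k`-th label of a thread `τ` in `β` is
carried by the step of `τ` that has exactly `k` steps of `τ` before it. -/
def IsBehavior (l : ℕ → Option ((Tid × ELab Loc Val) ⊕ Sil)) (β : Behavior Tid Loc Val) : Prop :=
  ∀ τ k a, (β τ).get? k = some a ↔
    ∃ n, Nat.count (OfThread l τ) n = k ∧ l n = some (Sum.inl (τ, a))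

theorem IsBehavior.unique {β β' : Behavior Tid Loc Val} (h : IsBehavior l β)
    (h' : IsBehavior l β') : β = β' :=
  funext fun τ => seq_ext_some fun k a => (h τ k a).trans (h' τ k a).symm

variable [DecidableEq Tid]

theorem isBehavior_subseq {α : Type*} {s : Stream'.Seq α}
    {f : α → Option ((Tid × ELab Loc Val) ⊕ Sil)} (h : ∀ n, (s.get? n).bind f = l n) :
    IsBehavior l (fun τ => subseq (fun a => ((f a).bind Sum.getLeft?).bind
      fun σ => if σ.1 = τ then some σ.2 else none) s) := by
  intro τ k a
  have hlabel : ∀ n a, ((s.get? n).bind fun a => ((f a).bind Sum.getLeft?).bind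
      fun σ => if σ.1 = τ then some σ.2 else none) = some a ↔ l n = some (Sum.inl (τ, a)) := by
    intro n a
    rw [← Option.bind_assoc, ← Option.bind_assoc, h]
    rcases l n with _ | ⟨⟨τ', b⟩⟩ | θ
    · simp
    · by_cases hτ : τ' = τ <;> simp [hτ]
    · simp
  have hkept : Kept (fun a => ((f a).bind Sum.getLeft?).bind
      fun σ => if σ.1 = τ then some σ.2 else none) s = OfThread l τ := by
    funext n
    unfold Kept OfThread
    simp only [Option.isSome_iff_exists, hlabel]
  simp only [subseq_get?_iff, hlabel]
  rw [hkept]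

theorem isBehavior_labelsOf (μ : Stream'.Seq (Transition Q (Tid × ELab Loc Val) Sil)) :
    IsBehavior (labelsOf μ) (behOf (obsTrace μ)) := by
  have h : IsBehavior (labelsOf μ) _ :=
    isBehavior_subseq (f := fun t => some t.tlab) (s := μ) fun n => by
      unfold labelsOf
      cases μ.get? n <;> rfl
  convert h using 1
  funext τ
  simp only [behOf, obsTrace, trace, map_eq_subseq, subseq_subseq]

theorem isBehavior_compress (q : ℕ → Q) (l : ℕ → Option ((Tid × ELab Loc Val) ⊕ Sil)) :
    IsBehavior l (behOf (obsTrace (compress q l))) := by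
  have h : IsBehavior l _ :=
    isBehavior_subseq (f := fun o => o.map Transition.tlab) (s := transSeq q l) fun n => by
      rw [transSeq_get?]
      cases l n <;> rfl
  convert h using 1
  funext τ
  simp only [behOf, obsTrace, trace, compress, map_eq_subseq, subseq_subseq, id,
    Option.map_eq_bind, Function.comp_def]

theorem mem_BehMF_iff {A : LTS Q (Tid × ELab Loc Val) Sil} {β : Behavior Tid Loc Val} :
    β ∈ BehMF A ↔ ∃ q l, A.StutterRun q l ∧ A.StutterFair q l ∧ IsBehavior l β := by
  constructor
  · rintro ⟨μ, h, hf, rfl⟩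
    exact ⟨_, _, h.stutterRun, h.stutterFair hf, isBehavior_labelsOf μ⟩
  · rintro ⟨q, l, h, hf, hb⟩
    exact ⟨compress q l, h.isRun_compress, h.memoryFair_compress hf,
      hb.unique (isBehavior_compress q l)⟩

end StutterBehavior

/-! ### Acyclic relations and enumerations -/

section Order

variable {α : Type*} {R : α → α → Prop}

theorem closureIrrefl_of_strictMono {γ : Type*} [Preorder γ] (f : α → γ)
    (h : ∀ a b, R a b → f a < f b) : ClosureIrrefl R := by
  intro a ha
  have hlt : Relation.TransGen (· < ·) (f a) (f a) := ha.lift f h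
  rw [Relation.transGen_eq_self] at hlt
  exact lt_irrefl _ hlt

theorem closureIrrefl_of_lex (κ T : α → ℕ)
    (h : ∀ a b, R a b → κ a < κ b ∨ κ a ≤ κ b ∧ T a < T b) : ClosureIrrefl R :=
  closureIrrefl_of_strictMono (fun a => toLex (κ a, T a)) fun a b hab => by
    rw [Prod.Lex.toLex_lt_toLex]
    rcases h a b hab with hκ | ⟨hκ, hT⟩
    · exact Or.inl hκ
    · exact hκ.lt_or_eq.imp_right fun heq => ⟨heq, hT⟩

theorem ClosureIrrefl.mono {R' : α → α → Prop} (h : ClosureIrrefl R)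
    (hR : ∀ a b, R' a b → R a b) : ClosureIrrefl R' :=
  fun a ha => h a (Relation.TransGen.mono hR a a ha)

theorem closureIrrefl_subtype {p : α → Prop} (h : ClosureIrrefl R) :
    ClosureIrrefl fun a b : {e // p e} => R a.1 b.1 :=
  fun a ha => h a.1 (ha.lift Subtype.val fun _ _ hR => hR)

/-- An infinite descending chain would meet one of the finitely many sequences infinitely often,
and hence climb along it. -/
theorem wellFounded_of_closureIrrefl {ι : Type*} [Finite ι] (c : α → ι) (s : α → ℕ)
    (hinj : ∀ a b, c a = c b → s a = s b → a = b) (hlt : ∀ a b, c a = c b → s a < s b → R a b)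
    (h : ClosureIrrefl R) : WellFounded R := by
  rw [wellFounded_iff_isEmpty_descending_chain]
  refine ⟨fun ⟨g, hg⟩ => ?_⟩
  have hdesc : ∀ i j, i < j → Relation.TransGen R (g j) (g i) := by
    intro i j hij
    induction j, hij using Nat.le_induction with
    | base => exact .single (hg i)
    | succ j _ ih => exact .head (hg j) ih
  obtain ⟨y, hy⟩ := Finite.exists_infinite_fiber (fun n => c (g n))
  have hinf : ((fun n => c (g n)) ⁻¹' {y}).Infinite := Set.infinite_coe_iff.1 hy
  obtain ⟨i, hi, hmin⟩ := exists_minimalFor_of_wellFoundedLT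
    (fun n => c (g n) = y) (fun n => s (g n)) hinf.nonempty
  obtain ⟨j, hj, hij⟩ := hinf.exists_gt i
  have hc : c (g i) = c (g j) := Eq.trans hi (Eq.symm hj)
  rcases (le_of_not_gt fun hlt => (hmin hj hlt.le).not_gt hlt).eq_or_lt with heq | hs
  · exact h _ (hinj _ _ hc heq ▸ hdesc i j hij)
  · exact h _ ((hdesc i j hij).tail (hlt _ _ hc hs))

theorem finite_reflTransGen (hwf : WellFounded R) (hfin : ∀ b, {a | R a b}.Finite) (b : α) :
    {a | Relation.ReflTransGen R a b}.Finite := by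
  induction b using hwf.induction with
  | _ b ih =>
    refine ((Set.finite_singleton b).union ((hfin b).biUnion ih)).subset fun a ha => ?_
    rcases Relation.ReflTransGen.cases_tail ha with rfl | ⟨d, had, hdb⟩
    · exact Or.inl rfl
    · exact Or.inr (Set.mem_biUnion hdb had)

theorem exists_enumeration [Countable α] (hwf : WellFounded R) (hfin : ∀ b, {a | R a b}.Finite) :
    ∃ f : α → ℕ, Function.Injective f ∧ ∀ a b, R a b → f a < f b := by
  obtain ⟨c, hc⟩ := exists_injective_nat α
  let D : α → Finset α := fun b => (finite_reflTransGen hwf hfin b).toFinset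
  have hD : ∀ a b, a ∈ D b ↔ Relation.ReflTransGen R a b := fun a b => by simp [D]
  have hirr : ∀ a, ¬ Relation.TransGen R a a := fun a ha => hwf.transGen.irrefl.irrefl a ha
  -- The number of `b` codes in binary the finite set `D b` of its ancestors.
  refine ⟨fun b => ∑ a ∈ D b, 2 ^ c a, fun a b hab => ?_, fun a b hab => ?_⟩
  · have hcodes : (D a).map ⟨c, hc⟩ = (D b).map ⟨c, hc⟩ := by
      apply Finset.geomSum_injective (n := 2) le_rfl
      simpa [Finset.sum_map] using hab
    have heq : D a = D b := Finset.map_injective _ hcodes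
    have hba : Relation.ReflTransGen R b a := by rw [← hD, heq, hD]
    rcases Relation.reflTransGen_iff_eq_or_transGen.1 ((hD a b).1 (heq ▸ (hD a a).2 .refl))
      with h | h
    · exact h.symm
    · exact absurd (h.trans_left hba) (hirr a)
  · refine Finset.sum_lt_sum_of_subset (i := b) (fun d hd => ?_) ((hD b b).2 .refl) (fun hb => ?_)
      (by positivity) fun _ _ _ => by positivity
    · exact (hD d b).2 (((hD d a).1 hd).tail hab)
    · exact hirr b (.tail' ((hD b a).1 hb) hab)

end Order

/-! ### Events -/

section EventLemmas

variable {Tid Loc Val : Type*}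

theorem ELab.isR_iff (a : ELab Loc Val) : a.IsR ↔ ∃ v, a.valR = some v := by
  cases a <;> simp [ELab.IsR, ELab.valR]

theorem ELab.isW_iff (a : ELab Loc Val) : a.IsW ↔ ∃ v, a.valW = some v := by
  cases a <;> simp [ELab.IsW, ELab.valW]

theorem ELab.isRMW_iff (a : ELab Loc Val) : a.IsRMW ↔ a.IsR ∧ a.IsW := by
  cases a <;> simp [ELab.IsR, ELab.IsW, ELab.IsRMW]

theorem ELab.isR_or_isW (a : ELab Loc Val) : a.IsR ∨ a.IsW := by
  cases a <;> simp [ELab.IsR, ELab.IsW]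

variable [Zero Val] {E : Set (Event Tid Loc Val)} {a b c e : Event Tid Loc Val}

theorem not_isR_of_mem_Init (h : e ∈ Init Tid Loc Val) : ¬ e.IsR := by
  obtain ⟨x, rfl⟩ := h
  exact id

theorem valW_of_mem_Init (h : e ∈ Init Tid Loc Val) : e.valW = some 0 := by
  obtain ⟨x, rfl⟩ := h
  rfl

theorem tid_of_mem_Init (h : e ∈ Init Tid Loc Val) : e.tid = none := by
  obtain ⟨x, rfl⟩ := h
  rfl

theorem eq_of_mem_Init (ha : a ∈ Init Tid Loc Val) (hb : b ∈ Init Tid Loc Val)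
    (h : a.loc = b.loc) : a = b := by
  obtain ⟨x, rfl⟩ := ha
  obtain ⟨y, rfl⟩ := hb
  exact Event.ext rfl rfl (congrArg (ELab.write · 0) h)

theorem notMem_Init_of_tid {τ : Tid} (h : e.tid = some τ) : e ∉ Init Tid Loc Val := fun hi => by
  simp [tid_of_mem_Init hi] at h

theorem mem_eventsOf_iff {β : Behavior Tid Loc Val} (he : e ∉ Init Tid Loc Val) :
    e ∈ eventsOf β ↔ ∃ τ k, e.tid = some τ ∧ e.sn = some k ∧ (β τ).get? k = some e.lab := by
  constructor
  · rintro (h | ⟨τ, k, l, h, rfl⟩)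
    · exact absurd h he
    · exact ⟨τ, k, rfl, rfl, h⟩
  · rintro ⟨τ, k, hτ, hk, h⟩
    exact Or.inr ⟨τ, k, e.lab, h, Event.ext hk hτ rfl⟩

theorem wellFormed_eventsOf (β : Behavior Tid Loc Val) : WellFormed (eventsOf β) := by
  refine ⟨fun e he => Or.inl he, ?_, ?_, ?_⟩
  · rintro e ⟨he, hi⟩
    obtain ⟨τ, k, hτ, hk, -⟩ := (mem_eventsOf_iff hi).1 he
    simp [hτ, hk]
  · rintro a ⟨ha, hai⟩ b ⟨hb, hbi⟩ ht hs
    obtain ⟨τ, k, hτ, hk, hla⟩ := (mem_eventsOf_iff hai).1 ha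
    obtain ⟨τ', k', hτ', hk', hlb⟩ := (mem_eventsOf_iff hbi).1 hb
    obtain rfl : τ = τ' := Option.some.inj (hτ.symm.trans (ht.trans hτ'))
    obtain rfl : k = k' := Option.some.inj (hk.symm.trans (hs.trans hk'))
    exact Event.ext hs ht (Option.some.inj (hla.symm.trans hlb))
  · rintro e ⟨he, hi⟩ n k hn hk
    obtain ⟨τ, k', hτ, hk', hl⟩ := (mem_eventsOf_iff hi).1 he
    obtain rfl : n = k' := Option.some.inj (hn.symm.trans hk')
    obtain ⟨l, hl'⟩ := Stream'.Seq.ge_stable (β τ) hk.le hl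
    exact ⟨l, Or.inr ⟨τ, k, l, hl', by rw [hτ]⟩⟩

/-- `e` is an event of `E` that is not an initialization event. -/
def Proper (E : Set (Event Tid Loc Val)) (e : Event Tid Loc Val) : Prop :=
  e ∈ E ∧ e ∉ Init Tid Loc Val

theorem seqBefore.notMem_Init (h : seqBefore a b) : b ∉ Init Tid Loc Val := by
  rcases h with h | ⟨-, k, k', -, h, -⟩
  · exact h.2
  · rintro ⟨x, rfl⟩
    cases h

theorem seqBefore.trans (hab : seqBefore a b) (hbc : seqBefore b c) : seqBefore a c := by
  rcases hab with hab | ⟨ht, k, k', hk, hk', hlt⟩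
  · exact Or.inl ⟨hab.1, hbc.notMem_Init⟩
  · rcases hbc with hbc | ⟨ht', j, j', hj, hj', hlt'⟩
    · obtain ⟨x, rfl⟩ := hbc.1
      cases hk'
    · obtain rfl : k' = j := Option.some.inj (hk'.symm.trans hj)
      exact Or.inr ⟨ht.trans ht', k, j', hk, hj', hlt.trans hlt'⟩

theorem Proper.seqBefore_iff (ha : Proper E a) :
    seqBefore a b ↔ a.tid = b.tid ∧ ∃ k k' : ℕ, a.sn = some k ∧ b.sn = some k' ∧ k < k' :=
  ⟨fun h => h.resolve_left fun hi => ha.2 hi.1, Or.inr⟩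

variable (hE : WellFormed E)
include hE

theorem WellFormed.exists_tid_sn (he : Proper E e) :
    ∃ τ k, e.tid = some τ ∧ e.sn = some k := by
  obtain ⟨htid, hsn⟩ := hE.ne_bot e he
  obtain ⟨τ, hτ⟩ := Option.ne_none_iff_exists'.1 htid
  obtain ⟨k, hk⟩ := Option.ne_none_iff_exists'.1 hsn
  exact ⟨τ, k, hτ, hk⟩

theorem WellFormed.exists_earlier (he : Proper E e) {τ : Tid} (hτ : e.tid = some τ) {j k : ℕ}
    (hk : e.sn = some k) (hj : j < k) :
    ∃ a, Proper E a ∧ a.tid = some τ ∧ a.sn = some j ∧ seqBefore a e := by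
  obtain ⟨l, hl⟩ := hE.downward e he k j hk hj
  exact ⟨_, ⟨hl, notMem_Init_of_tid hτ⟩, hτ, rfl, Or.inr ⟨rfl, j, k, rfl, hk, hj⟩⟩

theorem WellFormed.seqBefore_trichotomy (ha : Proper E a) (hb : Proper E b)
    (h : a.tid = b.tid) : seqBefore a b ∨ a = b ∨ seqBefore b a := by
  obtain ⟨-, k, -, hk⟩ := hE.exists_tid_sn ha
  obtain ⟨-, k', -, hk'⟩ := hE.exists_tid_sn hb
  rcases lt_trichotomy k k' with hlt | rfl | hlt
  · exact Or.inl (Or.inr ⟨h, k, k', hk, hk', hlt⟩)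
  · exact Or.inr (Or.inl (hE.inj a ha b hb h (hk.trans hk'.symm)))
  · exact Or.inr (Or.inr (Or.inr ⟨h.symm, k', k, hk', hk, hlt⟩))

end EventLemmas

/-! ### Schedules -/

section Schedule

variable {Tid Loc Val Sil : Type*} [Zero Val]

/-- `T` assigns to the events of `E` their position in a total execution order compatible with the
order of each thread; initialization events get position `0`. -/
structure Schedule (E : Set (Event Tid Loc Val)) (T : Event Tid Loc Val → ℕ) : Prop where
  init : ∀ e ∈ Init Tid Loc Val, T e = 0
  pos : ∀ e, Proper E e → 0 < T e
  inj : ∀ a b, Proper E a → Proper E b → T a = T b → a = b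
  mono : ∀ a b, a ∈ E → b ∈ E → seqBefore a b → T a < T b

/-- The optional label `o` of step `n` is observable iff some event has position `n + 1`, and then
it is the label of this event. -/
def Emits (E : Set (Event Tid Loc Val)) (T : Event Tid Loc Val → ℕ) (n : ℕ)
    (o : Option ((Tid × ELab Loc Val) ⊕ Sil)) : Prop :=
  ∀ τ a, o = some (Sum.inl (τ, a)) ↔
    ∃ e, Proper E e ∧ T e = n + 1 ∧ e.tid = some τ ∧ e.lab = a

variable {E : Set (Event Tid Loc Val)} {T : Event Tid Loc Val → ℕ} {a b e : Event Tid Loc Val}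
  {n : ℕ}

theorem Schedule.proper_of_pos (h : Schedule E T) (ha : a ∈ E) (hpos : 0 < T a) : Proper E a :=
  ⟨ha, fun hi => hpos.ne' (h.init a hi)⟩

theorem Schedule.lt_of_same_thread (hE : WellFormed E) (h : Schedule E T) (ha : Proper E a)
    (hb : Proper E b) (ht : a.tid = b.tid) (hlt : T a < T b) : seqBefore a b := by
  rcases hE.seqBefore_trichotomy ha hb ht with hab | rfl | hba
  · exact hab
  · exact absurd hlt (lt_irrefl _)
  · exact absurd hlt (h.mono b a hb.1 ha.1 hba).asymm

theorem Schedule.eq_of_mem (h : Schedule E T) (he : Proper E e) (ha : a ∈ E) (hT : T a = T e) :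
    a = e :=
  h.inj a e (h.proper_of_pos ha (hT ▸ h.pos e he)) he hT

theorem Schedule.inj_loc (h : Schedule E T) (ha : a ∈ E) (hb : b ∈ E) (hloc : a.loc = b.loc)
    (hT : T a = T b) : a = b := by
  by_cases hi : a ∈ Init Tid Loc Val
  · by_cases hj : b ∈ Init Tid Loc Val
    · exact eq_of_mem_Init hi hj hloc
    · have := h.pos b ⟨hb, hj⟩
      have := h.init a hi
      omega
  · exact (h.eq_of_mem ⟨ha, hi⟩ hb hT.symm).symm

theorem Schedule.finite_le (h : Schedule E T) (N : ℕ) : {e | Proper E e ∧ T e ≤ N}.Finite :=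
  .of_injOn (fun _ he => he.2) (fun a ha b hb => h.inj a b ha.1 hb.1) (Set.finite_le_nat N)

theorem Emits.eq_some (hE : WellFormed E) {o : Option ((Tid × ELab Loc Val) ⊕ Sil)}
    (h : Emits E T n o) (he : Proper E e) (hT : T e = n + 1) :
    ∃ τ, e.tid = some τ ∧ o = some (Sum.inl (τ, e.lab)) := by
  obtain ⟨τ, -, hτ, -⟩ := hE.exists_tid_sn he
  exact ⟨τ, hτ, (h τ e.lab).2 ⟨e, he, hT, hτ, rfl⟩⟩

theorem Emits.of_event (h : Schedule E T) {τ : Tid} (he : Proper E e) (hT : T e = n + 1)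
    (hτ : e.tid = some τ) :
    Emits E T n (some (Sum.inl (τ, e.lab)) : Option ((Tid × ELab Loc Val) ⊕ Sil)) := by
  intro τ' a
  constructor
  · rintro ⟨⟩
    exact ⟨e, he, hT, hτ, rfl⟩
  · rintro ⟨e', he', hT', hτ', rfl⟩
    obtain rfl := h.inj e e' he he' (hT.trans hT'.symm)
    obtain rfl : τ = τ' := Option.some.inj (hτ.symm.trans hτ')
    rfl

theorem Emits.of_no_event {o : Option ((Tid × ELab Loc Val) ⊕ Sil)}
    (ho : ∀ σ, o ≠ some (Sum.inl σ)) (h : ∀ e, Proper E e → T e ≠ n + 1) : Emits E T n o :=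
  fun _ _ => ⟨fun heq => absurd heq (ho _), fun ⟨e, he, hT, _⟩ => absurd hT (h e he)⟩

variable {l : ℕ → Option ((Tid × ELab Loc Val) ⊕ Sil)} {β : Behavior Tid Loc Val}

/-- The position of an event in the run with labels `l`: one more than the time of the step of its
thread given by its serial number, and `0` for initialization events. -/
noncomputable def stepTime (l : ℕ → Option ((Tid × ELab Loc Val) ⊕ Sil))
    (e : Event Tid Loc Val) : ℕ :=
  match e.sn, e.tid with
  | some k, some τ => Nat.nth (OfThread l τ) k + 1
  | _, _ => 0

open Classical in
theorem IsBehavior.exists_stepTime_eq (h : IsBehavior l β) (he : Proper (eventsOf β) e) :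
    ∃ n τ, stepTime l e = n + 1 ∧ e.tid = some τ ∧ e.sn = some (Nat.count (OfThread l τ) n) ∧
      l n = some (Sum.inl (τ, e.lab)) := by
  obtain ⟨τ, k, hτ, hk, hget⟩ := (mem_eventsOf_iff he.2).1 he.1
  obtain ⟨n, rfl, hl⟩ := (h τ k e.lab).1 hget
  have hnth : Nat.nth (OfThread l τ) (Nat.count (OfThread l τ) n) = n := Nat.nth_count ⟨_, hl⟩
  exact ⟨n, τ, by simp only [stepTime, hk, hτ, hnth], hτ, hk, hl⟩

theorem IsBehavior.schedule_stepTime (h : IsBehavior l β) :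
    Schedule (eventsOf β) (stepTime l) := by
  classical
  have hinit : ∀ e ∈ Init Tid Loc Val, stepTime l e = 0 := by
    rintro _ ⟨x, rfl⟩
    rfl
  refine ⟨hinit, fun e he => ?_, fun a b ha hb hab => ?_, fun a b ha hb hab => ?_⟩
  · obtain ⟨n, τ, hT, -⟩ := h.exists_stepTime_eq he
    omega
  · obtain ⟨n, τ, hT, hτ, hk, hl⟩ := h.exists_stepTime_eq ha
    obtain ⟨n', τ', hT', hτ', hk', hl'⟩ := h.exists_stepTime_eq hb
    obtain rfl : n = n' := by omega
    simp only [hl, Option.some.injEq, Sum.inl.injEq, Prod.mk.injEq] at hl'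
    obtain ⟨rfl, hlab⟩ := hl'
    exact Event.ext (hk.trans hk'.symm) (hτ.trans hτ'.symm) hlab
  · obtain ⟨n', τ', hT', hτ', hk', -⟩ := h.exists_stepTime_eq ⟨hb, hab.notMem_Init⟩
    by_cases hi : a ∈ Init Tid Loc Val
    · rw [hinit a hi]
      omega
    · have hap : Proper (eventsOf β) a := ⟨ha, hi⟩
      obtain ⟨n, τ, hT, hτ, hk, -⟩ := h.exists_stepTime_eq hap
      obtain ⟨ht, j, j', hj, hj', hlt⟩ := hap.seqBefore_iff.1 hab
      obtain rfl : τ = τ' := Option.some.inj (hτ.symm.trans (ht.trans hτ'))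
      rw [← Option.some.inj (hk.symm.trans hj), ← Option.some.inj (hk'.symm.trans hj')] at hlt
      have := (Nat.count_monotone (OfThread l τ)).reflect_lt hlt
      omega

theorem IsBehavior.emits_stepTime (h : IsBehavior l β) (n : ℕ) :
    Emits (eventsOf β) (stepTime l) n (l n) := by
  classical
  intro τ a
  constructor
  · intro hl
    have he : Proper (eventsOf β) ⟨some (Nat.count (OfThread l τ) n), some τ, a⟩ :=
      ⟨Or.inr ⟨τ, _, a, (h τ _ a).2 ⟨n, rfl, hl⟩, rfl⟩, notMem_Init_of_tid rfl⟩
    obtain ⟨n', τ', hT, ⟨⟩, hk, hl'⟩ := h.exists_stepTime_eq he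
    obtain rfl := Nat.count_injective ⟨a, hl⟩ ⟨_, hl'⟩ (Option.some.inj hk)
    exact ⟨_, he, hT, rfl, rfl⟩
  · rintro ⟨e, he, hn, hτ, rfl⟩
    obtain ⟨n', τ', hT, hτ', -, hl⟩ := h.exists_stepTime_eq he
    obtain rfl : τ = τ' := Option.some.inj (hτ.symm.trans hτ')
    obtain rfl : n = n' := by omega
    exact hl

theorem Schedule.le_iff_lt_count [∀ τ, DecidablePred (OfThread l τ)] (hE : WellFormed E)
    (h : Schedule E T) (hl : ∀ n, Emits E T n (l n)) (n : ℕ) {τ : Tid} {k : ℕ}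
    (he : Proper E e) (hτ : e.tid = some τ) (hk : e.sn = some k) :
    T e ≤ n ↔ k < Nat.count (OfThread l τ) n := by
  induction n generalizing e k with
  | zero => simpa using (h.pos e he).ne'
  | succ n ih =>
    rw [Nat.le_add_one_iff]
    by_cases hn : OfThread l τ n
    · obtain ⟨a, ha⟩ := hn
      obtain ⟨e', he', hT', hτ', rfl⟩ := (hl n τ a).1 ha
      obtain ⟨-, k', -, hk'⟩ := hE.exists_tid_sn he'
      have hsn : k' = Nat.count (OfThread l τ) n := by
        refine le_antisymm (not_lt.1 fun hlt => ?_) (not_lt.1 fun hlt => ?_)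
        · obtain ⟨d, hd, hτd, hkd, hde⟩ := hE.exists_earlier he' hτ' hk' hlt
          have := h.mono d e' hd.1 he'.1 hde
          exact lt_irrefl _ ((ih hd hτd hkd).1 (by omega))
        · have := (ih he' hτ' hk').2 hlt
          omega
      have heq : T e = n + 1 ↔ k = k' := by
        rw [← hT']
        refine ⟨fun hT => ?_, fun hkk => ?_⟩
        · rw [h.inj e e' he he' hT] at hk
          exact Option.some.inj (hk.symm.trans hk')
        · rw [hE.inj e he e' he' (hτ.trans hτ'.symm) (by rw [hk, hk', hkk])]
      rw [Nat.count_succ, if_pos ⟨_, ha⟩, ih he hτ hk, heq, hsn]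
      omega
    · have hne : T e ≠ n + 1 := fun hT => hn ⟨_, (hl n τ _).2 ⟨e, he, hT, hτ, rfl⟩⟩
      rw [Nat.count_succ, if_neg hn, ih he hτ hk]
      simp [hne]

theorem Schedule.isBehavior (h : Schedule (eventsOf β) T)
    (hl : ∀ n, Emits (eventsOf β) T n (l n)) : IsBehavior l β := by
  classical
  have hcount : ∀ {e τ k n}, Proper (eventsOf β) e → e.tid = some τ → e.sn = some k →
      T e = n + 1 → Nat.count (OfThread l τ) n = k := by
    intro e τ k n he hτ hk hn
    have hlt := h.le_iff_lt_count (wellFormed_eventsOf β) hl n he hτ hk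
    have hle := h.le_iff_lt_count (wellFormed_eventsOf β) hl (n + 1) he hτ hk
    have := Nat.count_succ (OfThread l τ) n
    split_ifs at this <;> omega
  intro τ k a
  constructor
  · intro hk
    have he : Proper (eventsOf β) ⟨some k, some τ, a⟩ :=
      ⟨Or.inr ⟨τ, k, a, hk, rfl⟩, notMem_Init_of_tid rfl⟩
    obtain ⟨n, hn⟩ := Nat.exists_eq_succ_of_ne_zero (h.pos _ he).ne'
    exact ⟨n, hcount he rfl rfl hn, (hl n τ a).2 ⟨_, he, hn, rfl, rfl⟩⟩
  · rintro ⟨n, hn, hla⟩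
    obtain ⟨e, he, hT, hτ, rfl⟩ := (hl n τ a).1 hla
    obtain ⟨τ', k', hτ', hk', hget⟩ := (mem_eventsOf_iff he.2).1 he.1
    obtain rfl : τ = τ' := Option.some.inj (hτ.symm.trans hτ')
    rw [← hn, hcount he hτ hk' hT, hget]

end Schedule

/-! ### Graphs determined by a key -/

section KeyGraph

variable {Tid Loc Val : Type*}

/-- A numerical key `P` that distinguishes the writes to the same location; its order can serve as a
modification order. -/
def IsMoKey (E : Set (Event Tid Loc Val)) (P : Event Tid Loc Val → ℕ) : Prop :=
  ∀ a b, a ∈ E → b ∈ E → a.IsW → b.IsW → a.loc = b.loc → P a = P b → a = b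

/-- The function `src` assigns to every read a write from which it can read. -/
def IsRfSource (E : Set (Event Tid Loc Val)) (src : Event Tid Loc Val → Event Tid Loc Val) : Prop :=
  ∀ r ∈ E, r.IsR → src r ∈ E ∧ (src r).IsW ∧ (src r).loc = r.loc ∧ (src r).valW = r.valR

variable [Zero Val] {E : Set (Event Tid Loc Val)} {P : Event Tid Loc Val → ℕ}
  {src : Event Tid Loc Val → Event Tid Loc Val}

/-- The execution graph in which the modification order is the order of the key `P` and every read
`r` reads from `src r`. -/
def keyGraph (hE : WellFormed E) (hP : IsMoKey E P) (hsrc : IsRfSource E src) :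
    EGraph Tid Loc Val where
  E := E
  rf e r := r ∈ E ∧ r.IsR ∧ e = src r
  mo a b := a ∈ E ∧ b ∈ E ∧ a.IsW ∧ b.IsW ∧ a.loc = b.loc ∧ P a < P b
  wf := hE
  rf_mem := by
    rintro _ r ⟨hr, hread, rfl⟩
    exact ⟨(hsrc r hr hread).1, hr⟩
  rf_match := by
    rintro _ r ⟨hr, hread, rfl⟩
    obtain ⟨-, hw, hloc, hval⟩ := hsrc r hr hread
    exact ⟨hw, hread, hloc, hval⟩
  rf_functional := by
    rintro _ _ r ⟨-, -, rfl⟩ ⟨-, -, rfl⟩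
    rfl
  rf_total := fun _ hr hread => ⟨_, hr, hread, rfl⟩
  mo_mem := fun _ _ ⟨ha, hb, _⟩ => ⟨ha, hb⟩
  mo_match := fun _ _ ⟨_, _, haw, hbw, hloc, _⟩ => ⟨haw, hbw, hloc⟩
  mo_irrefl := fun _ ⟨_, _, _, _, _, hlt⟩ => lt_irrefl _ hlt
  mo_trans := fun _ _ _ ⟨ha, _, haw, _, hloc, hlt⟩ ⟨_, hc, _, hcw, hloc', hlt'⟩ =>
    ⟨ha, hc, haw, hcw, hloc.trans hloc', hlt.trans hlt'⟩
  mo_total := by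
    intro a ha b hb haw hbw hloc hne
    rcases lt_trichotomy (P a) (P b) with h | h | h
    · exact Or.inl ⟨ha, hb, haw, hbw, hloc, h⟩
    · exact absurd (hP a b ha hb haw hbw hloc h) hne
    · exact Or.inr ⟨hb, ha, hbw, haw, hloc.symm, h⟩

theorem keyGraph_mo_finite (hE : WellFormed E) (hP : IsMoKey E P) (hsrc : IsRfSource E src) :
    PrefixFinite E (keyGraph hE hP hsrc).mo :=
  fun b _ => .of_injOn (fun _ ⟨_, _, _, _, _, hlt⟩ => hlt)
    (fun a ⟨ha, _, haw, _, hloc, _⟩ a' ⟨ha', _, haw', _, hloc', _⟩ =>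
      hP a a' ha ha' haw haw' (hloc.trans hloc'.symm)) (Set.finite_lt_nat (P b))

theorem keyGraph_fr (hE : WellFormed E) (hP : IsMoKey E P) (hsrc : IsRfSource E src)
    {a b : Event Tid Loc Val} (hfr : (keyGraph hE hP hsrc).fr a b) :
    a ∈ E ∧ a.IsR ∧ b ∈ E ∧ b.IsW ∧ a.loc = b.loc ∧ P (src a) < P b ∧ a ≠ b := by
  obtain ⟨⟨_, ⟨ha, hR, rfl⟩, -, hb, -, hbW, hloc, hlt⟩, hne⟩ := hfr
  exact ⟨ha, hR, hb, hbW, (hsrc a ha hR).2.2.1.symm.trans hloc, hlt, fun hab => hne ⟨hab, ha⟩⟩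

end KeyGraph

/-! ### Schedules from acyclic relations -/

section Enumeration

variable {Tid Loc Val : Type*} [Zero Val] {E : Set (Event Tid Loc Val)}

theorem WellFormed.finite_seqBefore (hE : WellFormed E) (b : Event Tid Loc Val) :
    {a | Proper E a ∧ seqBefore a b}.Finite := by
  refine .of_injOn (f := fun e => e.sn.getD 0) ?_ ?_ (Set.finite_lt_nat (b.sn.getD 0))
  · rintro a ⟨ha, hab⟩
    obtain ⟨-, k, k', hk, hk', hlt⟩ := ha.seqBefore_iff.1 hab
    simpa [hk, hk'] using hlt
  · rintro a ⟨ha, hab⟩ a' ⟨ha', hab'⟩ hsn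
    obtain ⟨ht, k, -, hk, -⟩ := ha.seqBefore_iff.1 hab
    obtain ⟨ht', k', -, hk', -⟩ := ha'.seqBefore_iff.1 hab'
    simp only [hk, hk', Option.getD_some] at hsn
    exact hE.inj a ha a' ha' (ht.trans ht'.symm) (by rw [hk, hk', hsn])

variable [Finite Tid]

theorem WellFormed.countable_proper (hE : WellFormed E) : Countable {e // Proper E e} := by
  have hinj : Function.Injective
      (fun e : {e // Proper E e} => ((e.1.tid, e.1.sn) : Option Tid × Option ℕ)) :=
    fun a b h => Subtype.ext (hE.inj _ a.2 _ b.2 (Prod.mk.inj h).1 (Prod.mk.inj h).2)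
  exact hinj.countable

variable {R : Event Tid Loc Val → Event Tid Loc Val → Prop}

theorem WellFormed.exists_enumeration (hE : WellFormed E)
    (hwf : WellFounded fun a b : {e // Proper E e} => R a.1 b.1)
    (hfin : ∀ b, Proper E b → {a | Proper E a ∧ R a b}.Finite) :
    ∃ f : Event Tid Loc Val → ℕ, (∀ a b, Proper E a → Proper E b → f a = f b → a = b) ∧
      ∀ a b, Proper E a → Proper E b → R a b → f a < f b := by
  classical
  have := hE.countable_proper
  obtain ⟨f, hf, hR⟩ := FairMM.exists_enumeration hwf fun b =>
    ((hfin b.1 b.2).preimage Subtype.val_injective.injOn).subset fun a ha => ⟨a.2, ha⟩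
  refine ⟨fun e => if h : Proper E e then f ⟨e, h⟩ else 0, ?_, ?_⟩
  · intro a b ha hb hab
    simp only [dif_pos ha, dif_pos hb] at hab
    exact congrArg Subtype.val (hf hab)
  · intro a b ha hb hab
    simp only [dif_pos ha, dif_pos hb]
    exact hR _ _ hab

theorem WellFormed.wellFounded_of_closureIrrefl (hE : WellFormed E) {κ : Type*} [Finite κ]
    (cl : Event Tid Loc Val → κ) (h : ClosureIrrefl R)
    (hpo : ∀ a b, Proper E a → Proper E b → cl a = cl b → seqBefore a b → R a b) :
    WellFounded fun a b : {e // Proper E e} => R a.1 b.1 := by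
  refine FairMM.wellFounded_of_closureIrrefl (ι := Option Tid × κ) (fun e => (e.1.tid, cl e.1))
    (fun e => e.1.sn.getD 0) ?_ ?_ (closureIrrefl_subtype h)
  all_goals
    intro a b htcl hs
    obtain ⟨ht, hcl⟩ := Prod.mk.inj htcl
    obtain ⟨-, k, -, hk⟩ := hE.exists_tid_sn a.2
    obtain ⟨-, k', -, hk'⟩ := hE.exists_tid_sn b.2
    simp only [hk, hk', Option.getD_some] at hs
  · exact Subtype.ext (hE.inj _ a.2 _ b.2 ht (by rw [hk, hk', hs]))
  · exact hpo _ _ a.2 b.2 hcl (Or.inr ⟨ht, k, k', hk, hk', hs⟩)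

omit [Finite Tid] in
theorem exists_schedule_of_enumeration {f : Event Tid Loc Val → ℕ}
    (hinj : ∀ a b, Proper E a → Proper E b → f a = f b → a = b)
    (hmono : ∀ a b, Proper E a → Proper E b → seqBefore a b → f a < f b) :
    ∃ T, Schedule E T ∧ ∀ e, Proper E e → T e = f e + 1 := by
  classical
  refine ⟨fun e => if e ∈ Init Tid Loc Val then 0 else f e + 1,
    ⟨fun e he => if_pos he, fun e he => ?_, fun a b ha hb h => ?_, fun a b ha hb h => ?_⟩,
    fun e he => if_neg he.2⟩
  · simp [he.2]
  · simp only [ha.2, hb.2, if_false] at h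
    exact hinj a b ha hb (by omega)
  · have hbi := h.notMem_Init
    by_cases hi : a ∈ Init Tid Loc Val
    · simp [hi, hbi]
    · simpa [hi, hbi] using hmono a b ⟨ha, hi⟩ ⟨hb, hbi⟩ h

theorem WellFormed.exists_schedule (hE : WellFormed E) (h : ClosureIrrefl R)
    (hpo : ∀ a b, a ∈ E → b ∈ E → seqBefore a b → R a b)
    (hfin : ∀ b, Proper E b → {a | Proper E a ∧ R a b}.Finite) :
    ∃ T, Schedule E T ∧ ∀ a b, a ∈ E → Proper E b → R a b → T a < T b := by
  obtain ⟨f, hf, hfR⟩ := hE.exists_enumeration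
    (hE.wellFounded_of_closureIrrefl (fun _ => ()) h fun a b ha hb _ => hpo a b ha.1 hb.1) hfin
  obtain ⟨T, hT, hTf⟩ := exists_schedule_of_enumeration hf
    fun a b ha hb hab => hfR a b ha hb (hpo a b ha.1 hb.1 hab)
  refine ⟨T, hT, fun a b ha hb hab => ?_⟩
  by_cases hi : a ∈ Init Tid Loc Val
  · rw [hT.init a hi]
    exact hT.pos b hb
  · rw [hTf a ⟨ha, hi⟩, hTf b hb]
    exact Nat.succ_lt_succ (hfR a b ⟨ha, hi⟩ hb hab)

end Enumeration

/-! ### Memories determined by committed writes -/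

section MemInv

variable {Tid Loc Val : Type*} {E : Set (Event Tid Loc Val)} {P : Event Tid Loc Val → ℕ}
  {D : Event Tid Loc Val → Prop} {x : Loc} {w w' e : Event Tid Loc Val} {n : ℕ} {M : Loc → Val}

/-- `w` is the last write to `x` among those that satisfy `D`, in the order given by `P`. -/
structure IsLastWrite (E : Set (Event Tid Loc Val)) (P : Event Tid Loc Val → ℕ)
    (D : Event Tid Loc Val → Prop) (x : Loc) (w : Event Tid Loc Val) : Prop where
  mem : w ∈ E
  isW : w.IsW
  loc_eq : w.loc = x
  sat : D w
  le : ∀ w' ∈ E, w'.IsW → w'.loc = x → D w' → P w' ≤ P w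

/-- The memory `M` is the result of committing, in the order of their keys, all writes whose key is
at most `n`. -/
def MemInv (E : Set (Event Tid Loc Val)) (P : Event Tid Loc Val → ℕ) (n : ℕ) (M : Loc → Val) :
    Prop :=
  ∀ x, ∃ w, IsLastWrite E P (fun w => P w ≤ n) x w ∧ w.valW = some (M x)

/-- The memory after a label has been executed in `M`. -/
def ELab.exec [DecidableEq Loc] (M : Loc → Val) (a : ELab Loc Val) : Loc → Val :=
  match a.valW with
  | some v => Function.update M a.loc v
  | none => M

theorem IsLastWrite.unique (hP : IsMoKey E P) (h : IsLastWrite E P D x w)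
    (h' : IsLastWrite E P D x w') : w = w' :=
  hP w w' h.mem h'.mem h.isW h'.isW (h.loc_eq.trans h'.loc_eq.symm)
    (le_antisymm (h'.le w h.mem h.isW h.loc_eq h.sat) (h.le w' h'.mem h'.isW h'.loc_eq h'.sat))

theorem MemInv.zero [Zero Val] (hE : WellFormed E) (hP : ∀ e ∈ Init Tid Loc Val, P e = 0) :
    MemInv E P 0 (fun _ => 0) := fun x =>
  have hx : (⟨none, none, .write x 0⟩ : Event Tid Loc Val) ∈ Init Tid Loc Val := ⟨x, rfl⟩
  ⟨_, ⟨hE.init_subset hx, trivial, rfl, (hP _ hx).le, fun _ _ _ _ h => h.trans (Nat.zero_le _)⟩,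
    rfl⟩

theorem MemInv.stay (h : MemInv E P n M) (hn : ∀ w ∈ E, w.IsW → P w ≠ n + 1) :
    MemInv E P (n + 1) M := by
  intro x
  obtain ⟨w, hw, hv⟩ := h x
  refine ⟨w, ⟨hw.mem, hw.isW, hw.loc_eq, hw.sat.trans n.le_succ, ?_⟩, hv⟩
  exact fun w' hE hW hx hle =>
    hw.le w' hE hW hx ((Nat.le_add_one_iff.1 hle).resolve_right (hn w' hE hW))

theorem MemInv.write [DecidableEq Loc] (h : MemInv E P n M) {v : Val} (he : e ∈ E) (hW : e.IsW)
    (hP : P e = n + 1) (hv : e.valW = some v) (hn : ∀ w ∈ E, w.IsW → P w = n + 1 → w = e) :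
    MemInv E P (n + 1) (Function.update M e.loc v) := by
  intro x
  by_cases hx : x = e.loc
  · subst hx
    exact ⟨e, ⟨he, hW, rfl, hP.le, fun w' _ _ _ hle => hP ▸ hle⟩, by simp [hv]⟩
  · obtain ⟨w, hw, hwv⟩ := h x
    refine ⟨w, ⟨hw.mem, hw.isW, hw.loc_eq, hw.sat.trans n.le_succ, fun w' hE' hW' hx' hle => ?_⟩,
      by simpa [hx] using hwv⟩
    refine hw.le w' hE' hW' hx' ((Nat.le_add_one_iff.1 hle).resolve_right fun heq => hx ?_)
    rw [← hx', hn w' hE' hW' heq]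

theorem MemInv.exec [DecidableEq Loc] (h : MemInv E P n M) (he : e ∈ E) (hP : e.IsW → P e = n + 1)
    (hn : ∀ w ∈ E, w.IsW → P w = n + 1 → w = e) : MemInv E P (n + 1) (e.lab.exec M) := by
  unfold ELab.exec
  cases hv : e.lab.valW with
  | none =>
    refine h.stay fun w hw hW hPw => ?_
    obtain ⟨v, hv'⟩ := (ELab.isW_iff _).1 (hn w hw hW hPw ▸ hW)
    simp [hv] at hv'
  | some v =>
    have hW : e.IsW := (ELab.isW_iff _).2 ⟨v, hv⟩
    exact h.write he hW (hP hW) hv hn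

end MemInv

section GraphLemmas

variable {Tid Loc Val : Type*} [Zero Val] {G : EGraph Tid Loc Val}
  {E : Set (Event Tid Loc Val)} {a b e r : Event Tid Loc Val}

theorem proper_of_isR (h : r ∈ E) (hR : r.IsR) : Proper E r :=
  ⟨h, fun hi => not_isR_of_mem_Init hi hR⟩

theorem EGraph.SCPerLoc.proper_of_mo (h : G.SCPerLoc) (hmo : G.mo a b) : Proper G.E b := by
  refine ⟨(G.mo_mem a b hmo).2, fun hb => ?_⟩
  have hloc := (G.mo_match a b hmo).2.2
  have ha : a ∉ Init Tid Loc Val := fun ha =>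
    G.mo_irrefl b (by simpa only [eq_of_mem_Init ha hb hloc] using hmo)
  have hpo : G.po b a := ⟨(G.mo_mem a b hmo).2, (G.mo_mem a b hmo).1, Or.inl ⟨hb, ha⟩⟩
  exact h a (.tail (.single (Or.inr (Or.inr (Or.inl hmo)))) (Or.inl ⟨hpo, hloc.symm⟩))

theorem EGraph.SCPerLoc.proper_of_fr (h : G.SCPerLoc) (hfr : G.fr a b) : Proper G.E b :=
  let ⟨⟨_, _, hmo⟩, _⟩ := hfr
  h.proper_of_mo hmo

theorem EGraph.ConsistentSC.scPerLoc (h : G.ConsistentSC) : G.SCPerLoc :=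
  ClosureIrrefl.mono h fun _ _ h => h.imp And.left id

theorem EGraph.finite_rf (G : EGraph Tid Loc Val) (b : Event Tid Loc Val) :
    {a | G.rf a b}.Finite :=
  Set.Subsingleton.finite fun a ha a' ha' => G.rf_functional a a' b ha ha'

/-- A write satisfying `D` cannot come after the source of `r` in `mo`, because then it would come
after `r` in `fr`. -/
theorem EGraph.isLastWrite_of_rf {P : Event Tid Loc Val → ℕ} {D : Event Tid Loc Val → Prop}
    (hrf : G.rf e r) (hD : D e) (hmo : ∀ a b, G.mo a b → P a ≤ P b)
    (hfr : ∀ w, G.fr r w → ¬ D w) (hr : ¬ (r.IsW ∧ D r)) : IsLastWrite G.E P D r.loc e := by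
  obtain ⟨hW, -, hloc, -⟩ := G.rf_match e r hrf
  have he := (G.rf_mem e r hrf).1
  refine ⟨he, hW, hloc, hD, fun w hw hwW hwloc hDw => ?_⟩
  by_cases hwe : w = e
  · rw [hwe]
  rcases G.mo_total w hw e he hwW hW (hwloc.trans hloc.symm) hwe with h | h
  · exact hmo _ _ h
  · refine absurd hDw (hfr w ⟨⟨e, hrf, h⟩, ?_⟩)
    rintro ⟨rfl, -⟩
    exact hr ⟨hwW, hDw⟩

end GraphLemmas

/-! ### Sequential consistency -/

section SC

variable {Tid Loc Val : Type*} [DecidableEq Loc]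

theorem scStep_iff {M M' : Loc → Val} {τ : Tid} {a : ELab Loc Val} :
    scStep M (Sum.inl (τ, a)) M' ↔ (a.IsR → a.valR = some (M a.loc)) ∧ M' = a.exec M := by
  cases a <;>
    simp [scStep, scRead, scWrite, ELab.IsR, ELab.valR, ELab.valW, ELab.loc, ELab.exec, eq_comm]

variable [Zero Val] {E : Set (Event Tid Loc Val)} {T : Event Tid Loc Val → ℕ}
  {q : ℕ → Loc → Val} {l : ℕ → Option ((Tid × ELab Loc Val) ⊕ Empty)}

theorem sc_memInv (hr : (memSC Tid Loc Val).StutterRun q l) (hE : WellFormed E)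
    (hT : Schedule E T) (hl : ∀ n, Emits E T n (l n)) (n : ℕ) : MemInv E T n (q n) := by
  induction n with
  | zero => exact hr.start ▸ MemInv.zero hE hT.init
  | succ n ih =>
    have hstep := hr.step n
    by_cases hex : ∃ e, Proper E e ∧ T e = n + 1
    · obtain ⟨e, he, hTe⟩ := hex
      obtain ⟨τ, -, hln⟩ := (hl n).eq_some hE he hTe
      rw [hln] at hstep
      rw [(scStep_iff.1 hstep).2]
      exact ih.exec he.1 (fun _ => hTe) fun w hw _ hTw => hT.eq_of_mem he hw (hTw.trans hTe.symm)
    · have hln : l n = none := by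
        rcases hln : l n with _ | ⟨τ, a⟩ | θ
        · rfl
        · obtain ⟨e, he, hTe, -⟩ := (hl n τ a).1 hln
          exact absurd ⟨e, he, hTe⟩ hex
        · exact θ.elim
      rw [hln] at hstep
      rw [show q (n + 1) = q n from hstep]
      exact ih.stay fun w hw _ hTw => hex ⟨w, hT.proper_of_pos hw (by omega), hTw⟩

theorem sc_exists_lastWrite (hr : (memSC Tid Loc Val).StutterRun q l) (hE : WellFormed E)
    (hT : Schedule E T) (hl : ∀ n, Emits E T n (l n)) {r : Event Tid Loc Val} (hrE : r ∈ E)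
    (hR : r.IsR) : ∃ e, IsLastWrite E T (fun w => T w < T r) r.loc e ∧ e.valW = r.valR := by
  have hrp := proper_of_isR hrE hR
  obtain ⟨n, hn⟩ := Nat.exists_eq_succ_of_ne_zero (hT.pos r hrp).ne'
  obtain ⟨τ, -, hln⟩ := (hl n).eq_some hE hrp hn
  have hstep := hr.step n
  rw [hln] at hstep
  obtain ⟨w, hw, hv⟩ := sc_memInv hr hE hT hl n r.loc
  refine ⟨w, ?_, hv.trans ((scStep_iff.1 hstep).1 hR).symm⟩
  simpa only [hn, Nat.lt_succ_iff] using hw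

omit [DecidableEq Loc] in
theorem exists_graph_of_schedule (hE : WellFormed E) (hT : Schedule E T)
    (hread : ∀ r ∈ E, r.IsR →
      ∃ e, IsLastWrite E T (fun w => T w < T r) r.loc e ∧ e.valW = r.valR) :
    ∃ G ∈ graphsSC Tid Loc Val ∩ graphsFair Tid Loc Val, E = G.E := by
  choose! src hlast hval using hread
  have hsrc : IsRfSource E src := fun r hr hR =>
    ⟨(hlast r hr hR).mem, (hlast r hr hR).isW, (hlast r hr hR).loc_eq, hval r hr hR⟩
  have hP : IsMoKey E T := fun a b ha hb _ _ hloc => hT.inj_loc ha hb hloc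
  let G := keyGraph hE hP hsrc
  have hfr : ∀ a b, G.fr a b → Proper E a ∧ T a < T b := by
    intro a b hab
    obtain ⟨ha, hR, hb, hbW, hloc, hlt, hne⟩ := keyGraph_fr hE hP hsrc hab
    have hap := proper_of_isR ha hR
    refine ⟨hap, lt_of_le_of_ne (not_lt.1 fun h => hlt.not_ge ?_) fun h => hne ?_⟩
    · exact (hlast a ha hR).le b hb hbW hloc.symm h
    · exact (hT.eq_of_mem hap hb h.symm).symm
  refine ⟨G, ⟨closureIrrefl_of_strictMono T fun a b hab => ?_, keyGraph_mo_finite hE hP hsrc,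
    fun b _ => ?_⟩, rfl⟩
  · rcases hab with ⟨ha, hb, hab⟩ | ⟨hb, hR, rfl⟩ | ⟨-, -, -, -, -, hlt⟩ | hab
    · exact hT.mono a b ha hb hab
    · exact (hlast b hb hR).sat
    · exact hlt
    · exact (hfr a b hab).2
  · exact (hT.finite_le (T b)).subset fun a ha => ⟨(hfr a b ha).1, (hfr a b ha).2.le⟩

theorem sc_behMF_subset [DecidableEq Tid] :
    BehMF (memSC Tid Loc Val) ⊆ BehDecl (graphsSC Tid Loc Val ∩ graphsFair Tid Loc Val) := by
  intro β hβ
  obtain ⟨q, l, hr, -, hb⟩ := mem_BehMF_iff.1 hβ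
  exact exists_graph_of_schedule (wellFormed_eventsOf β) hb.schedule_stepTime fun _ hr' hR =>
    sc_exists_lastWrite hr (wellFormed_eventsOf β) hb.schedule_stepTime hb.emits_stepTime hr' hR

omit [DecidableEq Loc] in
theorem EGraph.ConsistentSC.exists_schedule [Finite Tid] {G : EGraph Tid Loc Val}
    (hG : G.ConsistentSC) (hfair : G.Fair) :
    ∃ T, Schedule G.E T ∧ (∀ a b, G.rf a b → T a < T b) ∧ (∀ a b, G.mo a b → T a < T b) ∧
      ∀ a b, G.fr a b → T a < T b := by
  obtain ⟨T, hT, hmono⟩ := G.wf.exists_schedule hG (fun a b ha hb h => Or.inl ⟨ha, hb, h⟩)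
    (by
      intro b hb
      refine ((G.wf.finite_seqBefore b).union ((G.finite_rf b).union
        ((hfair.1 b hb.1).union (hfair.2 b hb.1)))).subset ?_
      rintro a ⟨ha, h⟩
      exact h.imp_left fun hpo => ⟨ha, hpo.2.2⟩)
  refine ⟨T, hT, fun a b h => ?_, fun a b h => ?_, fun a b h => ?_⟩
  · exact hmono a b (G.rf_mem a b h).1 (proper_of_isR (G.rf_mem a b h).2 (G.rf_match a b h).2.1)
      (Or.inr (Or.inl h))
  · exact hmono a b (G.mo_mem a b h).1 (hG.scPerLoc.proper_of_mo h) (Or.inr (Or.inr (Or.inl h)))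
  · obtain ⟨e, hrf, -⟩ := h.1
    exact hmono a b (G.rf_mem e a hrf).2 (hG.scPerLoc.proper_of_fr h) (Or.inr (Or.inr (Or.inr h)))

omit [DecidableEq Loc] in
theorem EGraph.valR_eq_of_memInv {G : EGraph Tid Loc Val} (hT : Schedule G.E T)
    (hrf : ∀ a b, G.rf a b → T a < T b) (hmo : ∀ a b, G.mo a b → T a < T b)
    (hfr : ∀ a b, G.fr a b → T a < T b) {n : ℕ} {M : Loc → Val} (hM : MemInv G.E T n M)
    {r : Event Tid Loc Val} (hr : r ∈ G.E) (hTr : T r = n + 1) (hR : r.IsR) :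
    r.valR = some (M r.loc) := by
  obtain ⟨e, he⟩ := G.rf_total r hr hR
  have hlast : IsLastWrite G.E T (fun w => T w ≤ n) r.loc e := by
    refine EGraph.isLastWrite_of_rf he ?_ (fun a b h => (hmo a b h).le) (fun w h => ?_) ?_
    · have := hrf e r he
      omega
    · have := hfr r w h
      omega
    · omega
  obtain ⟨w, hw, hv⟩ := hM r.loc
  obtain rfl := hlast.unique (fun a b ha hb _ _ hloc => hT.inj_loc ha hb hloc) hw
  exact (G.rf_match e r he).2.2.2.symm.trans hv

theorem sc_behDecl_subset [DecidableEq Tid] [Finite Tid] :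
    BehDecl (graphsSC Tid Loc Val ∩ graphsFair Tid Loc Val) ⊆ BehMF (memSC Tid Loc Val) := by
  rintro β ⟨G, ⟨hG, hfair⟩, hβ⟩
  obtain ⟨T, hT, hrf, hmo, hfr⟩ := EGraph.ConsistentSC.exists_schedule hG hfair
  obtain ⟨q, l, hrun, -, hl⟩ := (memSC Tid Loc Val).exists_stutterRun (MemInv G.E T)
    (fun n _ o _ => Emits G.E T n o) (MemInv.zero G.wf hT.init) (by
      intro n M hM
      by_cases hex : ∃ e, Proper G.E e ∧ T e = n + 1
      · obtain ⟨e, he, hTe⟩ := hex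
        obtain ⟨τ, -, hτ, -⟩ := G.wf.exists_tid_sn he
        exact ⟨some (Sum.inl (τ, e.lab)), _, .of_event hT he hTe hτ,
          scStep_iff.2 ⟨EGraph.valR_eq_of_memInv hT hrf hmo hfr hM he.1 hTe, rfl⟩,
          hM.exec he.1 (fun _ => hTe) fun w hw _ hTw => hT.eq_of_mem he hw (hTw.trans hTe.symm)⟩
      · exact ⟨none, M, .of_no_event (by simp) fun e he hTe => hex ⟨e, he, hTe⟩, rfl,
          hM.stay fun w hw _ hTw => hex ⟨w, hT.proper_of_pos hw (by omega), hTw⟩⟩)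
  rw [← hβ] at hT hl
  exact mem_BehMF_iff.2 ⟨q, l, hrun, Or.inr fun θ => θ.elim, hT.isBehavior hl⟩

end SC

/-! ### Total store order: states determined by commit times -/

section CommitTimes

variable {Tid Loc Val : Type*} [Zero Val]

/-- Commit times `P` of the events of `E` scheduled by `T`: reads and read-modify-writes commit when
they are executed and plain writes commit later, that is, when they leave the buffer. Different
actions take place at different times. -/
structure CommitTimes (E : Set (Event Tid Loc Val)) (T P : Event Tid Loc Val → ℕ) : Prop where
  wf : WellFormed E
  sched : Schedule E T
  init : ∀ e ∈ Init Tid Loc Val, P e = 0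
  eq : ∀ e, e.IsR → P e = T e
  lt : ∀ e, Proper E e → ¬ e.IsR → T e < P e
  inj : ∀ a b, Proper E a → Proper E b → P a = P b → a = b
  cross : ∀ a b, Proper E a → Proper E b → T a = P b → a = b
  fifo : ∀ a b, Proper E a → Proper E b → seqBefore a b → b.IsW → P a < P b

/-- The buffer `b` of the thread `τ` holds the writes executed but not yet committed at time `n`. -/
def BufInv (E : Set (Event Tid Loc Val)) (T P : Event Tid Loc Val → ℕ) (n : ℕ) (τ : Tid)
    (b : List (Loc × Val)) : Prop :=
  ∃ L : List (Event Tid Loc Val), L.map Event.lab = b.map (fun p => ELab.write p.1 p.2) ∧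
    L.Pairwise (fun a b => P b < P a) ∧
    ∀ w, w ∈ L ↔ Proper E w ∧ w.tid = some τ ∧ T w ≤ n ∧ n < P w

/-- The state `q` is determined by the events executed and committed up to time `n`. -/
structure TSOInv (E : Set (Event Tid Loc Val)) (T P : Event Tid Loc Val → ℕ) (n : ℕ)
    (q : TSOState Tid Loc Val) : Prop where
  mem : MemInv E P n q.mem
  buf : ∀ τ, BufInv E T P n τ (q.buf τ)

variable {E : Set (Event Tid Loc Val)} {T P : Event Tid Loc Val → ℕ} {n : ℕ}
  {a b e w : Event Tid Loc Val}

namespace CommitTimes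

variable (K : CommitTimes E T P)

include K

theorem le (he : e ∈ E) : T e ≤ P e := by
  by_cases hi : e ∈ Init Tid Loc Val
  · exact (K.sched.init e hi).trans_le (Nat.zero_le _)
  by_cases hR : e.IsR
  · exact (K.eq e hR).ge
  · exact (K.lt e ⟨he, hi⟩ hR).le

theorem proper_of_pos (he : e ∈ E) (h : 0 < P e) : Proper E e :=
  ⟨he, fun hi => h.ne' (K.init e hi)⟩

theorem pos (he : Proper E e) : 0 < P e :=
  (K.sched.pos e he).trans_le (K.le he.1)

theorem eq_of_commit_eq (he : Proper E e) (ha : a ∈ E) (h : P a = P e) : a = e :=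
  K.inj a e (K.proper_of_pos ha (h ▸ K.pos he)) he h

theorem eq_of_commit_eq_exec (he : Proper E e) (ha : a ∈ E) (h : P a = T e) : a = e :=
  (K.cross e a he (K.proper_of_pos ha (h ▸ K.sched.pos e he)) h.symm).symm

theorem isMoKey : IsMoKey E P := by
  intro a b ha hb _ _ hloc h
  by_cases hbi : b ∈ Init Tid Loc Val
  · by_cases hai : a ∈ Init Tid Loc Val
    · exact eq_of_mem_Init hai hbi hloc
    · exact (K.eq_of_commit_eq ⟨ha, hai⟩ hb h.symm).symm
  · exact K.eq_of_commit_eq ⟨hb, hbi⟩ ha h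

theorem commit_lt_of_seqBefore (ha : a ∈ E) (hb : b ∈ E) (h : seqBefore a b) (hW : b.IsW) :
    P a < P b := by
  have hb' : Proper E b := ⟨hb, h.notMem_Init⟩
  by_cases hi : a ∈ Init Tid Loc Val
  · exact (K.init a hi).trans_lt (K.pos hb')
  · exact K.fifo a b ⟨ha, hi⟩ hb' h hW

theorem exec_eq_iff_commit_eq (he : Proper E e) (hR : e.IsR) (hw : Proper E w) :
    T w = T e ↔ P w = T e := by
  constructor
  · intro h
    rw [K.sched.inj w e hw he h, K.eq e hR]
  · intro h
    rw [K.eq_of_commit_eq_exec he hw.1 h]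

end CommitTimes

theorem BufInv.stay {τ : Tid} {b : List (Loc × Val)} (h : BufInv E T P n τ b)
    (hn : ∀ w, Proper E w → w.tid = some τ → (T w = n + 1 ↔ P w = n + 1)) :
    BufInv E T P (n + 1) τ b := by
  obtain ⟨L, hlab, hsorted, hL⟩ := h
  refine ⟨L, hlab, hsorted, fun w => (hL w).trans ?_⟩
  refine and_congr_right fun hw => and_congr_right fun hτ => ?_
  have := hn w hw hτ
  omega

theorem BufInv.eq_nil {τ : Tid} {b : List (Loc × Val)} (h : BufInv E T P n τ b)
    (hn : ∀ w, Proper E w → w.tid = some τ → T w ≤ n → P w ≤ n) : b = [] := by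
  obtain ⟨L, hlab, -, hL⟩ := h
  obtain rfl : L = [] := List.eq_nil_iff_forall_not_mem.2 fun w hw =>
    let ⟨hwp, hτ, hT, hP⟩ := (hL w).1 hw
    hP.not_ge (hn w hwp hτ hT)
  simpa using hlab.symm

theorem BufInv.push (K : CommitTimes E T P) {τ : Tid} {b : List (Loc × Val)}
    (h : BufInv E T P n τ b) (he : Proper E e) (hT : T e = n + 1) (hτ : e.tid = some τ) {x : Loc}
    {v : Val} (hl : e.lab = .write x v) : BufInv E T P (n + 1) τ ((x, v) :: b) := by
  obtain ⟨L, hlab, hsorted, hL⟩ := h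
  have hR : ¬ e.IsR := by simp [Event.IsR, hl, ELab.IsR]
  have hlt := K.lt e he hR
  refine ⟨e :: L, by simp [hlab, hl], List.pairwise_cons.2 ⟨fun w hw => ?_, hsorted⟩, fun w => ?_⟩
  · obtain ⟨hwp, hwτ, hwT, -⟩ := (hL w).1 hw
    exact K.fifo w e hwp he
      (K.sched.lt_of_same_thread K.wf hwp he (hwτ.trans hτ.symm) (by omega))
      (by simp [Event.IsW, hl, ELab.IsW])
  · rw [List.mem_cons, hL]
    constructor
    · rintro (rfl | ⟨hwp, hwτ, hwT, hwP⟩)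
      · exact ⟨he, hτ, hT.le, by omega⟩
      · have hne : P w ≠ n + 1 := fun hP => by
          have := K.eq_of_commit_eq_exec he hwp.1 (hP.trans hT.symm)
          subst this
          omega
        exact ⟨hwp, hwτ, by omega, by omega⟩
    · rintro ⟨hwp, hwτ, hwT, hwP⟩
      by_cases hTw : T w = n + 1
      · exact Or.inl (K.sched.inj w e hwp he (by omega))
      · exact Or.inr ⟨hwp, hwτ, by omega, by omega⟩

omit [Zero Val] in
theorem exists_oldest_entry {L : List (Event Tid Loc Val)} {b : List (Loc × Val)}
    (hlab : L.map Event.lab = b.map fun p => ELab.write p.1 p.2)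
    (hsorted : L.Pairwise fun a b => P b < P a) (he : e ∈ L) (hmin : ∀ w ∈ L, P e ≤ P w) :
    ∃ L' b' x v, L = L' ++ [e] ∧ b = b' ++ [(x, v)] ∧ e.lab = .write x v ∧
      L'.map Event.lab = b'.map fun p => ELab.write p.1 p.2 := by
  obtain ⟨L', d, rfl⟩ := (List.eq_nil_or_concat' L).resolve_left (List.ne_nil_of_mem he)
  obtain rfl : e = d := by
    rcases List.mem_append.1 he with he' | he'
    · exact absurd ((List.pairwise_append.1 hsorted).2.2 e he' d (by simp))
        (hmin d (by simp)).not_gt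
    · simpa using he'
  rw [List.map_append] at hlab
  obtain ⟨b', c, rfl, hb', hc⟩ := List.map_eq_append_iff.1 hlab.symm
  obtain ⟨p, rfl, hp⟩ := List.map_eq_singleton_iff.1 hc
  exact ⟨L', b', p.1, p.2, rfl, rfl, hp.symm, hb'.symm⟩

theorem BufInv.pop (K : CommitTimes E T P) {τ : Tid} {b : List (Loc × Val)}
    (h : BufInv E T P n τ b) (he : Proper E e) (hP : P e = n + 1) (hR : ¬ e.IsR)
    (hτ : e.tid = some τ) :
    ∃ b' x v, b = b' ++ [(x, v)] ∧ e.lab = .write x v ∧ BufInv E T P (n + 1) τ b' := by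
  obtain ⟨L, hlab, hsorted, hL⟩ := h
  have hlt := K.lt e he hR
  have heL : e ∈ L := (hL e).2 ⟨he, hτ, by omega, by omega⟩
  obtain ⟨L', b', x, v, rfl, rfl, hl, hlab'⟩ := exists_oldest_entry hlab hsorted heL fun w hw => by
    have := ((hL w).1 hw).2.2.2
    omega
  obtain ⟨hsorted', -, hlast⟩ := List.pairwise_append.1 hsorted
  refine ⟨b', x, v, rfl, hl, L', hlab', hsorted', fun w => ⟨fun hw => ?_, ?_⟩⟩
  · obtain ⟨hwp, hwτ, hwT, -⟩ := (hL w).1 (List.mem_append_left _ hw)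
    have := hlast w hw e (by simp)
    exact ⟨hwp, hwτ, by omega, by omega⟩
  · rintro ⟨hwp, hwτ, hwT, hwP⟩
    have hne : T w ≠ n + 1 := fun hTw => by
      have := K.eq_of_commit_eq_exec hwp he.1 (hP.trans hTw.symm)
      subst this
      omega
    have hwL := (hL w).2 ⟨hwp, hwτ, by omega, by omega⟩
    refine (List.mem_append.1 hwL).resolve_right fun hwe => ?_
    rw [List.mem_singleton] at hwe
    subst hwe
    omega

namespace TSOInv

variable {q : TSOState Tid Loc Val}

theorem zero (K : CommitTimes E T P) : TSOInv E T P 0 ⟨fun _ => 0, fun _ => []⟩ := by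
  refine ⟨MemInv.zero K.wf K.init, fun τ => ⟨[], rfl, List.Pairwise.nil, fun w => ?_⟩⟩
  simp only [List.not_mem_nil, false_iff]
  rintro ⟨hw, -, hT, -⟩
  exact (K.sched.pos w hw).not_ge hT

theorem stay (h : TSOInv E T P n q) (K : CommitTimes E T P)
    (hT : ∀ e, Proper E e → T e ≠ n + 1) (hP : ∀ e, Proper E e → P e ≠ n + 1) :
    TSOInv E T P (n + 1) q where
  mem := h.mem.stay fun w hw _ hPw => hP w (K.proper_of_pos hw (by omega)) hPw
  buf τ := (h.buf τ).stay fun w hw _ => iff_of_false (hT w hw) (hP w hw)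

theorem write [DecidableEq Tid] (h : TSOInv E T P n q) (K : CommitTimes E T P)
    (he : Proper E e) (hT : T e = n + 1) {τ : Tid} (hτ : e.tid = some τ) {x : Loc} {v : Val}
    (hl : e.lab = .write x v) :
    TSOInv E T P (n + 1) ⟨q.mem, Function.update q.buf τ ((x, v) :: q.buf τ)⟩ := by
  have hlt := K.lt e he (by simp [Event.IsR, hl, ELab.IsR])
  have hP : ∀ w ∈ E, P w ≠ n + 1 := fun w hw hPw => by
    have := K.eq_of_commit_eq_exec he hw (hPw.trans hT.symm)
    subst this
    omega
  refine ⟨h.mem.stay fun w hw _ => hP w hw, fun τ' => ?_⟩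
  by_cases hττ : τ' = τ
  · subst hττ
    simpa only [Function.update_self] using (h.buf τ').push K he hT hτ hl
  · simp only [Function.update_of_ne hττ]
    refine (h.buf τ').stay fun w hw hwτ => iff_of_false (fun hTw => hττ ?_) (hP w hw.1)
    rw [K.sched.inj w e hw he (hTw.trans hT.symm), hτ] at hwτ
    exact (Option.some.inj hwτ).symm

variable [DecidableEq Loc]

theorem exec (h : TSOInv E T P n q) (K : CommitTimes E T P) (he : Proper E e)
    (hT : T e = n + 1) (hR : e.IsR) : TSOInv E T P (n + 1) ⟨e.lab.exec q.mem, q.buf⟩ where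
  mem := h.mem.exec he.1 (fun _ => (K.eq e hR).trans hT) fun _ hw _ hPw =>
    K.eq_of_commit_eq_exec he hw (hPw.trans hT.symm)
  buf τ := (h.buf τ).stay fun _ hw _ => hT ▸ K.exec_eq_iff_commit_eq he hR hw

theorem prop [DecidableEq Tid] (h : TSOInv E T P n q) (K : CommitTimes E T P)
    (he : Proper E e) (hP : P e = n + 1) (hR : ¬ e.IsR) {τ : Tid} (hτ : e.tid = some τ) :
    ∃ b x v, q.buf τ = b ++ [(x, v)] ∧
      TSOInv E T P (n + 1) ⟨Function.update q.mem x v, Function.update q.buf τ b⟩ := by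
  have hlt := K.lt e he hR
  obtain ⟨b, x, v, hb, hl, hbuf⟩ := (h.buf τ).pop K he hP hR hτ
  refine ⟨b, x, v, hb, ?_, fun τ' => ?_⟩
  · simpa [ELab.exec, hl, ELab.valW, ELab.loc] using h.mem.exec he.1 (fun _ => hP)
      fun w hw _ hPw => K.eq_of_commit_eq he hw (hPw.trans hP.symm)
  by_cases hττ : τ' = τ
  · subst hττ
    simpa only [Function.update_self] using hbuf
  · simp only [Function.update_of_ne hττ]
    refine (h.buf τ').stay fun w hw hwτ => iff_of_false (fun hTw => ?_) (fun hPw => hττ ?_)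
    · have := K.eq_of_commit_eq_exec hw he.1 (hP.trans hTw.symm)
      subst this
      omega
    · rw [K.eq_of_commit_eq he hw.1 (hPw.trans hP.symm), hτ] at hwτ
      exact (Option.some.inj hwτ).symm

end TSOInv

omit [Zero Val] in
theorem MemInv.exists_lastWrite_applyBuffer [DecidableEq Loc] {M : Loc → Val}
    (h : MemInv E P n M) (x : Loc) {L : List (Event Tid Loc Val)} {b : List (Loc × Val)}
    (hlab : L.map Event.lab = b.map fun p => ELab.write p.1 p.2)
    (hsorted : L.Pairwise fun a b => P b < P a) (hL : ∀ w ∈ L, w ∈ E ∧ n < P w) :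
    ∃ w, IsLastWrite E P (fun w => P w ≤ n ∨ w ∈ L) x w ∧ w.valW = some (applyBuffer M b x) := by
  induction L generalizing b with
  | nil =>
    obtain rfl : b = [] := by simpa using hlab.symm
    simpa [applyBuffer] using h x
  | cons e L ih =>
    obtain ⟨⟨y, v⟩, b, rfl⟩ : ∃ p b', b = p :: b' := List.exists_cons_of_ne_nil (by grind)
    obtain ⟨he, hlab⟩ := List.cons.inj hlab
    obtain ⟨hlast, hsorted⟩ := List.pairwise_cons.1 hsorted
    obtain ⟨w, hw, hv⟩ := ih hlab hsorted fun w hw => hL w (List.mem_cons_of_mem _ hw)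
    have happ : applyBuffer M ((y, v) :: b) = Function.update (applyBuffer M b) y v := rfl
    have hloc : e.loc = y := by simp [Event.loc, he, ELab.loc]
    rw [happ]
    by_cases hy : y = x
    · subst hy
      refine ⟨e, ⟨(hL e List.mem_cons_self).1, by simp [Event.IsW, he, ELab.IsW], hloc,
        Or.inr List.mem_cons_self, ?_⟩, by simp [Event.valW, he, ELab.valW]⟩
      rintro w' - - - (hle | hw')
      · exact hle.trans (hL e List.mem_cons_self).2.le
      · rcases List.mem_cons.1 hw' with rfl | hw'
        exacts [le_rfl, (hlast w' hw').le]
    · refine ⟨w, ⟨hw.mem, hw.isW, hw.loc_eq, hw.sat.imp_right (List.mem_cons_of_mem _), ?_⟩,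
        by rw [Function.update_of_ne (Ne.symm hy), hv]⟩
      refine fun w' hE hW hx hsat => hw.le w' hE hW hx (hsat.imp_right fun hw' => ?_)
      refine (List.mem_cons.1 hw').resolve_left ?_
      rintro rfl
      exact hy (hloc.symm.trans hx)

theorem TSOInv.exists_lastWrite [DecidableEq Loc] {q : TSOState Tid Loc Val}
    (h : TSOInv E T P n q) (τ : Tid) (x : Loc) :
    ∃ w, IsLastWrite E P (fun w => P w ≤ n ∨ (w.tid = some τ ∧ T w ≤ n)) x w ∧
      w.valW = some (applyBuffer q.mem (q.buf τ) x) := by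
  obtain ⟨L, hlab, hsorted, hL⟩ := h.buf τ
  obtain ⟨w, hw, hv⟩ := h.mem.exists_lastWrite_applyBuffer x hlab hsorted fun w hw =>
    ⟨((hL w).1 hw).1.1, ((hL w).1 hw).2.2.2⟩
  refine ⟨w, ⟨hw.mem, hw.isW, hw.loc_eq, hw.sat.imp_right fun hwL => ?_, ?_⟩, hv⟩
  · exact ⟨((hL w).1 hwL).2.1, ((hL w).1 hwL).2.2.1⟩
  · refine fun w' hE hW hx hsat => hw.le w' hE hW hx (or_iff_not_imp_left.2 fun hP => ?_)
    obtain ⟨hτ, hT⟩ := hsat.resolve_left hP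
    exact (hL w').2 ⟨⟨hE, notMem_Init_of_tid hτ⟩, hτ, hT, not_le.1 hP⟩

end CommitTimes

/-! ### Total store order: from runs to graphs -/

section TSOGraph

variable {Tid Loc Val : Type*}

/-- The write `w` is visible to the event `r`: it has been committed before `r` is executed, or it
has been executed before `r` by the same thread. -/
def Visible (T P : Event Tid Loc Val → ℕ) (r w : Event Tid Loc Val) : Prop :=
  P w < T r ∨ (w.tid = r.tid ∧ T w < T r)

open Classical in
/-- The write `e` itself, or the source of the read `e`. The commit time of this write is the time
at which `e` takes effect in the coherence order of its location. -/
noncomputable def writeOf (src : Event Tid Loc Val → Event Tid Loc Val) (e : Event Tid Loc Val) :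
    Event Tid Loc Val :=
  if e.IsW then e else src e

variable [Zero Val] {E : Set (Event Tid Loc Val)} {T P : Event Tid Loc Val → ℕ}
  {src : Event Tid Loc Val → Event Tid Loc Val} {a b w : Event Tid Loc Val}

namespace CommitTimes

variable (K : CommitTimes E T P)

include K

theorem seqBefore_of_exec_lt (ha : a ∈ E) (hb : Proper E b) (ht : a.tid = b.tid)
    (hlt : T a < T b) : seqBefore a b := by
  obtain ⟨τ, -, hτ, -⟩ := K.wf.exists_tid_sn hb
  exact K.sched.lt_of_same_thread K.wf ⟨ha, notMem_Init_of_tid (ht.trans hτ)⟩ hb ht hlt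

theorem exec_lt_of_visible (hw : w ∈ E) (h : Visible T P b w) : T w < T b :=
  h.elim (K.le hw).trans_lt And.right

theorem commit_lt_of_visible (hw : w ∈ E) (hb : Proper E b) (hW : b.IsW)
    (h : Visible T P b w) : P w < P b := by
  rcases h with hlt | ⟨ht, hlt⟩
  · exact hlt.trans_le (K.le hb.1)
  · exact K.commit_lt_of_seqBefore hw hb.1 (K.seqBefore_of_exec_lt hw hb ht hlt) hW

theorem visible_of_seqBefore (ha : a ∈ E) (hb : b ∈ E) (h : seqBefore a b) :
    Visible T P b a := by
  rcases h with ⟨hai, hbi⟩ | hab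
  · exact Or.inl ((K.init a hai).trans_lt (K.sched.pos b ⟨hb, hbi⟩))
  · exact Or.inr ⟨hab.1, K.sched.mono a b ha hb (Or.inr hab)⟩

theorem visible_trans (hb : b ∈ E) (ha : Proper E a) (h : seqBefore a b)
    (hw : Visible T P a w) : Visible T P b w := by
  have hlt := K.sched.mono a b ha.1 hb h
  exact hw.imp hlt.trans' fun ⟨ht, hwa⟩ => ⟨ht.trans (ha.seqBefore_iff.1 h).1, hwa.trans hlt⟩

variable (hsrc : IsRfSource E src)
  (hlast : ∀ r ∈ E, r.IsR → IsLastWrite E P (Visible T P r) r.loc (src r))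

include hlast

theorem lt_of_fr (h : (keyGraph K.wf K.isMoKey hsrc).fr a b) :
    Proper E a ∧ a.IsR ∧ b.IsW ∧ P (src a) < P b ∧ T a < P b := by
  obtain ⟨⟨_, ⟨haE, haR, rfl⟩, ⟨-, hbE, -, hbW, hloc, hlt⟩⟩, hne⟩ := h
  have ha := proper_of_isR haE haR
  refine ⟨ha, haR, hbW, hlt, lt_of_le_of_ne (not_lt.1 fun hba => hlt.not_ge ?_) fun heq => hne ?_⟩
  · exact (hlast a haE haR).le b hbE hbW (hloc.symm.trans (hlast a haE haR).loc_eq) (Or.inl hba)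
  · exact ⟨(K.eq_of_commit_eq_exec ha hbE heq.symm).symm, haE⟩

theorem keyGraph_global : ClosureIrrefl fun a b =>
    (keyGraph K.wf K.isMoKey hsrc).ppo a b ∨ (keyGraph K.wf K.isMoKey hsrc).rfe a b ∨
      (keyGraph K.wf K.isMoKey hsrc).mo a b ∨ (keyGraph K.wf K.isMoKey hsrc).fr a b := by
  refine closureIrrefl_of_strictMono P fun a b hab => ?_
  rcases hab with ⟨⟨ha, hb, hab⟩, hppo⟩ | ⟨⟨hb, hR, rfl⟩, hext⟩ | ⟨-, -, -, -, -, hlt⟩ | hfr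
  · by_cases hW : b.IsW
    · exact K.commit_lt_of_seqBefore ha hb hab hW
    have hbR : b.IsR := (ELab.isR_or_isW b.lab).resolve_right hW
    have haR : a.IsR := by
      by_contra hR
      refine hppo ⟨⟨(ELab.isR_or_isW a.lab).resolve_left hR, fun h => ?_⟩, hbR, fun h => ?_⟩
      exacts [hR ((ELab.isRMW_iff _).1 h).1, hW ((ELab.isRMW_iff _).1 h).2]
    rw [K.eq a haR, K.eq b hbR]
    exact K.sched.mono a b ha hb hab
  · have hsE := (hlast b hb hR).mem
    rw [K.eq b hR]
    refine (hlast b hb hR).sat.resolve_right fun ⟨ht, hlt⟩ => hext ⟨hsE, hb, ?_⟩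
    exact K.seqBefore_of_exec_lt hsE (proper_of_isR hb hR) ht hlt
  · exact hlt
  · obtain ⟨-, haR, -, -, hlt⟩ := K.lt_of_fr hsrc hlast hfr
    rwa [K.eq a haR]

theorem commit_writeOf_le (ha : a ∈ E) (hb : b ∈ E) (h : seqBefore a b) (hloc : a.loc = b.loc) :
    P (writeOf src a) ≤ P (writeOf src b) := by
  have hwrite : writeOf src a ∈ E ∧ (writeOf src a).IsW ∧ (writeOf src a).loc = a.loc ∧
      Visible T P b (writeOf src a) := by
    by_cases haW : a.IsW
    · rw [writeOf, if_pos haW]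
      exact ⟨ha, haW, rfl, K.visible_of_seqBefore ha hb h⟩
    · have haR : a.IsR := (ELab.isR_or_isW a.lab).resolve_right haW
      have hs := hlast a ha haR
      rw [writeOf, if_neg haW]
      exact ⟨hs.mem, hs.isW, hs.loc_eq, K.visible_trans hb (proper_of_isR ha haR) h hs.sat⟩
  obtain ⟨hE, hW, hwloc, hvis⟩ := hwrite
  by_cases hbW : b.IsW
  · rw [writeOf.eq_def src b, if_pos hbW]
    exact (K.commit_lt_of_visible hE ⟨hb, h.notMem_Init⟩ hbW hvis).le
  · have hbR : b.IsR := (ELab.isR_or_isW b.lab).resolve_right hbW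
    rw [writeOf.eq_def src b, if_neg hbW]
    exact (hlast b hb hbR).le _ hE hW (hwloc.trans hloc) hvis

theorem keyGraph_scPerLoc : (keyGraph K.wf K.isMoKey hsrc).SCPerLoc := by
  refine closureIrrefl_of_lex (fun e => P (writeOf src e)) T fun a b hab => ?_
  rcases hab with ⟨⟨ha, hb, hab⟩, hloc⟩ | ⟨hb, hR, rfl⟩ | ⟨-, -, haW, hbW, -, hlt⟩ | hfr
  · exact Or.inr ⟨K.commit_writeOf_le hlast ha hb hab hloc, K.sched.mono a b ha hb hab⟩
  · obtain ⟨hsE, hsW, -, hvis, -⟩ := hlast b hb hR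
    refine Or.inr ⟨?_, K.exec_lt_of_visible hsE hvis⟩
    by_cases hbW : b.IsW
    · simpa only [writeOf, if_pos hsW, if_pos hbW] using
        (K.commit_lt_of_visible hsE (proper_of_isR hb hR) hbW hvis).le
    · simp only [writeOf, if_pos hsW, if_neg hbW, le_refl]
  · simpa only [writeOf, if_pos haW, if_pos hbW] using Or.inl hlt
  · obtain ⟨-, haR, hbW, hlt, hTlt⟩ := K.lt_of_fr hsrc hlast hfr
    refine Or.inl ?_
    by_cases haW : a.IsW
    · simpa only [writeOf, if_pos haW, if_pos hbW, K.eq a haR] using hTlt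
    · simpa only [writeOf, if_neg haW, if_pos hbW] using hlt

omit hlast

theorem exists_graph (hread : ∀ r ∈ E, r.IsR →
      ∃ w, IsLastWrite E P (Visible T P r) r.loc w ∧ w.valW = r.valR) :
    ∃ G ∈ graphsTSO Tid Loc Val ∩ graphsFair Tid Loc Val, E = G.E := by
  choose! src hlast hval using hread
  have hsrc : IsRfSource E src := fun r hr hR =>
    ⟨(hlast r hr hR).mem, (hlast r hr hR).isW, (hlast r hr hR).loc_eq, hval r hr hR⟩
  refine ⟨keyGraph K.wf K.isMoKey hsrc,
    ⟨⟨K.keyGraph_global hsrc hlast, K.keyGraph_scPerLoc hsrc hlast⟩,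
      keyGraph_mo_finite K.wf K.isMoKey hsrc, fun b _ => ?_⟩, rfl⟩
  refine (K.sched.finite_le (P b)).subset fun a ha => ?_
  obtain ⟨hap, -, -, -, hlt⟩ := K.lt_of_fr hsrc hlast ha
  exact ⟨hap, hlt.le⟩

end CommitTimes

end TSOGraph

section Stutter

variable {Q Obs Sil : Type*} {A : LTS Q Obs Sil} {q : ℕ → Q} {l : ℕ → Option (Obs ⊕ Sil)} {N : ℕ}

theorem LTS.StutterRun.state_eq_of_none (h : A.StutterRun q l) (hN : ∀ n, N ≤ n → l n = none)
    {n : ℕ} (hn : N ≤ n) : q n = q N := by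
  induction n, hn using Nat.le_induction with
  | base => rfl
  | succ n hn ih =>
    have hstep := h.step n
    rw [hN n hn] at hstep
    exact Eq.trans hstep ih

theorem LTS.StutterRun.append_step (h : A.StutterRun q l) (hN : ∀ n, N ≤ n → l n = none)
    {σ : Obs ⊕ Sil} {q' : Q} (hstep : A.step (q N) σ q') :
    A.StutterRun (fun n => if n ≤ N then q n else q') (Function.update l N (some σ)) := by
  refine ⟨by simp [h.start], fun n => ?_⟩
  rcases lt_trichotomy n N with hlt | rfl | hgt
  · simpa [hlt.ne, hlt.le, Nat.succ_le_of_lt hlt] using h.step n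
  · simpa [LTS.StepOpt] using hstep
  · simp [hgt.ne', hN n hgt.le, LTS.StepOpt, hgt.not_ge, (hgt.trans n.lt_succ_self).not_ge]

variable {Tid Loc Val : Type*} {l l' : ℕ → Option ((Tid × ELab Loc Val) ⊕ Sil)}
  {β : Behavior Tid Loc Val}

theorem IsBehavior.congr (h : IsBehavior l β)
    (hl : ∀ n σ, l' n = some (Sum.inl σ) ↔ l n = some (Sum.inl σ)) : IsBehavior l' β := by
  have hthread : OfThread l' = OfThread l := by
    funext τ n
    simp only [OfThread, hl]
  intro τ k a
  rw [hthread, h τ k a]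
  simp only [hl]

end Stutter

section TSORun

variable {Tid Loc Val : Type*}

/-- Every buffer that is nonempty from some time on is propagated at some later time. -/
def BufferFair (q : ℕ → TSOState Tid Loc Val) (l : ℕ → Option ((Tid × ELab Loc Val) ⊕ Tid)) :
    Prop :=
  ∀ (τ : Tid) (k : ℕ), (∀ j, k ≤ j → (q j).buf τ ≠ []) → ∃ j, k ≤ j ∧ l j = some (Sum.inr τ)

/-- Step `n` is a plain write of the thread `τ`. -/
def WriteStep (l : ℕ → Option ((Tid × ELab Loc Val) ⊕ Tid)) (τ : Tid) (n : ℕ) : Prop :=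
  ∃ x v, l n = some (Sum.inl (τ, ELab.write x v))

/-- Step `n` is a propagation step of the thread `τ`. -/
def PropStep (l : ℕ → Option ((Tid × ELab Loc Val) ⊕ Tid)) (τ : Tid) (n : ℕ) : Prop :=
  l n = some (Sum.inr τ)

open Classical in
/-- The entry buffered by the write step `m` of the thread `τ` is propagated in step `n`. Since
buffers are queues, this is the propagation step with as many predecessors as `m` has. -/
def PropagatedAt (l : ℕ → Option ((Tid × ELab Loc Val) ⊕ Tid)) (τ : Tid) (m n : ℕ) : Prop :=
  WriteStep l τ m ∧ PropStep l τ n ∧ Nat.count (PropStep l τ) n = Nat.count (WriteStep l τ) m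

theorem ELab.exists_eq_write {a : ELab Loc Val} (h : ¬ a.IsR) : ∃ x v, a = .write x v := by
  cases a with
  | write x v => exact ⟨x, v, rfl⟩
  | _ => exact absurd trivial h

section PropagatedAt

variable {l : ℕ → Option ((Tid × ELab Loc Val) ⊕ Tid)} {τ τ' : Tid} {m m' n n' : ℕ}

theorem PropagatedAt.write_eq (h : PropagatedAt l τ m n) (h' : PropagatedAt l τ' m' n) :
    m = m' := by
  classical
  obtain rfl : τ = τ' := Sum.inr.inj (Option.some.inj (h.2.1.symm.trans h'.2.1))
  exact Nat.count_injective h.1 h'.1 (h.2.2.symm.trans h'.2.2)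

theorem PropagatedAt.prop_eq (h : PropagatedAt l τ m n) (h' : PropagatedAt l τ m n') : n = n' := by
  classical exact Nat.count_injective h.2.1 h'.2.1 (h.2.2.trans h'.2.2.symm)

theorem PropagatedAt.prop_lt (h : PropagatedAt l τ m n) (h' : PropagatedAt l τ m' n')
    (hlt : m < m') : n < n' := by
  classical
  refine (Nat.count_monotone (PropStep l τ)).reflect_lt ?_
  rw [h.2.2, h'.2.2]
  exact Nat.count_strict_mono h.1 hlt

end PropagatedAt

variable [DecidableEq Tid] [DecidableEq Loc]

theorem tsoStep_iff_of_isR {q q' : TSOState Tid Loc Val} {τ : Tid} {a : ELab Loc Val}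
    (hR : a.IsR) : tsoStep q (Sum.inl (τ, a)) q' ↔ (a.IsRMW → q.buf τ = []) ∧
      a.valR = some (applyBuffer q.mem (q.buf τ) a.loc) ∧ q' = ⟨a.exec q.mem, q.buf⟩ := by
  cases a with
  | read x v =>
    simp only [tsoStep, ELab.IsRMW, ELab.valR, ELab.valW, ELab.loc, ELab.exec, false_imp_iff,
      true_and, Option.some.injEq]
    rw [eq_comm]
  | write x v => exact hR.elim
  | rmw x v v' =>
    simp only [tsoStep, ELab.IsRMW, ELab.valR, ELab.valW, ELab.loc, ELab.exec, true_imp_iff,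
      Option.some.injEq]
    refine and_congr_right fun hb => ?_
    rw [hb, applyBuffer, List.foldr_nil, eq_comm]

variable [Zero Val]

theorem tso_enabled_prop {q : TSOState Tid Loc Val} {τ : Tid} :
    (memTSO Tid Loc Val).Enabled q (Sum.inr τ) ↔ q.buf τ ≠ [] := by
  constructor
  · rintro ⟨q', b, x, v, hb, -⟩ hnil
    simp [hnil] at hb
  · intro hne
    obtain ⟨b, p, hb⟩ := (List.eq_nil_or_concat' (q.buf τ)).resolve_left hne
    exact ⟨_, b, p.1, p.2, hb, rfl⟩

variable {q : ℕ → TSOState Tid Loc Val} {l : ℕ → Option ((Tid × ELab Loc Val) ⊕ Tid)}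
  {β : Behavior Tid Loc Val}

theorem tso_exists_flushed [Finite Tid] (hr : (memTSO Tid Loc Val).StutterRun q l) {N : ℕ}
    (hN : ∀ n, N ≤ n → l n = none) (hb : IsBehavior l β) :
    ∃ q l, (memTSO Tid Loc Val).StutterRun q l ∧ BufferFair q l ∧ IsBehavior l β := by
  cases nonempty_fintype Tid
  induction hs : ∑ τ, ((q N).buf τ).length generalizing N q l with
  | zero =>
    refine ⟨q, l, hr, fun τ k hk => ?_, hb⟩
    have hnil := List.length_eq_zero_iff.1 (Finset.sum_eq_zero_iff.1 hs τ (Finset.mem_univ τ))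
    have hne := hk (max k N) (le_max_left _ _)
    rw [hr.state_eq_of_none hN (le_max_right _ _)] at hne
    exact absurd hnil hne
  | succ s ih =>
    obtain ⟨τ, hτ⟩ : ∃ τ, (q N).buf τ ≠ [] := by
      by_contra! hnil
      simp [hnil] at hs
    obtain ⟨q', hstep⟩ := (tso_enabled_prop (Val := Val)).2 hτ
    refine ih (hr.append_step hN hstep) (N := N + 1) (fun n hn => ?_)
      (hb.congr fun n σ => ?_) ?_
    · rw [Function.update_of_ne (by omega), hN n (by omega)]
    · by_cases hn : n = N
      · subst hn
        simp [hN n le_rfl]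
      · rw [Function.update_of_ne hn]
    · obtain ⟨b, x, v, hbuf, rfl⟩ := hstep
      have hlen : ∀ τ', ((q N).buf τ').length =
          (Function.update (q N).buf τ b τ').length + if τ' = τ then 1 else 0 := by
        intro τ'
        by_cases h : τ' = τ
        · subst h
          simp [hbuf]
        · simp [h]
      simp only [hlen, Finset.sum_add_distrib, Finset.sum_ite_eq', Finset.mem_univ, if_true,
        Nat.add_right_cancel_iff] at hs
      simpa only [Nat.not_succ_le_self, if_false] using hs

theorem tso_exists_bufferFair [Finite Tid] (h : β ∈ BehMF (memTSO Tid Loc Val)) :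
    ∃ q l, (memTSO Tid Loc Val).StutterRun q l ∧ BufferFair q l ∧ IsBehavior l β := by
  obtain ⟨q, l, hr, ⟨N, hN⟩ | hfair, hb⟩ := mem_BehMF_iff.1 h
  · exact tso_exists_flushed hr hN hb
  · exact ⟨q, l, hr, fun τ k hk => hfair τ k fun j hj => tso_enabled_prop.2 (hk j hj), hb⟩

open Classical in
theorem tso_buffer_length_succ (hr : (memTSO Tid Loc Val).StutterRun q l) (τ : Tid) (n : ℕ) :
    ((q (n + 1)).buf τ).length + (if PropStep l τ n then 1 else 0) =
      ((q n).buf τ).length + if WriteStep l τ n then 1 else 0 := by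
  have h := hr.step n
  rcases hl : l n with _ | ⟨τ', a⟩ | τ' <;> rw [hl] at h <;> simp only [PropStep, WriteStep, hl]
  · rw [show q (n + 1) = q n from h]
    simp
  · by_cases hR : a.IsR
    · have hne : ∀ x v, a ≠ .write x v := by
        rintro x v rfl
        exact hR
      rw [((tsoStep_iff_of_isR hR).1 h).2.2]
      simp [hne]
    · obtain ⟨x, v, rfl⟩ := ELab.exists_eq_write hR
      rw [show q (n + 1) = _ from h]
      by_cases hτ : τ' = τ
      · subst hτ
        simp
      · simp [hτ, Ne.symm hτ]
  · obtain ⟨b, x, v, hb, hq⟩ := h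
    rw [hq]
    by_cases hτ : τ' = τ
    · subst hτ
      simp [hb]
    · simp [hτ, Ne.symm hτ]

variable (hr : (memTSO Tid Loc Val).StutterRun q l) {τ : Tid} {m n k : ℕ}

include hr

open Classical in
theorem tso_buffer_length (τ : Tid) (n : ℕ) :
    ((q n).buf τ).length + Nat.count (PropStep l τ) n = Nat.count (WriteStep l τ) n := by
  induction n with
  | zero =>
    rw [hr.start]
    simp [memTSO]
  | succ n ih =>
    have := tso_buffer_length_succ hr τ n
    rw [Nat.count_succ, Nat.count_succ]
    omega

theorem tso_exists_propagatedAt (hfair : BufferFair q l) (hm : WriteStep l τ m) :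
    ∃ n, PropagatedAt l τ m n := by
  classical
  by_contra! hc
  have hle : ∀ n, Nat.count (PropStep l τ) n ≤ Nat.count (WriteStep l τ) m := by
    intro n
    by_contra! hlt
    obtain ⟨n', hn', hcount⟩ := exists_count_eq _ _ n hlt
    exact hc n' ⟨hm, hn', hcount⟩
  have hne : ∀ j, m + 1 ≤ j → (q j).buf τ ≠ [] := by
    intro j hj hnil
    have hlen := tso_buffer_length hr τ j
    have hcount := Nat.count_strict_mono hm hj
    have := hle j
    rw [hnil, List.length_nil] at hlen
    omega
  have hinf : (Set.ofPred (PropStep l τ)).Infinite := Set.infinite_of_forall_exists_gt fun k => by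
    obtain ⟨j, hj, hl⟩ := hfair τ (m + k + 1) fun j hj => hne j (by omega)
    exact ⟨j, hl, by omega⟩
  have hnth := hle (Nat.nth (PropStep l τ) (Nat.count (WriteStep l τ) m + 1))
  rw [Nat.count_nth_of_infinite hinf] at hnth
  omega

open Classical in
theorem tso_count_lt_of_propStep (hn : PropStep l τ n) :
    Nat.count (PropStep l τ) n < Nat.count (WriteStep l τ) n := by
  have hstep := hr.step n
  rw [hn] at hstep
  have hpos := List.length_pos_iff.2 (tso_enabled_prop.1 ⟨_, hstep⟩)
  have := tso_buffer_length hr τ n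
  omega

theorem tso_exists_write_propagatedAt (hn : PropStep l τ n) : ∃ m, PropagatedAt l τ m n := by
  classical
  obtain ⟨m, hm, hcount⟩ := exists_count_eq _ _ n (tso_count_lt_of_propStep hr hn)
  exact ⟨m, hm, hn, hcount.symm⟩

theorem PropagatedAt.lt (h : PropagatedAt l τ m n) : m < n := by
  classical
  refine (Nat.count_monotone (WriteStep l τ)).reflect_lt ?_
  rw [← h.2.2]
  exact tso_count_lt_of_propStep hr h.2.1

theorem PropagatedAt.lt_of_buffer_eq_nil (h : PropagatedAt l τ m n) (hk : (q k).buf τ = [])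
    (hlt : m < k) : n < k := by
  classical
  refine (Nat.count_monotone (PropStep l τ)).reflect_lt ?_
  have hlen := tso_buffer_length hr τ k
  have hcount := Nat.count_strict_mono h.1 hlt
  rw [hk, List.length_nil] at hlen
  have := h.2.2
  omega

omit hr

/-- `P` is the commit time of the events of a run with labels `l`: reads and read-modify-writes
commit when they are executed, and plain writes when their buffer entry is propagated. -/
structure PropagationTimes (E : Set (Event Tid Loc Val)) (T : Event Tid Loc Val → ℕ)
    (l : ℕ → Option ((Tid × ELab Loc Val) ⊕ Tid)) (P : Event Tid Loc Val → ℕ) : Prop where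
  init : ∀ e ∈ Init Tid Loc Val, P e = 0
  eq : ∀ e, e.IsR → P e = T e
  propagated : ∀ e, Proper E e → ¬ e.IsR → ∃ m n τ, e.tid = some τ ∧ T e = m + 1 ∧ P e = n + 1 ∧
    PropagatedAt l τ m n

/-- The optional label `o` of step `n` is a propagation of `τ` iff a plain write of `τ` commits at
time `n + 1`. -/
def EmitsProp (E : Set (Event Tid Loc Val)) (P : Event Tid Loc Val → ℕ) (n : ℕ)
    (o : Option ((Tid × ELab Loc Val) ⊕ Tid)) : Prop :=
  ∀ τ, o = some (Sum.inr τ) ↔ ∃ w, Proper E w ∧ ¬ w.IsR ∧ w.tid = some τ ∧ P w = n + 1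

variable {E : Set (Event Tid Loc Val)} {T P : Event Tid Loc Val → ℕ} {a b e : Event Tid Loc Val}

theorem tso_exists_propagationTimes (hr : (memTSO Tid Loc Val).StutterRun q l)
    (hfair : BufferFair q l) (hE : WellFormed E) (hT : Schedule E T)
    (hl : ∀ n, Emits E T n (l n)) : ∃ P, PropagationTimes E T l P := by
  classical
  have hwrite : ∀ e, Proper E e → ¬ e.IsR →
      ∃ m n, T e = m + 1 ∧ ∃ τ, e.tid = some τ ∧ PropagatedAt l τ m n := by
    intro e he hR
    obtain ⟨m, hm⟩ := Nat.exists_eq_succ_of_ne_zero (hT.pos e he).ne'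
    obtain ⟨τ, hτ, hlm⟩ := (hl m).eq_some hE he hm
    obtain ⟨x, v, hlab⟩ := ELab.exists_eq_write hR
    obtain ⟨n, hn⟩ := tso_exists_propagatedAt hr hfair ⟨x, v, hlab ▸ hlm⟩
    exact ⟨m, n, hm, τ, hτ, hn⟩
  choose! m n hm hwrite using hwrite
  refine ⟨fun e => if Proper E e ∧ ¬ e.IsR then n e + 1 else T e, fun e he => ?_, fun e hR => ?_,
    fun e he hR => ?_⟩
  · rw [if_neg fun h => h.1.2 he, hT.init e he]
  · rw [if_neg fun h => h.2 hR]
  · obtain ⟨τ, hτ, hprop⟩ := hwrite e he hR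
    exact ⟨m e, n e, τ, hτ, hm e he hR, if_pos ⟨he, hR⟩, hprop⟩

namespace PropagationTimes

variable (H : PropagationTimes E T l P)

include H

omit [DecidableEq Tid] [DecidableEq Loc] in
theorem eq_of_exec_eq_commit (hE : WellFormed E) (hT : Schedule E T) (hl : ∀ n, Emits E T n (l n))
    (ha : Proper E a) (hb : Proper E b) (hab : T a = P b) : a = b := by
  by_cases hR : b.IsR
  · exact hT.inj a b ha hb (hab.trans (H.eq b hR))
  · obtain ⟨m, n, τ, -, -, hP, hprop⟩ := H.propagated b hb hR
    obtain ⟨τ', -, hln⟩ := (hl n).eq_some hE ha (hab.trans hP)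
    exact absurd (hprop.2.1.symm.trans hln) (by simp)

include hr in
theorem exec_lt_commit (he : Proper E e) (hR : ¬ e.IsR) : T e < P e := by
  obtain ⟨m, n, τ, -, hm, hn, hprop⟩ := H.propagated e he hR
  have := hprop.lt hr
  omega

include hr in
theorem fifo (hE : WellFormed E) (hT : Schedule E T) (hl : ∀ n, Emits E T n (l n))
    (ha : Proper E a) (hb : Proper E b) (hab : seqBefore a b) (hW : b.IsW) : P a < P b := by
  have hlt := hT.mono a b ha.1 hb.1 hab
  have hle : T b ≤ P b := by
    by_cases hR : b.IsR
    · exact (H.eq b hR).ge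
    · exact (H.exec_lt_commit hr hb hR).le
  by_cases haR : a.IsR
  · exact (H.eq a haR).trans_lt (hlt.trans_le hle)
  obtain ⟨m, n, τ, hτ, hm, hn, hprop⟩ := H.propagated a ha haR
  have hbτ : b.tid = some τ := (ha.seqBefore_iff.1 hab).1.symm.trans hτ
  by_cases hR : b.IsR
  · obtain ⟨k, hk⟩ := Nat.exists_eq_succ_of_ne_zero (hT.pos b hb).ne'
    obtain ⟨τ', hτ', hlk⟩ := (hl k).eq_some hE hb hk
    obtain rfl : τ = τ' := Option.some.inj (hbτ.symm.trans hτ')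
    have hstep := hr.step k
    rw [hlk] at hstep
    have hnil := ((tsoStep_iff_of_isR hR).1 hstep).1 ((ELab.isRMW_iff b.lab).2 ⟨hR, hW⟩)
    have := hprop.lt_of_buffer_eq_nil hr hnil (by omega)
    rw [H.eq b hR]
    omega
  · obtain ⟨m', n', τ', hτ', hm', hn', hprop'⟩ := H.propagated b hb hR
    obtain rfl : τ = τ' := Option.some.inj (hbτ.symm.trans hτ')
    have := hprop.prop_lt hprop' (by omega)
    omega

include hr in
theorem commitTimes (hE : WellFormed E) (hT : Schedule E T) (hl : ∀ n, Emits E T n (l n)) :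
    CommitTimes E T P where
  wf := hE
  sched := hT
  init := H.init
  eq := H.eq
  lt _ he hR := H.exec_lt_commit hr he hR
  cross _ _ ha hb hab := H.eq_of_exec_eq_commit hE hT hl ha hb hab
  fifo _ _ ha hb hab hW := H.fifo hr hE hT hl ha hb hab hW
  inj a b ha hb hab := by
    by_cases haR : a.IsR
    · exact H.eq_of_exec_eq_commit hE hT hl ha hb ((H.eq a haR).symm.trans hab)
    by_cases hbR : b.IsR
    · exact (H.eq_of_exec_eq_commit hE hT hl hb ha ((H.eq b hbR).symm.trans hab.symm)).symm
    obtain ⟨m, n, τ, -, hm, hn, hprop⟩ := H.propagated a ha haR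
    obtain ⟨m', n', τ', -, hm', hn', hprop'⟩ := H.propagated b hb hbR
    obtain rfl : n = n' := by omega
    exact hT.inj a b ha hb (by rw [hm, hm', hprop.write_eq hprop'])

include hr in
theorem emitsProp (hl : ∀ n, Emits E T n (l n)) (n : ℕ) :
    EmitsProp E P n (l n) := by
  intro τ
  constructor
  · intro hn
    obtain ⟨m, hprop⟩ := tso_exists_write_propagatedAt hr hn
    obtain ⟨x, v, hlm⟩ := hprop.1
    obtain ⟨e, he, hTe, hτ, hlab⟩ := (hl m τ _).1 hlm
    have hR : ¬ e.IsR := by simp [Event.IsR, hlab, ELab.IsR]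
    obtain ⟨m', n', τ', hτ', hm', hn', hprop'⟩ := H.propagated e he hR
    obtain rfl : τ = τ' := Option.some.inj (hτ.symm.trans hτ')
    obtain rfl : m = m' := by omega
    exact ⟨e, he, hR, hτ, by rw [hn', hprop.prop_eq hprop']⟩
  · rintro ⟨e, he, hR, hτ, hn⟩
    obtain ⟨m', n', τ', hτ', -, hn', hprop⟩ := H.propagated e he hR
    obtain rfl : τ = τ' := Option.some.inj (hτ.symm.trans hτ')
    obtain rfl : n = n' := by omega
    exact hprop.2.1

end PropagationTimes

theorem tso_inv (hr : (memTSO Tid Loc Val).StutterRun q l) (K : CommitTimes E T P)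
    (hl : ∀ n, Emits E T n (l n)) (hprop : ∀ n, EmitsProp E P n (l n)) (n : ℕ) :
    TSOInv E T P n (q n) := by
  induction n with
  | zero => exact hr.start ▸ TSOInv.zero K
  | succ n ih =>
    have hstep := hr.step n
    rcases hln : l n with _ | ⟨τ, a⟩ | τ <;> rw [hln] at hstep
    · rw [show q (n + 1) = q n from hstep]
      have hT : ∀ e, Proper E e → T e ≠ n + 1 := fun e he hTe => by
        obtain ⟨τ, -, hτ⟩ := (hl n).eq_some K.wf he hTe
        simp [hln] at hτ
      refine ih.stay K hT fun e he hP => ?_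
      by_cases hR : e.IsR
      · exact hT e he ((K.eq e hR).symm.trans hP)
      · obtain ⟨τ, -, hτ, -⟩ := K.wf.exists_tid_sn he
        simp [(hprop n τ).2 ⟨e, he, hR, hτ, hP⟩] at hln
    · obtain ⟨e, he, hTe, hτ, rfl⟩ := (hl n τ a).1 hln
      by_cases hR : e.IsR
      · rw [((tsoStep_iff_of_isR hR).1 hstep).2.2]
        exact ih.exec K he hTe hR
      · obtain ⟨x, v, hlab⟩ := ELab.exists_eq_write hR
        rw [hlab] at hstep
        rw [show q (n + 1) = _ from hstep]
        exact ih.write K he hTe hτ hlab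
    · obtain ⟨w, hw, hR, hτ, hP⟩ := (hprop n τ).1 hln
      obtain ⟨b, x, v, hb, hinv⟩ := ih.prop K hw hP hR hτ
      obtain ⟨b', x', v', hb', hq⟩ := hstep
      obtain ⟨rfl, hxv⟩ := List.append_inj' (hb.symm.trans hb') rfl
      obtain ⟨rfl, rfl⟩ : x = x' ∧ v = v' := by simpa using hxv
      rwa [hq]

theorem tso_behMF_subset [Finite Tid] :
    BehMF (memTSO Tid Loc Val) ⊆ BehDecl (graphsTSO Tid Loc Val ∩ graphsFair Tid Loc Val) := by
  intro β hβ
  obtain ⟨q, l, hr, hfair, hb⟩ := tso_exists_bufferFair hβ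
  have hE := wellFormed_eventsOf β
  have hT := hb.schedule_stepTime
  have hl := hb.emits_stepTime
  obtain ⟨P, H⟩ := tso_exists_propagationTimes hr hfair hE hT hl
  have K := H.commitTimes hr hE hT hl
  refine K.exists_graph fun r hrE hR => ?_
  have hrp := proper_of_isR hrE hR
  obtain ⟨n, hn⟩ := Nat.exists_eq_succ_of_ne_zero (hT.pos r hrp).ne'
  obtain ⟨τ, hτ, hln⟩ := (hl n).eq_some hE hrp hn
  have hstep := hr.step n
  rw [hln] at hstep
  obtain ⟨w, hw, hv⟩ := (tso_inv hr K hl (H.emitsProp hr hl) n).exists_lastWrite τ r.loc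
  refine ⟨w, ?_, hv.trans ((tsoStep_iff_of_isR hR).1 hstep).2.1.symm⟩
  have hvis : Visible (stepTime l) P r =
      fun w => P w ≤ n ∨ (w.tid = some τ ∧ stepTime l w ≤ n) := by
    funext w
    simp only [Visible, hn, Nat.lt_succ_iff, hτ]
  rwa [hvis]

end TSORun

/-! ### Total store order: from graphs to runs -/

section ActionRanks

variable {Tid Loc Val : Type*} [Zero Val] {E : Set (Event Tid Loc Val)}
  {f I i c : Event Tid Loc Val → ℕ} {a b e : Event Tid Loc Val}

theorem exists_enumeration_of_lex {α : Type*} [Countable α] (κ : α → ℕ × ℕ)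
    (hfin : ∀ N, {x | (κ x).1 ≤ N}.Finite) :
    ∃ g : α → ℕ, Function.Injective g ∧
      ∀ x y, (κ x).1 < (κ y).1 ∨ (κ x).1 = (κ y).1 ∧ (κ x).2 < (κ y).2 → g x < g y := by
  obtain ⟨g, hg, hlt⟩ := exists_enumeration (R := fun x y => Prod.Lex (· < ·) (· < ·) (κ x) (κ y))
    (InvImage.wf κ (WellFounded.prod_lex wellFounded_lt wellFounded_lt)) fun y =>
      (hfin (κ y).1).subset fun x hx => (Prod.lex_def.1 hx).elim le_of_lt fun h => h.1.le
  exact ⟨g, hg, fun x y h => hlt x y (Prod.lex_def.2 h)⟩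

/-- The least value of the commit key `f` at `e` and at the later events of its thread: the latest
moment at which `e` can be executed so that execution follows the program order. -/
noncomputable def execKey (E : Set (Event Tid Loc Val)) (f : Event Tid Loc Val → ℕ)
    (e : Event Tid Loc Val) : ℕ :=
  sInf {n | ∃ e', Proper E e' ∧ (e' = e ∨ seqBefore e e') ∧ f e' = n}

theorem execKey_le {e' : Event Tid Loc Val} (he' : Proper E e') (h : e' = e ∨ seqBefore e e') :
    execKey E f e ≤ f e' :=
  Nat.sInf_le ⟨e', he', h, rfl⟩

theorem exists_eq_execKey (f : Event Tid Loc Val → ℕ) (he : Proper E e) :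
    ∃ e', Proper E e' ∧ (e' = e ∨ seqBefore e e') ∧ f e' = execKey E f e :=
  Nat.sInf_mem (s := {n | ∃ e', Proper E e' ∧ (e' = e ∨ seqBefore e e') ∧ f e' = n})
    ⟨f e, e, he, Or.inl rfl, rfl⟩

theorem execKey_mono (hb : Proper E b) (hab : seqBefore a b) :
    execKey E f a ≤ execKey E f b := by
  obtain ⟨e, he, hbe, hf⟩ := exists_eq_execKey f hb
  rw [← hf]
  refine execKey_le he (Or.inr ?_)
  rcases hbe with rfl | hbe
  · exact hab
  · exact hab.trans hbe

theorem execKey_eq (he : Proper E e)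
    (h : ∀ e', Proper E e' → seqBefore e e' → f e ≤ f e') : execKey E f e = f e := by
  refine le_antisymm (execKey_le he (Or.inl rfl)) ?_
  obtain ⟨e', he', hee', hf⟩ := exists_eq_execKey f he
  rw [← hf]
  rcases hee' with rfl | hee'
  · exact le_rfl
  · exact h e' he' hee'

theorem WellFormed.finite_execKey_le (hE : WellFormed E)
    (hfin : ∀ N, {e | Proper E e ∧ f e ≤ N}.Finite) (N : ℕ) :
    {e | Proper E e ∧ execKey E f e ≤ N}.Finite := by
  refine ((hfin N).biUnion (t := fun e' => {e'} ∪ {e | Proper E e ∧ seqBefore e e'})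
    fun e' _ => (Set.finite_singleton e').union (hE.finite_seqBefore e')).subset ?_
  rintro e ⟨he, hle⟩
  obtain ⟨e', he', hee', hf⟩ := exists_eq_execKey f he
  exact Set.mem_biUnion ⟨he', hf.trans_le hle⟩ (hee'.imp Eq.symm fun h => ⟨he, h⟩)

/-- Injective ranks `i` of executions and `c` of commits, ordered by the keys `I` of executions and
`f` of commits, where an execution precedes the commits with the same key. -/
structure ActionRanks (E : Set (Event Tid Loc Val)) (I f i c : Event Tid Loc Val → ℕ) : Prop where
  exec_inj : ∀ a b, Proper E a → Proper E b → i a = i b → a = b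
  exec_ne_commit : ∀ a b, Proper E a → Proper E b → i a ≠ c b
  exec_mono : ∀ a b, Proper E a → Proper E b → seqBefore a b → i a < i b
  exec_lt_commit : ∀ a b, Proper E a → Proper E b → I a ≤ f b → i a < c b
  commit_lt_exec : ∀ a b, Proper E a → Proper E b → f a < I b → c a < i b
  commit_mono : ∀ a b, Proper E a → Proper E b → f a < f b → c a < c b

theorem WellFormed.exists_actionRanks [Finite Tid] (hE : WellFormed E)
    (hI : ∀ a b, Proper E a → Proper E b → seqBefore a b → I a ≤ I b)
    (hIfin : ∀ N, {e | Proper E e ∧ I e ≤ N}.Finite)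
    (hffin : ∀ N, {e | Proper E e ∧ f e ≤ N}.Finite) : ∃ i c, ActionRanks E I f i c := by
  classical
  have := hE.countable_proper
  let κ : {e // Proper E e} × Bool → ℕ × ℕ := fun x =>
    if x.2 then (2 * f x.1 + 1, 0) else (2 * I x.1, x.1.1.sn.getD 0)
  obtain ⟨g, hg, hlt⟩ := exists_enumeration_of_lex κ fun N => by
    refine .of_injOn (f := fun x => ((x.1 : Event Tid Loc Val), x.2)) (fun x hx => ?_)
      (fun x _ y _ hxy => ?_) (((hffin N).union (hIfin N)).prod (Set.finite_univ (α := Bool)))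
    · refine ⟨?_, trivial⟩
      obtain ⟨⟨e, he⟩, _ | _⟩ := x
      · have hx : 2 * I e ≤ N := hx
        exact Or.inr ⟨he, show I e ≤ N by omega⟩
      · have hx : 2 * f e + 1 ≤ N := hx
        exact Or.inl ⟨he, show f e ≤ N by omega⟩
    · obtain ⟨hxy, hk⟩ := Prod.mk.inj hxy
      exact Prod.ext (Subtype.ext hxy) hk
  let rank : Bool → Event Tid Loc Val → ℕ := fun k e =>
    if h : Proper E e then g (⟨e, h⟩, k) else 0
  have hrank : ∀ k e (he : Proper E e), rank k e = g (⟨e, he⟩, k) := fun k e he => dif_pos he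
  refine ⟨rank false, rank true, fun a b ha hb hab => ?_, fun a b ha hb hab => ?_,
    fun a b ha hb hab => ?_, fun a b ha hb hab => ?_, fun a b ha hb hab => ?_,
    fun a b ha hb hab => ?_⟩
  all_goals simp only [hrank _ a ha, hrank _ b hb] at hab ⊢
  · exact congrArg (fun x => x.1.1) (hg hab)
  · exact Bool.false_ne_true (congrArg Prod.snd (hg hab))
  · obtain ⟨-, j, k, hj, hk, hjk⟩ := ha.seqBefore_iff.1 hab
    have := hI a b ha hb hab
    refine hlt _ _ ?_
    simp only [κ, hj, hk, Option.getD_some, Bool.false_eq_true, if_false]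
    omega
  all_goals exact hlt _ _ (Or.inl (by simp [κ]; omega))

open Classical in
/-- The rank of the commit of `e`, which is its execution unless `e` is a plain write. -/
noncomputable def commitRank (i c : Event Tid Loc Val → ℕ) (e : Event Tid Loc Val) : ℕ :=
  if e.IsR then i e else c e

theorem ActionRanks.commitRank_lt (h : ActionRanks E I f i c)
    (hI : ∀ e, Proper E e → I e ≤ f e) (hIR : ∀ e, Proper E e → e.IsR → I e = f e)
    (ha : Proper E a) (hb : Proper E b) (hab : f a < f b) :
    commitRank i c a < commitRank i c b := by
  have hIa := hI a ha
  by_cases haR : a.IsR <;> by_cases hbR : b.IsR <;>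
    simp only [commitRank, haR, hbR, if_true, if_false]
  · exact (h.exec_lt_commit a a ha ha hIa).trans
      (h.commit_lt_exec a b ha hb (hab.trans_eq (hIR b hb hbR).symm))
  · exact h.exec_lt_commit a b ha hb (hIa.trans hab.le)
  · exact h.commit_lt_exec a b ha hb (hab.trans_eq (hIR b hb hbR).symm)
  · exact h.commit_mono a b ha hb hab

theorem ActionRanks.eq_of_exec_eq_commitRank (h : ActionRanks E I f i c) (ha : Proper E a)
    (hb : Proper E b) (hab : i a = commitRank i c b) : a = b := by
  by_cases hR : b.IsR
  · exact h.exec_inj a b ha hb (by simpa only [commitRank, if_pos hR] using hab)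
  · exact absurd (by simpa only [commitRank, if_neg hR] using hab) (h.exec_ne_commit a b ha hb)

/-- A plain write is executed as late as possible: just before the first commit of itself or of a
later event of its thread. -/
theorem WellFormed.exists_commitTimes [Finite Tid] (hE : WellFormed E)
    (hf : ∀ a b, Proper E a → Proper E b → f a = f b → a = b)
    (hfR : ∀ a b, Proper E a → Proper E b → seqBefore a b → a.IsR → f a < f b)
    (hfW : ∀ a b, Proper E a → Proper E b → seqBefore a b → b.IsW → f a < f b) :
    ∃ T P, CommitTimes E T P ∧ ∀ a b, Proper E a → Proper E b → f a < f b → P a < P b := by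
  classical
  have hffin : ∀ N, {e | Proper E e ∧ f e ≤ N}.Finite := fun N =>
    .of_injOn (fun e he => he.2) (fun a ha b hb => hf a b ha.1 hb.1) (Set.finite_le_nat N)
  obtain ⟨i, c, h⟩ := hE.exists_actionRanks (fun a b _ hb => execKey_mono hb)
    (hE.finite_execKey_le hffin) hffin
  have hI : ∀ e, Proper E e → execKey E f e ≤ f e := fun e he => execKey_le he (Or.inl rfl)
  have hlt : ∀ a b, Proper E a → Proper E b → f a < f b → commitRank i c a < commitRank i c b :=
    fun a b => h.commitRank_lt hI fun e he hR =>
      execKey_eq he fun e' he' hee' => (hfR e e' he he' hee' hR).le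
  obtain ⟨T, hT, hTi⟩ := exists_schedule_of_enumeration h.exec_inj h.exec_mono
  let P : Event Tid Loc Val → ℕ := fun e =>
    if e.IsR then T e else if e ∈ Init Tid Loc Val then 0 else commitRank i c e + 1
  have hPR : ∀ e, e.IsR → P e = T e := fun e hR => if_pos hR
  have hP : ∀ e, Proper E e → P e = commitRank i c e + 1 := fun e he => by
    by_cases hR : e.IsR
    · rw [hPR e hR, hTi e he, commitRank, if_pos hR]
    · simp only [P, if_neg hR, if_neg he.2]
  have hPlt : ∀ a b, Proper E a → Proper E b → f a < f b → P a < P b := fun a b ha hb hab => by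
    rw [hP a ha, hP b hb]
    exact Nat.succ_lt_succ (hlt a b ha hb hab)
  refine ⟨T, P, ⟨hE, hT, fun e he => ?_, hPR, fun e he hR => ?_, fun a b ha hb hab => ?_,
    fun a b ha hb hab => ?_, fun a b ha hb hab hW => hPlt a b ha hb (hfW a b ha hb hab hW)⟩, hPlt⟩
  · simp only [P, if_neg (not_isR_of_mem_Init he), if_pos he]
  · rw [hP e he, hTi e he, commitRank, if_neg hR]
    exact Nat.succ_lt_succ (h.exec_lt_commit e e he he (hI e he))
  · by_contra hne
    rcases Nat.lt_or_gt_of_ne fun heq => hne (hf a b ha hb heq) with hlt | hlt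
    · exact (hPlt a b ha hb hlt).ne hab
    · exact (hPlt b a hb ha hlt).ne' hab
  · rw [hTi a ha, hP b hb] at hab
    exact h.eq_of_exec_eq_commitRank ha hb (Nat.succ_injective hab)

end ActionRanks

section TSOGraphToRun

variable {Tid Loc Val : Type*} [Zero Val] {G : EGraph Tid Loc Val} {T P : Event Tid Loc Val → ℕ}
  {n : ℕ} {τ : Tid} {e w : Event Tid Loc Val} {q : TSOState Tid Loc Val}

theorem EGraph.finite_ppo_or_rfe_or_mo_or_fr (hfair : G.Fair)
    {b : Event Tid Loc Val} (hb : Proper G.E b) :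
    {a | Proper G.E a ∧ (G.ppo a b ∨ G.rfe a b ∨ G.mo a b ∨ G.fr a b)}.Finite := by
  refine ((G.wf.finite_seqBefore b).union ((G.finite_rf b).union
    ((hfair.1 b hb.1).union (hfair.2 b hb.1)))).subset ?_
  rintro a ⟨ha, h | h | h⟩
  · exact Or.inl ⟨ha, h.1.2.2⟩
  · exact Or.inr (Or.inl h.1)
  · exact Or.inr (Or.inr h)

/-- Commit times of the events of `G` that respect the global order of the TSO model. -/
structure EGraph.GlobalTimes (G : EGraph Tid Loc Val) (T P : Event Tid Loc Val → ℕ) : Prop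
    extends CommitTimes G.E T P where
  rfe_lt : ∀ a b, G.rfe a b → P a < P b
  mo_lt : ∀ a b, G.mo a b → P a < P b
  fr_lt : ∀ a b, G.fr a b → P a < P b

theorem EGraph.ConsistentTSO.exists_globalTimes [Finite Tid] (hG : G.ConsistentTSO)
    (hfair : G.Fair) : ∃ T P, G.GlobalTimes T P := by
  have hppoR : ∀ {a b}, G.po a b → a.IsR → G.ppo a b := fun h ha =>
    ⟨h, fun hc => hc.1.2 ((ELab.isRMW_iff _).2 ⟨ha, hc.1.1⟩)⟩
  have hppoW : ∀ {a b}, G.po a b → b.IsW → G.ppo a b := fun h hb =>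
    ⟨h, fun hc => hc.2.2 ((ELab.isRMW_iff _).2 ⟨hc.2.1, hb⟩)⟩
  obtain ⟨f, hf, hlt⟩ := G.wf.exists_enumeration
    (G.wf.wellFounded_of_closureIrrefl (fun e => e.IsW) hG.1 fun a b ha hb hab h =>
      Or.inl ⟨⟨ha.1, hb.1, h⟩, fun hc => hc.2.2 ((ELab.isRMW_iff _).2 ⟨hc.2.1, hab.mp hc.1.1⟩)⟩)
    fun b => EGraph.finite_ppo_or_rfe_or_mo_or_fr hfair
  obtain ⟨T, P, K, hP⟩ := G.wf.exists_commitTimes hf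
    (fun a b ha hb hab hR => hlt a b ha hb (Or.inl (hppoR ⟨ha.1, hb.1, hab⟩ hR)))
    (fun a b ha hb hab hW => hlt a b ha hb (Or.inl (hppoW ⟨ha.1, hb.1, hab⟩ hW)))
  have hPlt : ∀ a b, a ∈ G.E → Proper G.E b → G.rfe a b ∨ G.mo a b ∨ G.fr a b → P a < P b := by
    intro a b ha hb h
    by_cases hi : a ∈ Init Tid Loc Val
    · rw [K.init a hi]
      exact K.pos hb
    · exact hP a b ⟨ha, hi⟩ hb (hlt a b ⟨ha, hi⟩ hb (Or.inr h))
  refine ⟨T, P, K, fun a b h => ?_, fun a b h => ?_, fun a b h => ?_⟩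
  · exact hPlt a b (G.rf_mem a b h.1).1
      (proper_of_isR (G.rf_mem a b h.1).2 (G.rf_match a b h.1).2.1) (Or.inl h)
  · exact hPlt a b (G.mo_mem a b h).1 (hG.2.proper_of_mo h) (Or.inr (Or.inl h))
  · obtain ⟨c, hrf, -⟩ := h.1
    exact hPlt a b (G.rf_mem c a hrf).2 (hG.2.proper_of_fr h) (Or.inr (Or.inr h))

namespace EGraph.GlobalTimes

variable (K : G.GlobalTimes T P) (hloc : G.SCPerLoc)

include K hloc

theorem isLastWrite_of_rf (he : Proper G.E e) (hT : T e = n + 1) (hτ : e.tid = some τ)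
    (hR : e.IsR) (hrf : G.rf w e) :
    IsLastWrite G.E P (fun w => P w ≤ n ∨ (w.tid = some τ ∧ T w ≤ n)) e.loc w := by
  have hPe := K.eq e hR
  refine EGraph.isLastWrite_of_rf hrf ?_ (fun a b h => (K.mo_lt a b h).le) (fun d hfr hd => ?_)
    (by omega)
  · by_cases hpo : G.po w e
    · have hTw := K.sched.mono w e hpo.1 he.1 hpo.2.2
      rcases hpo.2.2 with hinit | hseq
      · exact Or.inl ((K.init w hinit.1).trans_le n.zero_le)
      · exact Or.inr ⟨hseq.1.trans hτ, by omega⟩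
    · have := K.rfe_lt w e ⟨hrf, hpo⟩
      exact Or.inl (by omega)
  · have hdp := hloc.proper_of_fr hfr
    rcases hd with hd | ⟨hdτ, hd⟩
    · have := K.fr_lt e d hfr
      omega
    · have hde := K.seqBefore_of_exec_lt hdp.1 he (hdτ.trans hτ.symm) (by omega)
      obtain ⟨c, hc, hmo⟩ := hfr.1
      have hdloc : d.loc = e.loc := (G.mo_match c d hmo).2.2.symm.trans (G.rf_match c e hc).2.2.1
      exact hloc d (.tail (.single (Or.inl ⟨⟨hdp.1, he.1, hde⟩, hdloc⟩))
        (Or.inr (Or.inr (Or.inr hfr))))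

theorem valR_eq [DecidableEq Loc] (hq : TSOInv G.E T P n q) (he : Proper G.E e)
    (hT : T e = n + 1) (hτ : e.tid = some τ) (hR : e.IsR) :
    e.valR = some (applyBuffer q.mem (q.buf τ) e.loc) := by
  obtain ⟨w, hrf⟩ := G.rf_total e he.1 hR
  obtain ⟨w', hw', hv⟩ := hq.exists_lastWrite τ e.loc
  obtain rfl := (K.isLastWrite_of_rf hloc he hT hτ hR hrf).unique K.isMoKey hw'
  exact (G.rf_match w e hrf).2.2.2.symm.trans hv

end EGraph.GlobalTimes

variable [DecidableEq Tid] [DecidableEq Loc]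

theorem EGraph.GlobalTimes.exists_exec_step (K : G.GlobalTimes T P) (hloc : G.SCPerLoc)
    (hq : TSOInv G.E T P n q) (he : Proper G.E e) (hT : T e = n + 1) (hτ : e.tid = some τ) :
    ∃ q', tsoStep q (Sum.inl (τ, e.lab)) q' ∧ TSOInv G.E T P (n + 1) q' := by
  by_cases hR : e.IsR
  · refine ⟨_, (tsoStep_iff_of_isR hR).2 ⟨fun hRMW => ?_, K.valR_eq hloc hq he hT hτ hR, rfl⟩,
      hq.exec K.toCommitTimes he hT hR⟩
    refine (hq.buf τ).eq_nil fun w hw hwτ hTw => ?_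
    have hwe := K.seqBefore_of_exec_lt hw.1 he (hwτ.trans hτ.symm) (by omega)
    have := K.fifo w e hw he hwe ((ELab.isRMW_iff _).1 hRMW).2
    rw [K.eq e hR] at this
    omega
  · obtain ⟨x, v, hlab⟩ := ELab.exists_eq_write hR
    exact ⟨_, by rw [hlab]; rfl, hq.write K.toCommitTimes he hT hτ hlab⟩

theorem EGraph.GlobalTimes.exists_step (K : G.GlobalTimes T P) (hloc : G.SCPerLoc)
    (hq : TSOInv G.E T P n q) :
    ∃ o q', (Emits G.E T n o ∧ EmitsProp G.E P n o) ∧ (memTSO Tid Loc Val).StepOpt q o q' ∧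
      TSOInv G.E T P (n + 1) q' := by
  by_cases hex : ∃ e, Proper G.E e ∧ T e = n + 1
  · obtain ⟨e, he, hT⟩ := hex
    obtain ⟨τ, -, hτ, -⟩ := G.wf.exists_tid_sn he
    obtain ⟨q', hstep, hq'⟩ := K.exists_exec_step hloc hq he hT hτ
    refine ⟨some (Sum.inl (τ, e.lab)), q', ⟨.of_event K.sched he hT hτ, fun τ' => ?_⟩, hstep, hq'⟩
    refine iff_of_false (by simp) fun ⟨w, hw, hR, _, hP⟩ => ?_
    obtain rfl := K.eq_of_commit_eq_exec he hw.1 (hP.trans hT.symm)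
    exact (K.lt w he hR).ne (hT.trans hP.symm)
  have hT : ∀ e, Proper G.E e → T e ≠ n + 1 := fun e he hT => hex ⟨e, he, hT⟩
  by_cases hexP : ∃ w, Proper G.E w ∧ P w = n + 1
  · obtain ⟨w, hw, hP⟩ := hexP
    have hR : ¬ w.IsR := fun hR => hT w hw ((K.eq w hR).symm.trans hP)
    obtain ⟨τ, -, hτ, -⟩ := G.wf.exists_tid_sn hw
    obtain ⟨b, x, v, hb, hq'⟩ := hq.prop K.toCommitTimes hw hP hR hτ
    refine ⟨some (Sum.inr τ), _, ⟨.of_no_event (by simp) hT, fun τ' => ⟨?_, ?_⟩⟩,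
      ⟨b, x, v, hb, rfl⟩, hq'⟩
    · rintro ⟨⟩
      exact ⟨w, hw, hR, hτ, hP⟩
    · rintro ⟨w', hw', -, hτ', hP'⟩
      obtain rfl := K.inj w w' hw hw' (hP.trans hP'.symm)
      rw [Option.some.inj (hτ.symm.trans hτ')]
  · exact ⟨none, q, ⟨.of_no_event (by simp) hT, fun τ => iff_of_false (by simp)
      fun ⟨w, hw, _, _, hP⟩ => hexP ⟨w, hw, hP⟩⟩, rfl,
      hq.stay K.toCommitTimes hT fun w hw hP => hexP ⟨w, hw, hP⟩⟩

theorem tso_behDecl_subset [Finite Tid] :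
    BehDecl (graphsTSO Tid Loc Val ∩ graphsFair Tid Loc Val) ⊆ BehMF (memTSO Tid Loc Val) := by
  rintro β ⟨G, ⟨hG, hfair⟩, hβ⟩
  obtain ⟨T, P, K⟩ := EGraph.ConsistentTSO.exists_globalTimes hG hfair
  obtain ⟨q, l, hrun, hinv, hl⟩ := (memTSO Tid Loc Val).exists_stutterRun (TSOInv G.E T P)
    (fun n _ o _ => Emits G.E T n o ∧ EmitsProp G.E P n o) (TSOInv.zero K.toCommitTimes)
    fun n q hq => K.exists_step hG.2 hq
  refine mem_BehMF_iff.2 ⟨q, l, hrun, Or.inr fun τ k hk => ?_, ?_⟩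
  · obtain ⟨w, hw, hτ, hTw, hPw⟩ : ∃ w, Proper G.E w ∧ w.tid = some τ ∧ T w ≤ k ∧ k < P w := by
      by_contra! hflushed
      exact tso_enabled_prop.1 (hk k le_rfl) (((hinv k).buf τ).eq_nil hflushed)
    have hR : ¬ w.IsR := fun hR => by
      rw [K.eq w hR] at hPw
      omega
    exact ⟨P w - 1, by omega, ((hl (P w - 1)).2 τ).2 ⟨w, hw, hR, hτ, by omega⟩⟩
  · have hT := K.sched
    rw [← hβ] at hT hl
    exact hT.isBehavior fun n => (hl n).1

end TSOGraphToRun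

/-! ### View-based systems: from runs to graphs -/

section ViewSystem

variable {Tid Loc Val : Type*}

/-- Reading a message whose view records its own timestamp increases the view of the thread, and
sets its entry for the location of the message to the timestamp of the message. -/
def Advances (upd : View Loc → Msg Loc Val → View Loc) : Prop :=
  ∀ V m, V m.loc ≤ m.ts → m.view m.loc = m.ts → upd V m m.loc = m.ts ∧ V ≤ upd V m

theorem advances_join : Advances fun (V : View Loc) (m : Msg Loc Val) => V ⊔ m.view :=
  fun _ _ hle hview => ⟨by simp [hview, hle], le_sup_left⟩

variable [DecidableEq Loc]

theorem advances_update :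
    Advances fun (V : View Loc) (m : Msg Loc Val) => Function.update V m.loc m.ts :=
  fun _ _ hle _ => ⟨by simp, le_update_self_iff.2 hle⟩

variable [DecidableEq Tid]

/-- The view-based memory system in which `upd` describes the effect of reading a message. -/
def memView [Zero Val] (upd : View Loc → Msg Loc Val → View Loc) :
    LTS (VState Tid Loc Val) (Tid × ELab Loc Val) (Tid × Msg Loc Val) where
  init := viewInit
  step := viewStep upd

/-- The effect of an observable step of a view-based system, as far as it determines the execution
graph of a run. -/
structure ViewEffect (upd : View Loc → Msg Loc Val → View Loc) (τ : Tid) (a : ELab Loc Val)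
    (q q' : VState Tid Loc Val) : Prop where
  other : ∀ τ', τ' ≠ τ → q'.tview τ' = q.tview τ'
  mono : q.tview τ ≤ q'.tview τ
  mem_read : ¬ a.IsW → q'.mem = q.mem
  mem_write : ∀ v, a.valW = some v →
    q'.mem = q.mem ∪ {⟨a.loc, v, q'.tview τ a.loc, q'.tview τ⟩} ∧
      ¬ ∃ m ∈ q.mem, m.loc = a.loc ∧ m.ts = q'.tview τ a.loc
  read : a.IsR → ∃ m ∈ q.mem, m.loc = a.loc ∧ some m.val = a.valR ∧ q.tview τ a.loc ≤ m.ts ∧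
    upd (q.tview τ) m ≤ q'.tview τ ∧ (¬ a.IsW → q'.tview τ a.loc = m.ts) ∧
    (a.IsW → q'.tview τ a.loc = m.ts + 1)

variable {upd : View Loc → Msg Loc Val → View Loc} {τ : Tid} {x : Loc} {v vR vW : Val}
  {a : ELab Loc Val} {q q₁ q' : VState Tid Loc Val}

theorem viewWrite.tview_eq {t : ℕ}
    (h : q'.tview = Function.update q.tview τ (Function.update (q.tview τ) x t)) :
    (∀ τ', τ' ≠ τ → q'.tview τ' = q.tview τ') ∧
      q'.tview τ = Function.update (q.tview τ) x t ∧ q'.tview τ x = t := by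
  rw [h]
  exact ⟨fun τ' hτ' => Function.update_of_ne hτ' _ _, by simp, by simp⟩

theorem viewWrite.effect (h : viewWrite τ x v q q') :
    ViewEffect upd τ (.write x v) q q' := by
  obtain ⟨t, hfresh, hlt, htv, hmem⟩ := h
  obtain ⟨hother, hview, hts⟩ := viewWrite.tview_eq htv
  refine ⟨hother, hview ▸ le_update_self_iff.2 hlt.le, fun hW => absurd trivial hW, ?_, False.elim⟩
  rintro _ ⟨⟩
  rw [ELab.loc, hts]
  exact ⟨hmem, hfresh⟩

omit [DecidableEq Loc] in
theorem viewRead.effect (hupd : Advances upd) (hq : ∀ m ∈ q.mem, m.view m.loc = m.ts)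
    (h : viewRead upd τ x v q q') : ViewEffect upd τ (.read x v) q q' := by
  obtain ⟨m, hm, rfl, rfl, hle, rfl⟩ := h
  obtain ⟨hts, hmono⟩ := hupd (q.tview τ) m hle (hq m hm)
  exact ⟨fun τ' hτ' => Function.update_of_ne hτ' _ _, by simpa using hmono, fun _ => rfl, nofun,
    fun _ => ⟨m, hm, rfl, rfl, hle, by simp, fun _ => by simpa [ELab.loc] using hts, False.elim⟩⟩

theorem viewWrite.effect_rmw (hupd : Advances upd) (hq : ∀ m ∈ q.mem, m.view m.loc = m.ts)
    (hread : viewRead upd τ x vR q q₁) (hwrite : viewWrite τ x vW q₁ q')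
    (hinc : q'.tview τ x = q₁.tview τ x + 1) : ViewEffect upd τ (.rmw x vR vW) q q' := by
  have hw := hwrite.effect (upd := upd)
  have hr := hread.effect hupd hq
  obtain ⟨m, hm, hloc, hval, hle, hupd_le, hts, -⟩ := hr.read trivial
  have hmem : q₁.mem = q.mem := hr.mem_read id
  refine ⟨fun τ' hτ' => (hw.other τ' hτ').trans (hr.other τ' hτ'), hr.mono.trans hw.mono,
    fun hW => absurd trivial hW, fun v hv => hmem ▸ hw.mem_write v hv, fun _ => ?_⟩
  exact ⟨m, hm, hloc, hval, hle, hupd_le.trans hw.mono, fun hW => absurd trivial hW,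
    fun _ => hinc.trans (congrArg (· + 1) (hts id))⟩

theorem viewStep_effect (hupd : Advances upd) (hq : ∀ m ∈ q.mem, m.view m.loc = m.ts)
    (h : viewStep upd q (Sum.inl (τ, a)) q') : ViewEffect upd τ a q q' := by
  cases a with
  | read x v => exact viewRead.effect hupd hq h
  | write x v => exact viewWrite.effect h
  | rmw x vR vW =>
    obtain ⟨q₁, hread, hwrite, hinc⟩ := h
    exact viewWrite.effect_rmw hupd hq hread hwrite hinc

end ViewSystem

section ViewRun

variable {Tid Loc Val : Type*} {q : ℕ → VState Tid Loc Val} {T : Event Tid Loc Val → ℕ}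
  {a b e r w : Event Tid Loc Val} {m : Msg Loc Val} {τ : Tid} {n : ℕ}

/-- The view of the thread of `e` after the execution of `e`. -/
def eventView (q : ℕ → VState Tid Loc Val) (T : Event Tid Loc Val → ℕ) (e : Event Tid Loc Val) :
    View Loc :=
  match e.tid with
  | none => fun _ => 0
  | some τ => (q (T e)).tview τ

/-- The timestamp of `e`. -/
def eventTs (q : ℕ → VState Tid Loc Val) (T : Event Tid Loc Val → ℕ) (e : Event Tid Loc Val) : ℕ :=
  eventView q T e e.loc

/-- `m` is the message of the write `w`. -/
def IsMsgOf (q : ℕ → VState Tid Loc Val) (T : Event Tid Loc Val → ℕ) (w : Event Tid Loc Val)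
    (m : Msg Loc Val) : Prop :=
  ∃ v, w.valW = some v ∧ m = ⟨w.loc, v, eventTs q T w, eventView q T w⟩

/-- The memory after `n` steps consists of the messages of the writes of `E` executed so far. -/
def MsgInv (E : Set (Event Tid Loc Val)) (T : Event Tid Loc Val → ℕ)
    (q : ℕ → VState Tid Loc Val) (n : ℕ) : Prop :=
  ∀ m, m ∈ (q n).mem ↔ ∃ w ∈ E, T w ≤ n ∧ IsMsgOf q T w m

theorem eventView_of_tid (h : e.tid = some τ) : eventView q T e = (q (T e)).tview τ := by
  simp [eventView, h]

theorem IsMsgOf.view_loc (h : IsMsgOf q T w m) : m.view m.loc = m.ts := by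
  obtain ⟨v, -, rfl⟩ := h
  rfl

/-- The views and timestamps in a run in which `r` reads the message of `w`. -/
structure ReadsFrom (upd : View Loc → Msg Loc Val → View Loc) (q : ℕ → VState Tid Loc Val)
    (T : Event Tid Loc Val → ℕ) (w r : Event Tid Loc Val) : Prop where
  lt : T w < T r
  tview_le : ∀ n τ, r.tid = some τ → T r = n + 1 → (q n).tview τ r.loc ≤ eventTs q T w
  ts_eq : ¬ r.IsW → eventTs q T r = eventTs q T w
  ts_eq_succ : r.IsW → eventTs q T r = eventTs q T w + 1
  view_le : (∀ V m, m.view ≤ upd V m) → eventView q T w ≤ eventView q T r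

theorem ReadsFrom.eventTs_le {upd : View Loc → Msg Loc Val → View Loc}
    (h : ReadsFrom upd q T w r) : eventTs q T w ≤ eventTs q T r := by
  by_cases hW : r.IsW
  · exact (h.ts_eq_succ hW).symm ▸ Nat.le_succ _
  · exact (h.ts_eq hW).ge

variable {E : Set (Event Tid Loc Val)}

theorem MsgInv.view_loc (h : MsgInv E T q n) : ∀ m ∈ (q n).mem, m.view m.loc = m.ts := fun m hm =>
  let ⟨_, _, _, hmsg⟩ := (h m).1 hm
  hmsg.view_loc

theorem MsgInv.stay (h : MsgInv E T q n) (hmem : (q (n + 1)).mem = (q n).mem)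
    (hn : ∀ w ∈ E, w.IsW → T w ≠ n + 1) : MsgInv E T q (n + 1) := by
  intro m
  rw [hmem, h]
  refine exists_congr fun w => and_congr_right fun hw => and_congr_left fun ⟨v, hv, _⟩ => ?_
  have := hn w hw ((ELab.isW_iff _).2 ⟨v, hv⟩)
  omega

theorem MsgInv.write (h : MsgInv E T q n) (he : e ∈ E) (hT : T e = n + 1) {v : Val}
    (hv : e.valW = some v)
    (hmem : (q (n + 1)).mem = (q n).mem ∪ {⟨e.loc, v, eventTs q T e, eventView q T e⟩})
    (hn : ∀ w ∈ E, T w = n + 1 → w = e) : MsgInv E T q (n + 1) := by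
  intro m
  rw [hmem, Set.mem_union, Set.mem_singleton_iff, h]
  constructor
  · rintro (⟨w, hw, hTw, hm⟩ | rfl)
    · exact ⟨w, hw, by omega, hm⟩
    · exact ⟨e, he, hT.le, v, hv, rfl⟩
  · rintro ⟨w, hw, hTw, hm⟩
    rcases hTw.lt_or_eq with hlt | heq
    · exact Or.inl ⟨w, hw, by omega, hm⟩
    · obtain rfl := hn w hw heq
      obtain ⟨v', hv', rfl⟩ := hm
      rw [Option.some.inj (hv'.symm.trans hv)]
      exact Or.inr rfl

variable [Zero Val]

theorem eventView_of_init (h : e ∈ Init Tid Loc Val) : eventView q T e = fun _ => 0 := by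
  simp [eventView, tid_of_mem_Init h]

theorem MsgInv.zero (hE : WellFormed E) (hT : Schedule E T) (hq : q 0 = viewInit) :
    MsgInv E T q 0 := by
  intro m
  rw [hq]
  constructor
  · rintro ⟨x, rfl⟩
    have hi : (⟨none, none, .write x 0⟩ : Event Tid Loc Val) ∈ Init Tid Loc Val := ⟨x, rfl⟩
    exact ⟨_, hE.init_subset hi, (hT.init _ hi).le, 0, rfl,
      by rw [eventTs, eventView_of_init hi]; rfl⟩
  · rintro ⟨w, hw, hTw, v, hv, rfl⟩
    have hi : w ∈ Init Tid Loc Val := by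
      by_contra hi
      exact (hT.pos w ⟨hw, hi⟩).not_ge hTw
    rw [valW_of_mem_Init hi] at hv
    exact ⟨w.loc, by rw [eventTs, eventView_of_init hi, ← Option.some.inj hv]⟩

variable [DecidableEq Tid] [DecidableEq Loc]
  {upd : View Loc → Msg Loc Val → View Loc}
  {l : ℕ → Option ((Tid × ELab Loc Val) ⊕ (Tid × Msg Loc Val))}

/-- A run of a view-based system that executes the events of `E` in the order of the schedule
`T`. -/
structure ViewRun (upd : View Loc → Msg Loc Val → View Loc) (E : Set (Event Tid Loc Val))
    (T : Event Tid Loc Val → ℕ) (q : ℕ → VState Tid Loc Val)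
    (l : ℕ → Option ((Tid × ELab Loc Val) ⊕ (Tid × Msg Loc Val))) : Prop where
  advances : Advances upd
  run : (memView upd).StutterRun q l
  wf : WellFormed E
  sched : Schedule E T
  emits : ∀ n, Emits E T n (l n)

namespace ViewRun

theorem step_of_event (h : ViewRun upd E T q l) (he : Proper E e) (hT : T e = n + 1)
    (hτ : e.tid = some τ) : viewStep upd (q n) (Sum.inl (τ, e.lab)) (q (n + 1)) := by
  have hstep := h.run.step n
  rw [(h.emits n τ e.lab).2 ⟨e, he, hT, hτ, rfl⟩] at hstep
  exact hstep

theorem step_of_no_event (h : ViewRun upd E T q l) (hn : ∀ e, Proper E e → T e ≠ n + 1) :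
    (q (n + 1)).mem = (q n).mem ∧ (q n).tview ≤ (q (n + 1)).tview := by
  have hstep := h.run.step n
  rcases hln : l n with _ | ⟨τ, a⟩ | ⟨τ, m⟩ <;> rw [hln] at hstep
  · rw [show q (n + 1) = q n from hstep]
    exact ⟨rfl, le_rfl⟩
  · obtain ⟨e, he, hT, -⟩ := (h.emits n τ a).1 hln
    exact absurd hT (hn e he)
  · obtain ⟨-, hlt, hq⟩ := hstep
    rw [hq]
    exact ⟨rfl, le_update_self_iff.2 (le_update_self_iff.2 hlt.le)⟩

theorem msgInv (h : ViewRun upd E T q l) (n : ℕ) : MsgInv E T q n := by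
  induction n with
  | zero => exact MsgInv.zero h.wf h.sched h.run.start
  | succ n ih =>
    by_cases hex : ∃ e, Proper E e ∧ T e = n + 1
    · obtain ⟨e, he, hTe⟩ := hex
      obtain ⟨τ, -, hτ, -⟩ := h.wf.exists_tid_sn he
      have hunique : ∀ w ∈ E, T w = n + 1 → w = e := fun w hw hTw =>
        h.sched.eq_of_mem he hw (hTw.trans hTe.symm)
      have heff := viewStep_effect h.advances ih.view_loc (h.step_of_event he hTe hτ)
      by_cases hW : e.IsW
      · obtain ⟨v, hv⟩ := (ELab.isW_iff _).1 hW
        refine ih.write he.1 hTe hv ?_ hunique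
        rw [eventTs, eventView_of_tid hτ, hTe]
        exact (heff.mem_write v hv).1
      · exact ih.stay (heff.mem_read hW) fun w hw hwW hTw => hW (hunique w hw hTw ▸ hwW)
    · have hn : ∀ e, Proper E e → T e ≠ n + 1 := fun e he hT => hex ⟨e, he, hT⟩
      exact ih.stay (h.step_of_no_event hn).1 fun w hw _ hTw =>
        hn w (h.sched.proper_of_pos hw (by omega)) hTw

theorem effect (h : ViewRun upd E T q l) (he : Proper E e) (hT : T e = n + 1)
    (hτ : e.tid = some τ) : ViewEffect upd τ e.lab (q n) (q (n + 1)) :=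
  viewStep_effect h.advances (h.msgInv n).view_loc (h.step_of_event he hT hτ)

theorem exists_effect (h : ViewRun upd E T q l) (he : Proper E e) :
    ∃ n τ, T e = n + 1 ∧ e.tid = some τ ∧ ViewEffect upd τ e.lab (q n) (q (n + 1)) := by
  obtain ⟨n, hn⟩ := Nat.exists_eq_succ_of_ne_zero (h.sched.pos e he).ne'
  obtain ⟨τ, -, hτ, -⟩ := h.wf.exists_tid_sn he
  exact ⟨n, τ, hn, hτ, h.effect he hn hτ⟩

theorem monotone_tview (h : ViewRun upd E T q l) (τ : Tid) : Monotone fun n => (q n).tview τ := by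
  refine monotone_nat_of_le_succ fun n => ?_
  by_cases hex : ∃ e, Proper E e ∧ T e = n + 1
  · obtain ⟨e, he, hTe⟩ := hex
    obtain ⟨τ', -, hτ', -⟩ := h.wf.exists_tid_sn he
    have heff := h.effect he hTe hτ'
    by_cases hτ : τ = τ'
    · exact hτ ▸ heff.mono
    · exact (heff.other τ hτ).ge
  · exact (h.step_of_no_event fun e he hT => hex ⟨e, he, hT⟩).2 τ

theorem eventView_le_of_seqBefore (h : ViewRun upd E T q l) (ha : a ∈ E) (hb : b ∈ E)
    (hab : seqBefore a b) : eventView q T a ≤ eventView q T b := by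
  by_cases hi : a ∈ Init Tid Loc Val
  · rw [eventView_of_init hi]
    exact fun _ => Nat.zero_le _
  · have hap : Proper E a := ⟨ha, hi⟩
    obtain ⟨τ, -, hτ, -⟩ := h.wf.exists_tid_sn hap
    rw [eventView_of_tid hτ, eventView_of_tid ((hap.seqBefore_iff.1 hab).1.symm.trans hτ)]
    exact h.monotone_tview τ (h.sched.mono a b ha hb hab).le

theorem eventTs_ne_of_lt (h : ViewRun upd E T q l) (ha : a ∈ E) (hb : b ∈ E) (haW : a.IsW)
    (hbW : b.IsW) (hloc : a.loc = b.loc) (hlt : T a < T b) : eventTs q T a ≠ eventTs q T b := by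
  intro hts
  obtain ⟨n, τ, hn, hτ, heff⟩ := h.exists_effect (h.sched.proper_of_pos hb (by omega))
  obtain ⟨v, hv⟩ := (ELab.isW_iff _).1 hbW
  obtain ⟨v', hv'⟩ := (ELab.isW_iff _).1 haW
  refine (heff.mem_write v hv).2
    ⟨_, (h.msgInv n _).2 ⟨a, ha, by omega, v', hv', rfl⟩, hloc, hts.trans ?_⟩
  rw [eventTs, eventView_of_tid hτ, hn]

theorem isMoKey (h : ViewRun upd E T q l) : IsMoKey E (eventTs q T) := by
  intro a b ha hb haW hbW hloc hts
  refine h.sched.inj_loc ha hb hloc (le_antisymm (not_lt.1 fun hlt => ?_) (not_lt.1 fun hlt => ?_))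
  · exact h.eventTs_ne_of_lt hb ha hbW haW hloc.symm hlt hts.symm
  · exact h.eventTs_ne_of_lt ha hb haW hbW hloc hlt hts

theorem exists_readsFrom (h : ViewRun upd E T q l) (hr : r ∈ E) (hR : r.IsR) :
    ∃ w, (w ∈ E ∧ w.IsW ∧ w.loc = r.loc ∧ w.valW = r.valR) ∧ ReadsFrom upd q T w r := by
  obtain ⟨n, τ, hn, hτ, heff⟩ := h.exists_effect (proper_of_isR hr hR)
  obtain ⟨m, hm, hloc, hval, hle, hupd_le, hts, hts'⟩ := heff.read hR
  obtain ⟨w, hw, hTw, v, hv, rfl⟩ := (h.msgInv n m).1 hm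
  have hview : eventView q T r = (q (n + 1)).tview τ := by rw [eventView_of_tid hτ, hn]
  refine ⟨w, ⟨hw, (ELab.isW_iff _).2 ⟨v, hv⟩, hloc, hv.trans hval⟩, by omega,
    fun n' τ' hτ' hn' => ?_, fun hW => ?_, fun hW => ?_, fun hjoin => ?_⟩
  · obtain rfl : n' = n := by omega
    obtain rfl : τ = τ' := Option.some.inj (hτ.symm.trans hτ')
    exact hle
  · rw [eventTs, hview]
    exact hts hW
  · rw [eventTs, hview]
    exact hts' hW
  · exact hview ▸ (hjoin _ _).trans hupd_le

/-- Since messages are never removed, a thread that propagates fairly does not stay behind a write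
forever. -/
theorem exists_eventTs_le (h : ViewRun upd E T q l)
    (hfair : ∀ (θ : Tid × Msg Loc Val) (k : ℕ),
      (∀ j, k ≤ j → (memView upd).Enabled (q j) (Sum.inr θ)) →
        ∃ j, k ≤ j ∧ l j = some (Sum.inr θ))
    (hb : b ∈ E) (hbW : b.IsW) (τ : Tid) :
    ∃ N, ∀ n, N ≤ n → eventTs q T b ≤ (q n).tview τ b.loc := by
  by_contra! hbehind
  have hlt : ∀ n, (q n).tview τ b.loc < eventTs q T b := fun n =>
    let ⟨_, hn', hlt⟩ := hbehind n
    (h.monotone_tview τ hn' b.loc).trans_lt hlt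
  obtain ⟨v, hv⟩ := (ELab.isW_iff _).1 hbW
  obtain ⟨j, -, hlj⟩ := hfair (τ, ⟨b.loc, v, eventTs q T b, eventView q T b⟩) (T b) fun j hj =>
    ⟨_, (h.msgInv j _).2 ⟨b, hb, hj, v, hv, rfl⟩, hlt j, rfl⟩
  have hstep := h.run.step j
  rw [hlj] at hstep
  have hlt' := hlt (j + 1)
  simp [hstep.2.2] at hlt'

variable {src : Event Tid Loc Val → Event Tid Loc Val}

theorem exists_source (h : ViewRun upd E T q l) :
    ∃ src, IsRfSource E src ∧ ∀ r ∈ E, r.IsR → ReadsFrom upd q T (src r) r := by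
  choose! src hsrc hread using fun r hr hR => h.exists_readsFrom (r := r) hr hR
  exact ⟨src, hsrc, hread⟩

theorem eventTs_lt_of_fr (h : ViewRun upd E T q l) (hsrc : IsRfSource E src)
    (hread : ∀ r ∈ E, r.IsR → ReadsFrom upd q T (src r) r)
    (hfr : (keyGraph h.wf h.isMoKey hsrc).fr a b) : eventTs q T a < eventTs q T b := by
  obtain ⟨ha, hR, hb, hbW, hloc, hlt, hne⟩ := keyGraph_fr h.wf h.isMoKey hsrc hfr
  by_cases haW : a.IsW
  · exact lt_of_le_of_ne ((hread a ha hR).ts_eq_succ haW ▸ hlt) fun hts =>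
      hne (h.isMoKey a b ha hb haW hbW hloc hts)
  · exact (hread a ha hR).ts_eq haW ▸ hlt

theorem finite_fr [Finite Tid] (h : ViewRun upd E T q l) (hf : (memView upd).StutterFair q l)
    (hsrc : IsRfSource E src) (hread : ∀ r ∈ E, r.IsR → ReadsFrom upd q T (src r) r)
    (b : Event Tid Loc Val) : {a | (keyGraph h.wf h.isMoKey hsrc).fr a b}.Finite := by
  have hfr := fun {a} => keyGraph_fr (a := a) (b := b) h.wf h.isMoKey hsrc
  rcases hf with ⟨N, hN⟩ | hf
  · refine (h.sched.finite_le N).subset fun a ha => ?_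
    have hap := proper_of_isR (hfr ha).1 (hfr ha).2.1
    refine ⟨hap, not_lt.1 fun hlt => ?_⟩
    obtain ⟨n, hn⟩ := Nat.exists_eq_succ_of_ne_zero (h.sched.pos a hap).ne'
    obtain ⟨τ, -, hln⟩ := (h.emits n).eq_some h.wf hap hn
    simp [hN n (by omega)] at hln
  · by_cases hb : b ∈ E ∧ b.IsW
    · choose N hN using h.exists_eventTs_le hf hb.1 hb.2
      refine (Set.finite_iUnion fun τ => h.sched.finite_le (N τ)).subset fun a ha => ?_
      obtain ⟨haE, hR, -, -, hloc, hlt, -⟩ := hfr ha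
      obtain ⟨n, τ, hn, hτ, -⟩ := h.exists_effect (proper_of_isR haE hR)
      refine Set.mem_iUnion.2 ⟨τ, proper_of_isR haE hR, not_lt.1 fun hNa => ?_⟩
      have hle := (hread a haE hR).tview_le n τ hτ hn
      exact hlt.not_ge ((hN τ n (by omega)).trans (hloc ▸ hle))
    · exact Set.finite_empty.subset fun a ha => hb ⟨(hfr ha).2.2.1, (hfr ha).2.2.2.1⟩

theorem po_le (h : ViewRun upd E T q l) (hsrc : IsRfSource E src)
    (hpo : (keyGraph h.wf h.isMoKey hsrc).po a b) :
    eventView q T a ≤ eventView q T b ∧ T a < T b :=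
  let ⟨ha, hb, hab⟩ := hpo
  ⟨h.eventView_le_of_seqBefore ha hb hab, h.sched.mono a b ha hb hab⟩

theorem closureIrrefl (h : ViewRun upd E T q l) (hsrc : IsRfSource E src)
    (hread : ∀ r ∈ E, r.IsR → ReadsFrom upd q T (src r) r)
    {H : Event Tid Loc Val → Event Tid Loc Val → Prop}
    (hH : ∀ a b, H a b → eventView q T a ≤ eventView q T b ∧ T a < T b) :
    ClosureIrrefl fun a b => (H a b ∧ a.loc = b.loc) ∨ (keyGraph h.wf h.isMoKey hsrc).rf a b ∨
      (keyGraph h.wf h.isMoKey hsrc).mo a b ∨ (keyGraph h.wf h.isMoKey hsrc).fr a b := by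
  refine closureIrrefl_of_lex (eventTs q T) T fun a b hab => ?_
  rcases hab with ⟨hab, hloc⟩ | ⟨hb, hR, rfl⟩ | ⟨-, -, -, -, -, hlt⟩ | hfr
  · refine Or.inr ⟨?_, (hH a b hab).2⟩
    rw [eventTs, eventTs, ← hloc]
    exact (hH a b hab).1 _
  · exact Or.inr ⟨(hread b hb hR).eventTs_le, (hread b hb hR).lt⟩
  · exact Or.inl hlt
  · exact Or.inl (h.eventTs_lt_of_fr hsrc hread hfr)

end ViewRun

variable [Finite Tid]

theorem ra_behMF_subset :
    BehMF (memRA Tid Loc Val) ⊆ BehDecl (graphsRA Tid Loc Val ∩ graphsFair Tid Loc Val) := by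
  intro β hβ
  obtain ⟨q, l, hr, hf, hb⟩ := mem_BehMF_iff.1 hβ
  have h : ViewRun _ (eventsOf β) (stepTime l) q l :=
    ⟨advances_join, hr, wellFormed_eventsOf β, hb.schedule_stepTime, hb.emits_stepTime⟩
  obtain ⟨src, hsrc, hread⟩ := h.exists_source
  let G := keyGraph h.wf h.isMoKey hsrc
  have hstep : ∀ a b, (G.po a b ∨ G.rf a b) →
      eventView q (stepTime l) a ≤ eventView q (stepTime l) b ∧ stepTime l a < stepTime l b := by
    rintro a b (hpo | ⟨hb, hR, rfl⟩)
    · exact h.po_le hsrc hpo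
    · exact ⟨(hread b hb hR).view_le fun _ _ => le_sup_right, (hread b hb hR).lt⟩
  refine ⟨G, ⟨h.closureIrrefl hsrc hread fun a b hab => ?_, keyGraph_mo_finite _ _ _,
    fun b _ => h.finite_fr hf hsrc hread b⟩, rfl⟩
  induction hab with
  | single hab => exact hstep _ _ hab
  | tail _ hab ih => exact ⟨ih.1.trans (hstep _ _ hab).1, ih.2.trans (hstep _ _ hab).2⟩

theorem strongCOH_behMF_subset :
    BehMF (memStrongCOH Tid Loc Val) ⊆
      BehDecl (graphsStrongCOH Tid Loc Val ∩ graphsFair Tid Loc Val) := by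
  intro β hβ
  obtain ⟨q, l, hr, hf, hb⟩ := mem_BehMF_iff.1 hβ
  have h : ViewRun _ (eventsOf β) (stepTime l) q l :=
    ⟨advances_update, hr, wellFormed_eventsOf β, hb.schedule_stepTime, hb.emits_stepTime⟩
  obtain ⟨src, hsrc, hread⟩ := h.exists_source
  refine ⟨keyGraph h.wf h.isMoKey hsrc, ⟨⟨closureIrrefl_of_strictMono (stepTime l) ?_,
    h.closureIrrefl hsrc hread fun a b => h.po_le hsrc⟩, keyGraph_mo_finite _ _ _,
    fun b _ => h.finite_fr hf hsrc hread b⟩, rfl⟩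
  rintro a b (hpo | ⟨hb, hR, rfl⟩)
  · exact (h.po_le hsrc hpo).2
  · exact (hread b hb hR).lt

end ViewRun

/-! ### View-based systems: from graphs to runs -/

section Timestamps

variable {Tid Loc Val : Type*} [Zero Val]

/-- The timestamp of a write: its position in the modification order. -/
noncomputable def EGraph.ts (G : EGraph Tid Loc Val) (w : Event Tid Loc Val) : ℕ :=
  {a | G.mo a w}.ncard

/-- A thread that has observed the timestamp `t` for the location of the event `a` may still
execute `a`: neither the message read by `a` nor the one written by `a` is too old. -/
def EGraph.Allows (G : EGraph Tid Loc Val) (t : ℕ) (a : Event Tid Loc Val) : Prop :=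
  (∀ d, G.rf d a → t ≤ G.ts d) ∧ (a.IsW → t < G.ts a)

variable {G : EGraph Tid Loc Val} {a b d w : Event Tid Loc Val} {t t' : ℕ}

namespace EGraph

theorem ts_lt (hf : PrefixFinite G.E G.mo) (h : G.mo a b) : G.ts a < G.ts b := by
  refine Set.ncard_lt_ncard ?_ (hf b (G.mo_mem a b h).2)
  exact (Set.ssubset_iff_of_subset (s := {c | G.mo c a}) (t := {c | G.mo c b})
    fun c hc => G.mo_trans c a b hc h).2 ⟨a, h, G.mo_irrefl a⟩

theorem ts_inj (hf : PrefixFinite G.E G.mo) (ha : a ∈ G.E) (hb : b ∈ G.E) (haW : a.IsW)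
    (hbW : b.IsW) (hloc : a.loc = b.loc) (h : G.ts a = G.ts b) : a = b := by
  by_contra hne
  rcases G.mo_total a ha b hb haW hbW hloc hne with hmo | hmo
  · exact (ts_lt hf hmo).ne h
  · exact (ts_lt hf hmo).ne' h

theorem ts_le_of_not_mo (hf : PrefixFinite G.E G.mo) (ha : a ∈ G.E) (hb : b ∈ G.E) (haW : a.IsW)
    (hbW : b.IsW) (hloc : a.loc = b.loc) (h : ¬ G.mo b a) : G.ts a ≤ G.ts b := by
  by_cases hne : a = b
  · rw [hne]
  · exact (ts_lt hf ((G.mo_total a ha b hb haW hbW hloc hne).resolve_right h)).le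

theorem ts_init (hs : G.SCPerLoc) (ha : a ∈ Init Tid Loc Val) : G.ts a = 0 := by
  have hempty : {b | G.mo b a} = ∅ :=
    Set.eq_empty_iff_forall_notMem.2 fun _ hmo => (hs.proper_of_mo hmo).2 ha
  rw [ts, hempty, Set.ncard_empty]

theorem ts_pos (hf : PrefixFinite G.E G.mo) (hs : G.SCPerLoc) (ha : Proper G.E a) (haW : a.IsW) :
    0 < G.ts a := by
  have hi : (⟨none, none, .write a.loc 0⟩ : Event Tid Loc Val) ∈ Init Tid Loc Val := ⟨a.loc, rfl⟩
  have hne : (⟨none, none, .write a.loc 0⟩ : Event Tid Loc Val) ≠ a := fun h => ha.2 (h ▸ hi)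
  rcases G.mo_total _ (G.wf.init_subset hi) a ha.1 trivial haW rfl hne with hmo | hmo
  · exact (Nat.zero_le _).trans_lt (ts_lt hf hmo)
  · exact absurd hi (hs.proper_of_mo hmo).2

theorem SCPerLoc.mo_of_rf (hs : G.SCPerLoc) (h : G.rf d a) (haW : a.IsW) : G.mo d a := by
  obtain ⟨hd, ha⟩ := G.rf_mem d a h
  obtain ⟨hdW, -, hloc, -⟩ := G.rf_match d a h
  have hne : d ≠ a := by
    rintro rfl
    exact hs d (.single (Or.inr (Or.inl h)))
  exact (G.mo_total d hd a ha hdW haW hloc hne).resolve_right fun hmo =>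
    hs d (.tail (.single (Or.inr (Or.inl h))) (Or.inr (Or.inr (Or.inl hmo))))

theorem SCPerLoc.mo_iff_of_rf (hs : G.SCPerLoc) (h : G.rf d a) (haW : a.IsW) :
    G.mo w a ↔ w = d ∨ G.mo w d := by
  have hmo := hs.mo_of_rf h haW
  constructor
  · intro hwa
    by_contra! hnot
    obtain ⟨hwW, -, hloc⟩ := G.mo_match w a hwa
    obtain ⟨hdW, -, hloc', -⟩ := G.rf_match d a h
    have hdw := (G.mo_total w (G.mo_mem w a hwa).1 d (G.rf_mem d a h).1 hwW hdW
      (hloc.trans hloc'.symm) hnot.1).resolve_left hnot.2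
    have hfr : G.fr a w := ⟨⟨d, h, hdw⟩, fun heq => G.mo_irrefl a (by simpa [heq.1] using hwa)⟩
    exact hs a (.tail (.single (Or.inr (Or.inr (Or.inr hfr)))) (Or.inr (Or.inr (Or.inl hwa))))
  · rintro (rfl | hwd)
    · exact hmo
    · exact G.mo_trans w d a hwd hmo

theorem ts_eq_succ_of_rf (hf : PrefixFinite G.E G.mo) (hs : G.SCPerLoc) (h : G.rf d a)
    (haW : a.IsW) : G.ts a = G.ts d + 1 := by
  have hset : {w | G.mo w a} = insert d {w | G.mo w d} :=
    Set.ext fun _ => hs.mo_iff_of_rf h haW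
  rw [ts, ts, hset,
    Set.ncard_insert_of_notMem (s := {w | G.mo w d}) (G.mo_irrefl d) (hf d (G.rf_mem d a h).1)]

theorem Allows.mono (h : G.Allows t a) (ht : t' ≤ t) : G.Allows t' a :=
  ⟨fun d hd => ht.trans (h.1 d hd), fun haW => ht.trans_lt (h.2 haW)⟩

theorem Allows.sup (h : G.Allows t a) (h' : G.Allows t' a) : G.Allows (t ⊔ t') a :=
  ⟨fun d hd => sup_le (h.1 d hd) (h'.1 d hd), fun haW => max_lt (h.2 haW) (h'.2 haW)⟩

theorem Allows.update [DecidableEq Loc] {V : View Loc} {x : Loc} (h : G.Allows (V a.loc) a)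
    (ht : x = a.loc → G.Allows t a) : G.Allows (Function.update V x t a.loc) a := by
  by_cases hx : x = a.loc
  · rw [hx, Function.update_self]
    exact ht hx
  · rwa [Function.update_of_ne (Ne.symm hx)]

theorem allows_zero (hf : PrefixFinite G.E G.mo) (hs : G.SCPerLoc) (ha : Proper G.E a) :
    G.Allows 0 a :=
  ⟨fun _ _ => Nat.zero_le _, ts_pos hf hs ha⟩

theorem allows_ts (hf : PrefixFinite G.E G.mo) (hw : w ∈ G.E) (hW : w.IsW) (ha : a ∈ G.E)
    (hloc : w.loc = a.loc) (hne : w ≠ a) (hfr : ¬ G.fr a w) (hmo : ¬ G.mo a w) :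
    G.Allows (G.ts w) a := by
  refine ⟨fun d hd => ?_, fun haW =>
    ts_lt hf ((G.mo_total w hw a ha hW haW hloc hne).resolve_right hmo)⟩
  obtain ⟨hdW, -, hloc', -⟩ := G.rf_match d a hd
  exact ts_le_of_not_mo hf hw (G.rf_mem d a hd).1 hW hdW (hloc.trans hloc'.symm) fun hdw =>
    hfr ⟨⟨d, hd, hdw⟩, fun heq => hne heq.1.symm⟩

end EGraph

end Timestamps

section ViewInvariant

variable {Tid Loc Val : Type*} [Zero Val]

/-- `m` may be used as the message of the write `w`; its view does not block the events that come
after `w` in `H`. -/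
structure Represents (G : EGraph Tid Loc Val) (H : Event Tid Loc Val → Event Tid Loc Val → Prop)
    (w : Event Tid Loc Val) (m : Msg Loc Val) : Prop where
  loc_eq : m.loc = w.loc
  val_eq : w.valW = some m.val
  ts_eq : m.ts = G.ts w
  view_loc : m.view m.loc = m.ts
  allows : ∀ a, H w a → G.Allows (m.view a.loc) a

/-- The messages in `M` represent exactly the writes scheduled in the first `n` steps. -/
structure ViewMemInv (G : EGraph Tid Loc Val) (H : Event Tid Loc Val → Event Tid Loc Val → Prop)
    (T : Event Tid Loc Val → ℕ) (n : ℕ) (M : Set (Msg Loc Val)) : Prop where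
  sound : ∀ m ∈ M, ∃ w ∈ G.E, T w ≤ n ∧ Represents G H w m
  complete : ∀ w ∈ G.E, w.IsW → T w ≤ n → ∃ m ∈ M, Represents G H w m

/-- The view of a thread does not block the events scheduled for this thread after `n` steps, nor
the events that come after them in `H`. -/
def ThreadInv (G : EGraph Tid Loc Val) (H : Event Tid Loc Val → Event Tid Loc Val → Prop)
    (T : Event Tid Loc Val → ℕ) (n : ℕ) (tview : Tid → View Loc) : Prop :=
  ∀ τ b a, Proper G.E b → b.tid = some τ → n < T b → Relation.ReflGen H b a →
    G.Allows (tview τ a.loc) a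

/-- The states reached after `n` steps of the simulation of a graph. -/
structure ViewInv (G : EGraph Tid Loc Val) (H : Event Tid Loc Val → Event Tid Loc Val → Prop)
    (T : Event Tid Loc Val → ℕ) (n : ℕ) (q : VState Tid Loc Val) : Prop where
  mem : ViewMemInv G H T n q.mem
  thread : ThreadInv G H T n q.tview

variable {G : EGraph Tid Loc Val} {H : Event Tid Loc Val → Event Tid Loc Val → Prop}
  {T : Event Tid Loc Val → ℕ} {n : ℕ} {M : Set (Msg Loc Val)} {m : Msg Loc Val}
  {tview : Tid → View Loc} {q : VState Tid Loc Val} {a e w : Event Tid Loc Val} {τ : Tid}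

theorem Represents.isW (h : Represents G H w m) : w.IsW :=
  (ELab.isW_iff _).2 ⟨m.val, h.val_eq⟩

theorem ViewMemInv.stay (h : ViewMemInv G H T n M) (hn : ∀ w ∈ G.E, w.IsW → T w ≠ n + 1) :
    ViewMemInv G H T (n + 1) M where
  sound m hm :=
    let ⟨w, hw, hTw, hwm⟩ := h.sound m hm
    ⟨w, hw, hTw.trans n.le_succ, hwm⟩
  complete w hw hW hTw :=
    h.complete w hw hW (Nat.le_of_lt_succ (hTw.lt_of_ne (hn w hw hW)))

theorem ViewMemInv.insert (h : ViewMemInv G H T n M) (he : e ∈ G.E) (hTe : T e = n + 1)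
    (hn : ∀ w ∈ G.E, T w = n + 1 → w = e) (hem : Represents G H e m) :
    ViewMemInv G H T (n + 1) (M ∪ {m}) := by
  constructor
  · rintro m' (hm' | rfl)
    · obtain ⟨w, hw, hTw, hwm⟩ := h.sound m' hm'
      exact ⟨w, hw, hTw.trans n.le_succ, hwm⟩
    · exact ⟨e, he, hTe.le, hem⟩
  · intro w hw hW hTw
    rcases hTw.lt_or_eq with hlt | heq
    · obtain ⟨m', hm', hwm⟩ := h.complete w hw hW (Nat.le_of_lt_succ hlt)
      exact ⟨m', Or.inl hm', hwm⟩
    · exact ⟨m, Or.inr rfl, hn w hw heq ▸ hem⟩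

theorem ViewMemInv.fresh (h : ViewMemInv G H T n M) (hf : PrefixFinite G.E G.mo) (he : e ∈ G.E)
    (heW : e.IsW) (hTe : n < T e) : ¬ ∃ m ∈ M, m.loc = e.loc ∧ m.ts = G.ts e := by
  rintro ⟨m, hm, hloc, hts⟩
  obtain ⟨w, hw, hTw, hwm⟩ := h.sound m hm
  obtain rfl := EGraph.ts_inj hf he hw heW hwm.isW (hloc.symm.trans hwm.loc_eq)
    (hts.symm.trans hwm.ts_eq)
  exact hTe.not_ge hTw

theorem ThreadInv.stay (h : ThreadInv G H T n tview) : ThreadInv G H T (n + 1) tview :=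
  fun τ b a hb hτ hTb => h τ b a hb hτ (by omega)

theorem ThreadInv.update [DecidableEq Tid] (h : ThreadInv G H T n tview) {V : View Loc}
    (hV : ∀ b a, Proper G.E b → b.tid = some τ → n + 1 < T b → Relation.ReflGen H b a →
      G.Allows (V a.loc) a) :
    ThreadInv G H T (n + 1) (Function.update tview τ V) := by
  intro τ' b a hb hτ' hTb hba
  by_cases hττ : τ' = τ
  · subst hττ
    rw [Function.update_self]
    exact hV b a hb hτ' hTb hba
  · rw [Function.update_of_ne hττ]
    exact h.stay τ' b a hb hτ' hTb hba

/-- The assumptions under which a view-based system simulates a graph in the order of the schedule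
`T`, where `H` is the order along which views are passed on. Odd positions leave every second step
to propagation. -/
structure ViewPlan (G : EGraph Tid Loc Val) (upd : View Loc → Msg Loc Val → View Loc)
    (H : Event Tid Loc Val → Event Tid Loc Val → Prop) (T : Event Tid Loc Val → ℕ) : Prop where
  fair : G.Fair
  sched : Schedule G.E T
  odd : ∀ e, Proper G.E e → Odd (T e)
  po_le : ∀ a b, G.po a b → H a b
  trans : ∀ a b c, H a b → H b c → H a c
  proper : ∀ a b, H a b → Proper G.E b
  acyclic : ClosureIrrefl fun a b => (H a b ∧ a.loc = b.loc) ∨ G.rf a b ∨ G.mo a b ∨ G.fr a b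
  mono : ∀ a b, H a b → T a < T b
  mono_rf : ∀ a b, G.rf a b → T a < T b
  advances : Advances upd
  upd_le : (∀ V m, upd V m ≤ V ⊔ m.view) ∧ (∀ a b, G.rf a b → H a b) ∨
    ∀ V m x, x ≠ m.loc → upd V m x ≤ V x

variable {upd : View Loc → Msg Loc Val → View Loc}

namespace ViewPlan

theorem scPerLoc (K : ViewPlan G upd H T) : G.SCPerLoc :=
  K.acyclic.mono fun a b h => h.imp_left fun h => ⟨K.po_le a b h.1, h.2⟩

theorem allows_zero (K : ViewPlan G upd H T) (ha : Proper G.E a) : G.Allows 0 a :=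
  EGraph.allows_zero K.fair.1 K.scPerLoc ha

/-- An `fr`- or `mo`-edge from `a` back to `w` would close a cycle. -/
theorem allows_ts (K : ViewPlan G upd H T) (hw : w ∈ G.E) (hW : w.IsW) (ha : a ∈ G.E)
    (hloc : w.loc = a.loc) (hwa : Relation.TransGen
      (fun a b => (H a b ∧ a.loc = b.loc) ∨ G.rf a b ∨ G.mo a b ∨ G.fr a b) w a) :
    G.Allows (G.ts w) a := by
  refine EGraph.allows_ts K.fair.1 hw hW ha hloc ?_
    (fun hfr => K.acyclic w (hwa.tail (Or.inr (Or.inr (Or.inr hfr)))))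
    (fun hmo => K.acyclic w (hwa.tail (Or.inr (Or.inr (Or.inl hmo)))))
  rintro rfl
  exact K.acyclic w hwa

theorem allows_update_ts [DecidableEq Loc] (K : ViewPlan G upd H T) (he : e ∈ G.E) (heW : e.IsW)
    (hea : H e a) {V : View Loc} (hV : G.Allows (V a.loc) a) :
    G.Allows (Function.update V e.loc (G.ts e) a.loc) a :=
  hV.update fun hloc =>
    K.allows_ts he heW (K.proper e a hea).1 hloc (.single (Or.inl ⟨hea, hloc⟩))

theorem allows_upd (K : ViewPlan G upd H T) {d : Event Tid Loc Val} (hrf : G.rf d e)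
    (hea : H e a) {V : View Loc} (hV : G.Allows (V a.loc) a) (hm : Represents G H d m)
    (hle : V m.loc ≤ m.ts) : G.Allows (upd V m a.loc) a := by
  obtain ⟨hdW, -, hde, -⟩ := G.rf_match d e hrf
  by_cases hloc : d.loc = a.loc
  · rw [← hloc, ← hm.loc_eq, (K.advances V m hle hm.view_loc).1, hm.ts_eq]
    exact K.allows_ts (G.rf_mem d e hrf).1 hdW (K.proper e a hea).1 hloc
      (.tail (.single (Or.inr (Or.inl hrf))) (Or.inl ⟨hea, hde.symm.trans hloc⟩))
  · rcases K.upd_le with ⟨hupd, hrfH⟩ | hupd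
    · exact (hV.sup (hm.allows a (K.trans d e a (hrfH d e hrf) hea))).mono (hupd V m a.loc)
    · exact hV.mono (hupd V m a.loc fun heq => hloc (hm.loc_eq.symm.trans heq.symm))

end ViewPlan

theorem ViewInv.stay (h : ViewInv G H T n q) (K : ViewPlan G upd H T)
    (hn : ∀ e, Proper G.E e → T e ≠ n + 1) : ViewInv G H T (n + 1) q :=
  ⟨h.mem.stay fun w hw _ hTw => hn w (K.sched.proper_of_pos hw (by omega)) hTw, h.thread.stay⟩

theorem ViewInv.zero (K : ViewPlan G upd H T) : ViewInv G H T 0 viewInit := by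
  refine ⟨⟨?_, fun w hw _ hTw => ?_⟩, fun τ b a hb _ _ hba => ?_⟩
  · rintro _ ⟨x, rfl⟩
    have hi : (⟨none, none, .write x 0⟩ : Event Tid Loc Val) ∈ Init Tid Loc Val := ⟨x, rfl⟩
    exact ⟨_, G.wf.init_subset hi, (K.sched.init _ hi).le, rfl, rfl,
      (EGraph.ts_init K.scPerLoc hi).symm, rfl, fun a ha => K.allows_zero (K.proper _ a ha)⟩
  · have hi : w ∈ Init Tid Loc Val := by
      by_contra hi
      exact (K.sched.pos w ⟨hw, hi⟩).not_ge hTw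
    exact ⟨_, ⟨w.loc, rfl⟩, rfl, valW_of_mem_Init hi, (EGraph.ts_init K.scPerLoc hi).symm, rfl,
      fun a ha => K.allows_zero (K.proper _ a ha)⟩
  · cases hba with
    | refl => exact K.allows_zero hb
    | single hba => exact K.allows_zero (K.proper b a hba)

theorem ThreadInv.event [DecidableEq Tid] (h : ThreadInv G H T n tview) (K : ViewPlan G upd H T)
    (he : Proper G.E e) (hTe : T e = n + 1) (hτ : e.tid = some τ) {V : View Loc}
    (hV : ∀ a, H e a → G.Allows (V a.loc) a) :
    ThreadInv G H T (n + 1) (Function.update tview τ V) := by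
  refine h.update fun b a hb hbτ hTb hba => hV a ?_
  have heb : H e b := K.po_le e b ⟨he.1, hb.1,
    K.sched.lt_of_same_thread G.wf he hb (hτ.trans hbτ.symm) (hTe.trans_lt hTb)⟩
  cases hba with
  | refl => exact heb
  | single hba => exact K.trans e b a heb hba

end ViewInvariant

section ViewGraphToRun

variable {Tid Loc Val : Type*} [Zero Val] [DecidableEq Tid]
  {G : EGraph Tid Loc Val} {H : Event Tid Loc Val → Event Tid Loc Val → Prop}
  {T : Event Tid Loc Val → ℕ} {upd : View Loc → Msg Loc Val → View Loc} {n : ℕ}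
  {q : VState Tid Loc Val} {e w : Event Tid Loc Val} {τ : Tid}

theorem ViewInv.exists_read (h : ViewInv G H T n q) (K : ViewPlan G upd H T)
    (he : Proper G.E e) (hTe : T e = n + 1) (hτ : e.tid = some τ) {v : Val}
    (hv : e.valR = some v) :
    ∃ V d, G.rf d e ∧ viewRead upd τ e.loc v q ⟨q.mem, Function.update q.tview τ V⟩ ∧
      V e.loc = G.ts d ∧ ∀ a, H e a → G.Allows (V a.loc) a := by
  obtain ⟨d, hrf⟩ := G.rf_total e he.1 ((ELab.isR_iff _).2 ⟨v, hv⟩)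
  obtain ⟨hdW, -, hloc, hval⟩ := G.rf_match d e hrf
  obtain ⟨m, hm, hdm⟩ := h.mem.complete d (G.rf_mem d e hrf).1 hdW
    (Nat.le_of_lt_succ ((K.mono_rf d e hrf).trans_eq hTe))
  have hmloc : m.loc = e.loc := hdm.loc_eq.trans hloc
  have hmval : m.val = v := Option.some.inj (hdm.val_eq.symm.trans (hval.trans hv))
  have hallows : ∀ a, Relation.ReflGen H e a → G.Allows (q.tview τ a.loc) a := fun a =>
    h.thread τ e a he hτ (by omega)
  have hle : q.tview τ m.loc ≤ m.ts := by
    rw [hmloc, hdm.ts_eq]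
    exact (hallows e .refl).1 d hrf
  refine ⟨upd (q.tview τ) m, d, hrf, ⟨m, hm, hmloc, hmval, hmloc ▸ hle, rfl⟩, ?_, fun a ha =>
    K.allows_upd hrf ha (hallows a (.single ha)) hdm hle⟩
  rw [← hmloc, (K.advances _ m hle hdm.view_loc).1, hdm.ts_eq]

variable [DecidableEq Loc]

theorem ViewInv.exists_write (h : ViewInv G H T n q) (K : ViewPlan G upd H T)
    (he : Proper G.E e) (hTe : T e = n + 1) (hτ : e.tid = some τ) {v : Val}
    (hv : e.valW = some v) {V : View Loc} (hV : ∀ a, H e a → G.Allows (V a.loc) a)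
    (hlt : V e.loc < G.ts e) :
    ∃ q', viewWrite τ e.loc v ⟨q.mem, Function.update q.tview τ V⟩ q' ∧
      q'.tview τ e.loc = G.ts e ∧ ViewInv G H T (n + 1) q' := by
  have heW : e.IsW := (ELab.isW_iff _).2 ⟨v, hv⟩
  let V' := Function.update V e.loc (G.ts e)
  have hV' : ∀ a, H e a → G.Allows (V' a.loc) a := fun a ha =>
    K.allows_update_ts he.1 heW ha (hV a ha)
  refine ⟨⟨q.mem ∪ {⟨e.loc, v, G.ts e, V'⟩}, Function.update q.tview τ V'⟩,
    ⟨G.ts e, h.mem.fresh K.fair.1 he.1 heW (by omega), by simpa using hlt, by simp [V'], by simp⟩,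
    by simp [V'], ?_, h.thread.event K he hTe hτ hV'⟩
  exact h.mem.insert he.1 hTe (fun w hw hTw => K.sched.eq_of_mem he hw (hTw.trans hTe.symm))
    ⟨rfl, hv, rfl, Function.update_self .., hV'⟩

theorem ViewInv.exists_event_step (h : ViewInv G H T n q) (K : ViewPlan G upd H T)
    (he : Proper G.E e) (hTe : T e = n + 1) (hτ : e.tid = some τ) :
    ∃ q', viewStep upd q (Sum.inl (τ, e.lab)) q' ∧ ViewInv G H T (n + 1) q' := by
  obtain ⟨sn, tid, lab⟩ := e
  cases lab with
  | read x v =>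
    obtain ⟨V, d, -, hread, -, hV⟩ := h.exists_read K he hTe hτ rfl
    refine ⟨_, hread, h.mem.stay ?_, h.thread.event K he hTe hτ hV⟩
    rintro w hw hW hTw
    obtain rfl := K.sched.eq_of_mem he hw (hTw.trans hTe.symm)
    exact hW
  | write x v =>
    have hallows := fun a => h.thread τ _ a he hτ (by omega)
    obtain ⟨q', hwrite, -, hq'⟩ := h.exists_write K he hTe hτ rfl
      (fun a ha => hallows a (.single ha)) ((hallows _ .refl).2 trivial)
    rw [Function.update_eq_self] at hwrite
    exact ⟨q', hwrite, hq'⟩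
  | rmw x vR vW =>
    obtain ⟨V, d, hrf, hread, hVd, hV⟩ := h.exists_read K he hTe hτ rfl
    have hts := EGraph.ts_eq_succ_of_rf K.fair.1 K.scPerLoc hrf trivial
    obtain ⟨q', hwrite, hview, hq'⟩ := h.exists_write K he hTe hτ rfl hV (by omega)
    refine ⟨q', ⟨_, hread, hwrite, hview.trans ?_⟩, hq'⟩
    simp only [hts, ← hVd, Function.update_self]
    rfl

/-- The write `w` and all events that come before it in `fr` or `mo` are scheduled in the first `n`
steps; from then on, `w` may be propagated to every thread. -/
def Settled (G : EGraph Tid Loc Val) (T : Event Tid Loc Val → ℕ) (n : ℕ)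
    (w : Event Tid Loc Val) : Prop :=
  ∀ a, a = w ∨ G.fr a w ∨ G.mo a w → T a ≤ n

theorem ViewInv.exists_prop_step (h : ViewInv G H T n q) (K : ViewPlan G upd H T)
    (hn : ∀ e, Proper G.E e → T e ≠ n + 1) (hw : w ∈ G.E) (hW : w.IsW)
    (hsettled : Settled G T n w) (hlt : q.tview τ w.loc < G.ts w) :
    ∃ m q', viewStep upd q (Sum.inr (τ, m)) q' ∧ ViewInv G H T (n + 1) q' ∧
      G.ts w ≤ q'.tview τ w.loc := by
  obtain ⟨m, hm, hwm⟩ := h.mem.complete w hw hW (hsettled w (Or.inl rfl))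
  refine ⟨m, _, ⟨hm, by rwa [hwm.loc_eq, hwm.ts_eq], rfl⟩,
    ⟨(h.stay K hn).mem, h.thread.update fun b a hb hτ hTb hba => ?_⟩,
    by simp [hwm.loc_eq, hwm.ts_eq]⟩
  have hlater : a ∈ G.E ∧ n < T a := by
    cases hba with
    | refl => exact ⟨hb.1, by omega⟩
    | single hba => exact ⟨(K.proper b a hba).1, by have := K.mono b a hba; omega⟩
  have hnot := fun hback => hlater.2.not_ge (hsettled a hback)
  rw [hwm.loc_eq, hwm.ts_eq]
  exact (h.thread τ b a hb hτ (by omega) hba).update fun hloc =>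
    EGraph.allows_ts K.fair.1 hw hW hlater.1 hloc (fun heq => hnot (Or.inl heq.symm))
      (fun hfr => hnot (Or.inr (Or.inl hfr))) fun hmo => hnot (Or.inr (Or.inr hmo))

theorem ViewInv.exists_idle_step (h : ViewInv G H T n q) (K : ViewPlan G upd H T)
    (hn : ∀ e, Proper G.E e → T e ≠ n + 1) (target : Option ({e // Proper G.E e} × Tid)) :
    ∃ o q', (∀ σ, o ≠ some (Sum.inl σ)) ∧ (memView upd).StepOpt q o q' ∧
      ViewInv G H T (n + 1) q' ∧ ∀ w τ, target = some (w, τ) → w.1.IsW → Settled G T n w.1 →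
        G.ts w.1 ≤ q'.tview τ w.1.loc := by
  by_cases hprop : ∃ w τ, target = some (w, τ) ∧ w.1.IsW ∧ Settled G T n w.1 ∧
      q.tview τ w.1.loc < G.ts w.1
  · obtain ⟨w, τ, rfl, hW, hsettled, hlt⟩ := hprop
    obtain ⟨m, q', hstep, hq', hle⟩ := h.exists_prop_step K hn w.2.1 hW hsettled hlt
    refine ⟨some (Sum.inr (τ, m)), q', by simp, hstep, hq', ?_⟩
    rintro _ _ ⟨⟩ - -
    exact hle
  · exact ⟨none, q, nofun, rfl, h.stay K hn, fun w τ htarget hW hsettled =>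
      not_lt.1 fun hlt => hprop ⟨w, τ, htarget, hW, hsettled, hlt⟩⟩

theorem ViewInv.exists_step (h : ViewInv G H T n q) (K : ViewPlan G upd H T)
    (target : Option ({e // Proper G.E e} × Tid)) :
    ∃ o q', (Emits G.E T n o ∧ ((∀ e, Proper G.E e → T e ≠ n + 1) → ∀ w τ,
        target = some (w, τ) → w.1.IsW → Settled G T n w.1 → G.ts w.1 ≤ q'.tview τ w.1.loc)) ∧
      (memView upd).StepOpt q o q' ∧ ViewInv G H T (n + 1) q' := by
  by_cases hevent : ∃ e, Proper G.E e ∧ T e = n + 1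
  · obtain ⟨e, he, hTe⟩ := hevent
    obtain ⟨τ, -, hτ, -⟩ := G.wf.exists_tid_sn he
    obtain ⟨q', hstep, hq'⟩ := h.exists_event_step K he hTe hτ
    exact ⟨_, q', ⟨.of_event K.sched he hTe hτ, fun hn => absurd hTe (hn e he)⟩, hstep, hq'⟩
  · have hn : ∀ e, Proper G.E e → T e ≠ n + 1 := fun e he hTe => hevent ⟨e, he, hTe⟩
    obtain ⟨o, q', ho, hstep, hq', hprop⟩ := h.exists_idle_step K hn target
    exact ⟨o, q', ⟨.of_no_event ho hn, fun _ => hprop⟩, hstep, hq'⟩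

omit [DecidableEq Tid] [DecidableEq Loc] in
theorem EGraph.Fair.exists_settled (hfair : G.Fair) (T : Event Tid Loc Val → ℕ) (hw : w ∈ G.E) :
    ∃ N, ∀ n, N ≤ n → Settled G T n w := by
  obtain ⟨N, hN⟩ := ((((Set.finite_singleton w).union
    ((hfair.2 w hw).union (hfair.1 w hw))).image T).bddAbove)
  exact ⟨N, fun n hn a ha => (hN ⟨a, ha, rfl⟩).trans hn⟩

theorem exists_seq_infinitely_often (α : Type*) [Countable α] :
    ∃ s : ℕ → Option α, ∀ a N, ∃ k, N ≤ k ∧ s k = some a := by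
  have := Encodable.ofCountable α
  exact ⟨fun k => Encodable.decode k.unpair.1, fun a N =>
    ⟨Nat.pair (Encodable.encode a) N, Nat.right_le_pair _ _, by simp⟩⟩

theorem ViewPlan.exists_not_enabled (K : ViewPlan G upd H T) {q : ℕ → VState Tid Loc Val}
    (hinv : ∀ n, ViewInv G H T n (q n)) {s : ℕ → Option ({e // Proper G.E e} × Tid)}
    (hs : ∀ a N, ∃ k, N ≤ k ∧ s k = some a)
    (hprop : ∀ n, (∀ e, Proper G.E e → T e ≠ n + 1) → ∀ w τ, s (n / 2) = some (w, τ) →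
      w.1.IsW → Settled G T n w.1 → G.ts w.1 ≤ (q (n + 1)).tview τ w.1.loc)
    (θ : Tid × Msg Loc Val) (k : ℕ) :
    ∃ j, k ≤ j ∧ ¬ (memView upd).Enabled (q j) (Sum.inr θ) := by
  obtain ⟨τ, m⟩ := θ
  by_contra! henabled
  obtain ⟨_, hm, hlt, -⟩ := henabled k le_rfl
  obtain ⟨w, hwE, -, hwm⟩ := (hinv k).mem.sound m hm
  have hw : Proper G.E w := ⟨hwE, fun hi =>
    Nat.not_lt_zero _ (hlt.trans_eq (hwm.ts_eq.trans (EGraph.ts_init K.scPerLoc hi)))⟩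
  obtain ⟨N, hN⟩ := K.fair.exists_settled T hwE
  obtain ⟨j, hj, hsj⟩ := hs (⟨w, hw⟩, τ) (max N k)
  have hidle : ∀ e, Proper G.E e → T e ≠ 2 * j + 1 + 1 := fun e he hTe => by
    obtain ⟨i, hi⟩ := K.odd e he
    omega
  have hle : G.ts w ≤ (q (2 * j + 1 + 1)).tview τ w.loc :=
    hprop (2 * j + 1) hidle ⟨w, hw⟩ τ (by rwa [show (2 * j + 1) / 2 = j by omega]) hwm.isW
      (hN _ (by omega))
  obtain ⟨_, -, hlt', -⟩ := henabled (2 * j + 1 + 1) (by omega)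
  rw [hwm.loc_eq, hwm.ts_eq] at hlt'
  exact hlt'.not_ge hle

theorem ViewPlan.mem_behMF [Finite Tid] (K : ViewPlan G upd H T) {β : Behavior Tid Loc Val}
    (hβ : eventsOf β = G.E) : β ∈ BehMF (memView (Tid := Tid) upd) := by
  have := G.wf.countable_proper
  obtain ⟨s, hs⟩ := exists_seq_infinitely_often ({e // Proper G.E e} × Tid)
  obtain ⟨q, l, hrun, hinv, hl⟩ := (memView (Tid := Tid) upd).exists_stutterRun (ViewInv G H T) _
    (ViewInv.zero K) fun n q hq => hq.exists_step K (s (n / 2))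
  refine mem_BehMF_iff.2 ⟨q, l, hrun, Or.inr fun θ k henabled => ?_, ?_⟩
  · obtain ⟨j, hj, hdisabled⟩ := K.exists_not_enabled hinv hs (fun n => (hl n).2) θ k
    exact absurd (henabled j hj) hdisabled
  · have hT := K.sched
    have hemits := fun n => (hl n).1
    rw [← hβ] at hT hemits
    exact hT.isBehavior hemits

end ViewGraphToRun

section ViewSchedule

variable {Tid Loc Val : Type*} [Zero Val] {G : EGraph Tid Loc Val} {a b : Event Tid Loc Val}

theorem EGraph.proper_of_hbRA (h : G.hbRA a b) : Proper G.E b := by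
  obtain ⟨c, -, hpo | hrf⟩ := Relation.TransGen.tail'_iff.1 h
  · exact ⟨hpo.2.1, hpo.2.2.notMem_Init⟩
  · exact proper_of_isR (G.rf_mem c b hrf).2 (G.rf_match c b hrf).2.1

theorem Schedule.strictMono_comp {E : Set (Event Tid Loc Val)} {T : Event Tid Loc Val → ℕ}
    (h : Schedule E T) {g : ℕ → ℕ} (hg : StrictMono g) (hzero : g 0 = 0) : Schedule E (g ∘ T) where
  init e he := by rw [Function.comp_apply, h.init e he, hzero]
  pos e he := hzero ▸ hg (h.pos e he)
  inj a b ha hb hab := h.inj a b ha hb (hg.injective hab)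
  mono a b ha hb hab := hg (h.mono a b ha hb hab)

variable [Finite Tid]

theorem EGraph.exists_schedule_hbRA (h : ∀ a, ¬ G.hbRA a a) :
    ∃ T, Schedule G.E T ∧ (∀ e, Proper G.E e → Odd (T e)) ∧ ∀ a b, G.hbRA a b → T a < T b := by
  obtain ⟨T, hT, hmono⟩ := G.wf.exists_schedule (R := fun a b => G.po a b ∨ G.rf a b) h
    (fun a b ha hb hab => Or.inl ⟨ha, hb, hab⟩) fun b _ =>
      ((G.wf.finite_seqBefore b).union (G.finite_rf b)).subset fun a ha =>
        ha.2.imp (fun hpo => ⟨ha.1, hpo.2.2⟩) id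
  have hdouble : StrictMono fun n => 2 * n - 1 := fun m n hmn => by dsimp only; omega
  refine ⟨_, hT.strictMono_comp hdouble rfl, fun e he => ⟨T e - 1, ?_⟩, fun a b hab => hdouble ?_⟩
  · have := hT.pos e he
    simp only [Function.comp_apply]
    omega
  · refine Relation.TransGen.trans_induction_on (motive := fun {a b} _ => T a < T b) hab ?_ ?_
    · intro a b hab
      exact hmono a b (hab.elim And.left fun hrf => (G.rf_mem a b hrf).1)
        (EGraph.proper_of_hbRA (.single hab)) hab
    · exact fun _ _ => lt_trans

variable [DecidableEq Tid] [DecidableEq Loc]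

theorem ra_behDecl_subset :
    BehDecl (graphsRA Tid Loc Val ∩ graphsFair Tid Loc Val) ⊆ BehMF (memRA Tid Loc Val) := by
  rintro β ⟨G, ⟨hG, hfair⟩, hβ⟩
  obtain ⟨T, hT, hodd, hmono⟩ := EGraph.exists_schedule_hbRA fun a ha =>
    hG a (.single (Or.inl ⟨ha, rfl⟩))
  have K : ViewPlan G (fun V m => V ⊔ m.view) G.hbRA T :=
    { fair := hfair
      sched := hT
      odd := hodd
      po_le := fun _ _ hpo => .single (Or.inl hpo)
      trans := fun _ _ _ => Relation.TransGen.trans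
      proper := fun _ _ => EGraph.proper_of_hbRA
      acyclic := hG
      mono := hmono
      mono_rf := fun a b hrf => hmono a b (.single (Or.inr hrf))
      advances := advances_join
      upd_le := Or.inl ⟨fun _ _ => le_rfl, fun _ _ hrf => .single (Or.inr hrf)⟩ }
  exact K.mem_behMF hβ

theorem strongCOH_behDecl_subset :
    BehDecl (graphsStrongCOH Tid Loc Val ∩ graphsFair Tid Loc Val) ⊆
      BehMF (memStrongCOH Tid Loc Val) := by
  rintro β ⟨G, ⟨⟨hhb, hG⟩, hfair⟩, hβ⟩
  obtain ⟨T, hT, hodd, hmono⟩ := EGraph.exists_schedule_hbRA hhb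
  have K : ViewPlan G (fun V m => Function.update V m.loc m.ts) G.po T :=
    { fair := hfair
      sched := hT
      odd := hodd
      po_le := fun _ _ hpo => hpo
      trans := fun _ _ _ hab hbc => ⟨hab.1, hbc.2.1, hab.2.2.trans hbc.2.2⟩
      proper := fun _ _ hpo => ⟨hpo.2.1, hpo.2.2.notMem_Init⟩
      acyclic := hG
      mono := fun a b hpo => hmono a b (.single (Or.inl hpo))
      mono_rf := fun a b hrf => hmono a b (.single (Or.inr hrf))
      advances := advances_update
      upd_le := Or.inr fun _ _ _ hx => (Function.update_of_ne hx ..).le }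
  exact K.mem_behMF hβ

end ViewSchedule

end FairMM

theorem theorem4p3 {Tid : Type*} {Loc : Type*} {Val : Type*}
    [Finite Tid] [DecidableEq Tid] [DecidableEq Loc] [Zero Val] :
    FairMM.BehMF (FairMM.memSC Tid Loc Val) =
        FairMM.BehDecl (FairMM.graphsSC Tid Loc Val ∩ FairMM.graphsFair Tid Loc Val) ∧
      FairMM.BehMF (FairMM.memTSO Tid Loc Val) =
        FairMM.BehDecl (FairMM.graphsTSO Tid Loc Val ∩ FairMM.graphsFair Tid Loc Val) ∧
      FairMM.BehMF (FairMM.memRA Tid Loc Val) =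
        FairMM.BehDecl (FairMM.graphsRA Tid Loc Val ∩ FairMM.graphsFair Tid Loc Val) ∧
      FairMM.BehMF (FairMM.memStrongCOH Tid Loc Val) =
        FairMM.BehDecl (FairMM.graphsStrongCOH Tid Loc Val ∩ FairMM.graphsFair Tid Loc Val) :=
  ⟨FairMM.sc_behMF_subset.antisymm FairMM.sc_behDecl_subset,
    FairMM.tso_behMF_subset.antisymm FairMM.tso_behDecl_subset,
    FairMM.ra_behMF_subset.antisymm FairMM.ra_behDecl_subset,
    FairMM.strongCOH_behMF_subset.antisymm FairMM.strongCOH_behDecl_subset⟩
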